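/- Let $k$ be a number field with ring of integers $\mathfrak o$. A toroidal curve over $\mathfrak o$ is a pair $(\mathfrak C,\mathfrak D)$ consisting of an integral scheme $\mathfrak C$, flat and projective over $\mathfrak o$ and birational over $\mathfrak o$ to $\mathbb P^1_{\mathfrak o}$, and a reduced effective divisor $\mathfrak D\subset\mathfrak C$ (a reduced closed subscheme of pure codimension one), flat over $\mathfrak o$, with the following property. If $(C,D)$ is the generic fiber of $(\mathfrak C,\mathfrak D)$ and $\phi:\mathbb P^1_k\to C$ is the normalization, then $\sum_{x\in\phi^{-1}(D)}[k(x):k]=2$, where $k(x)$ is the residue field and $\phi^{-1}(D)$ is regarded as a set of points, and each $k(x)$ is separable over $k$. Its splitting field is $K=k(x)$ for any $x\in\phi^{-1}(D)$, so that $[K:k]\in\{1,2\}$. Let $\mathfrak C_0=\mathfrak C\setminus\mathfrak D$, and let $\mathfrak C_0(\mathfrak o)$ be the set of its integral points, that is, of morphisms $\operatorname{Spec}\mathfrak o\to\mathfrak C_0$ over $\mathfrak o$. An integral point is generically regular if it maps the generic point of $\operatorname{Spec}\mathfrak o$ to a regular point. Write $\infty_k$ and $\infty_K$ for the sets of archimedean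 places of $k$ and $K$. Corollary 2.11. Let $(\mathfrak C,\mathfrak D)$ be a toroidal curve over $\mathfrak o$ with splitting field $K$. Then $\#\mathfrak C_0(\mathfrak o)=\infty$ if and only if (i) the set $\mathfrak C_0(\mathfrak o)$ contains a generically regular point, (ii) the splitting field $K$ has an infinite group of units $\mathfrak o_K^\times$ (equivalently, $\#\infty_K>1$), and (iii) if $[K:k]=2$, there is a place $v\in\infty_k$ that splits in $K$, i.e., that has two distinct places of $K$ above it (for $[K:k]=2$, the existence of such a place is equivalent to $\#\infty_K>\#\infty_k$). -/

import Mathlib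

open AlgebraicGeometry CategoryTheory CategoryTheory.Limits NumberField

noncomputable section

namespace LogCurves

universe u

attribute [local instance] MvPolynomial.gradedAlgebra

/-- Projective `n`-space over (the spectrum of) a commutative ring `R`, as the `Proj` of
`R[x₀, …, xₙ]` with the grading by total degree. -/
def projSpace (n : ℕ) (R : Type u) [CommRing R] : Scheme.{u} :=
  Proj (MvPolynomial.homogeneousSubmodule (Fin (n + 1)) R)

/-- The structure morphism `ℙⁿ_R ⟶ Spec R`. -/
def projSpaceStr (n : ℕ) (R : Type u) [CommRing R] :
    projSpace n R ⟶ Spec (CommRingCat.of R) :=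
  Proj.toSpecZero (MvPolynomial.homogeneousSubmodule (Fin (n + 1)) R) ≫
    Spec.map (CommRingCat.ofHom
      (algebraMap R (MvPolynomial.homogeneousSubmodule (Fin (n + 1)) R 0)))

/-- A morphism to `Spec R` is projective if it factors as a closed immersion into some `ℙⁿ_R`
followed by the structure morphism. -/
def IsProjective {R : Type u} [CommRing R] {X : Scheme.{u}}
    (f : X ⟶ Spec (CommRingCat.of R)) : Prop :=
  ∃ (n : ℕ) (i : X ⟶ projSpace n R), IsClosedImmersion i ∧ i ≫ projSpaceStr n R = f

/-- A scheme is normal if all its local rings are integrally closed domains. -/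
def IsNormalScheme (X : Scheme.{u}) : Prop :=
  ∀ x : X, IsDomain (X.presheaf.stalk x) ∧ IsIntegrallyClosed (X.presheaf.stalk x)

/-- `f : Y ⟶ X` is the normalization of `X` (for `X` an integral scheme of finite type over a
field): `Y` is normal, and `f` is finite and birational. -/
structure IsNormalization {Y X : Scheme.{u}} (f : Y ⟶ X) : Prop where
  normal : IsNormalScheme Y
  finite : IsFinite f
  birational : ∃ U : X.Opens, Dense (U : Set X) ∧ Dense ((f ⁻¹ᵁ U : Y.Opens) : Set Y) ∧
    IsIso (f ∣_ U)

section ResidueField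

variable {k : Type u} [Field k] {X : Scheme.{u}} (f : X ⟶ Spec (CommRingCat.of k)) (x : X)

/-- The structure map `k → κ(x)` of the residue field of a point `x` on a `k`-scheme. -/
def residueMap : k →+* X.residueField x :=
  (Spec.preimage (X.fromSpecResidueField x ≫ f)).hom

/-- The degree `[κ(x) : k]` of a point `x` on a `k`-scheme (with value `0` if it is infinite). -/
def pointDegree : ℕ :=
  letI : Algebra k (X.residueField x) := (residueMap f x).toAlgebra
  Module.finrank k (X.residueField x)

/-- The residue field `κ(x)` of a point `x` on a `k`-scheme is a separable extension of `k`. -/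
def IsSeparablePoint : Prop :=
  letI : Algebra k (X.residueField x) := (residueMap f x).toAlgebra
  Algebra.IsSeparable k (X.residueField x)

end ResidueField

/-- A log scheme over `R`: a separated `R`-scheme `X` of finite type together with a reduced
effective divisor, that is, a reduced closed subscheme `D` of pure codimension one. -/
structure LogScheme (R : Type u) [CommRing R] where
  X : Scheme.{u}
  str : X ⟶ Spec (CommRingCat.of R)
  isSeparated : IsSeparated str
  locallyOfFiniteType : LocallyOfFiniteType str
  quasiCompact : QuasiCompact str
  D : Scheme.{u}
  incl : D ⟶ X
  isClosedImmersion : IsClosedImmersion incl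
  isReduced : IsReduced D
  /-- The generic points of the irreducible components of `D` have codimension one in `X`. -/
  codim_one : ∀ d : D, closure {d} ∈ irreducibleComponents D →
    ringKrullDim (X.presheaf.stalk (incl d)) = 1

namespace LogScheme

section

variable {R : Type u} [CommRing R] (L : LogScheme R)

/-- A log scheme is flat if both `X` and `D` are flat over the base. -/
def IsFlat : Prop := Flat L.str ∧ Flat (L.incl ≫ L.str)

/-- The open subscheme `X ∖ D`. -/
def openPart : L.X.Opens where
  carrier := (Set.range L.incl)ᶜ
  is_open' := by
    have := L.isClosedImmersion
    exact L.incl.isClosedEmbedding.isClosed_range.isOpen_compl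

/-- The set `(X ∖ D)(R)` of integral points: sections over `Spec R` of `X ∖ D`. -/
def IntegralPoints : Type u :=
  {s : Spec (CommRingCat.of R) ⟶ (L.openPart : Scheme.{u}) //
    s ≫ L.openPart.ι ≫ L.str = 𝟙 (Spec (CommRingCat.of R))}

/-- An integral point is generically regular if the image in `X` of the generic point of
`Spec R` is a regular point. -/
def IntegralPoints.GenericallyRegular [IsDomain R] {L : LogScheme R} (s : L.IntegralPoints) :
    Prop :=
  IsRegularLocalRing (L.X.presheaf.stalk
    ((s.1 ≫ L.openPart.ι) (genericPoint (Spec (CommRingCat.of R)))))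

/-- The generic fibre `X_k` of `X`. -/
def genericFiber (k : Type u) [Field k] [Algebra R k] : Scheme.{u} :=
  pullback L.str (Spec.map (CommRingCat.ofHom (algebraMap R k)))

/-- The projection `X_k ⟶ X`. -/
def genericFiberFst (k : Type u) [Field k] [Algebra R k] : L.genericFiber k ⟶ L.X :=
  pullback.fst L.str (Spec.map (CommRingCat.ofHom (algebraMap R k)))

/-- The structure morphism `X_k ⟶ Spec k`. -/
def genericFiberStr (k : Type u) [Field k] [Algebra R k] :
    L.genericFiber k ⟶ Spec (CommRingCat.of k) :=
  pullback.snd L.str (Spec.map (CommRingCat.ofHom (algebraMap R k)))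

/-- The generic fibre `D_k` of the divisor, as a set of points of `X_k`. -/
def genericDivisor (k : Type u) [Field k] [Algebra R k] : Set (L.genericFiber k) :=
  L.genericFiberFst k ⁻¹' Set.range L.incl

end

end LogScheme

/-- A toroidal curve over a Dedekind ring `R` with field of fractions `k`, together with the
normalization `φ : ℙ¹_k ⟶ C` of its generic fibre `C`. -/
structure ToroidalCurve (R k : Type u) [CommRing R] [IsDedekindDomain R] [Field k] [Algebra R k]
    [IsFractionRing R k] extends LogScheme R where
  integral : IsIntegral X
  flat : toLogScheme.IsFlat
  projective : IsProjective str
  birational : Scheme.BirationalOver str (projSpaceStr 1 R)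
  φ : projSpace 1 k ⟶ toLogScheme.genericFiber k
  φ_over : φ ≫ toLogScheme.genericFiberStr k = projSpaceStr 1 k
  φ_normalization : IsNormalization φ
  /-- The preimage of the generic fibre of `D` under the normalization is a finite set of points,
  with degrees over `k` adding up to `2`. -/
  finite_preimage : (φ ⁻¹' toLogScheme.genericDivisor k).Finite
  degree_eq_two : ∑ᶠ x ∈ φ ⁻¹' toLogScheme.genericDivisor k, pointDegree (projSpaceStr 1 k) x = 2
  separable : ∀ x ∈ φ ⁻¹' toLogScheme.genericDivisor k, IsSeparablePoint (projSpaceStr 1 k) x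

/-- `K` is (up to `k`-isomorphism) the splitting field of a toroidal curve: the residue field of
one of the points of `ℙ¹_k` above the generic fibre of the divisor. -/
def ToroidalCurve.IsSplittingField {R k : Type u} [CommRing R] [IsDedekindDomain R] [Field k]
    [Algebra R k] [IsFractionRing R k] (C : ToroidalCurve R k) (K : Type*) [Field K]
    [Algebra k K] : Prop :=
  ∃ x ∈ C.φ ⁻¹' C.genericDivisor k, ∃ e : K ≃+* (projSpace 1 k).residueField x,
    ∀ a : k, e (algebraMap k K a) = residueMap (projSpaceStr 1 k) x a

/-- An archimedean place `v` of `k` splits in the extension `K` if there is more than one place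
of `K` above it. -/
def PlaceSplits {k K : Type*} [Field k] [Field K] [Algebra k K] (v : InfinitePlace k) : Prop :=
  ∃ w₁ w₂ : InfinitePlace K, w₁ ≠ w₂ ∧ w₁.comap (algebraMap k K) = v ∧
    w₂.comap (algebraMap k K) = v

end LogCurves

end

/-! After normalization the generic fibre of the complement of the divisor is a one-dimensional
torus. The preimage of `D` in `ℙ¹_k` is a pair of rational points or one point of degree two, hence
the zero locus of a binary quadratic form `F` with `F = a * b` for nonproportional linear forms `a`,
`b` over `K` (`ToroidalCurve.exists_torusForm`), conjugate in the quadratic case. The coordinate `t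
= a / b` embeds the rational points of the torus in `Kˣ`, and `t * σ t = 1` when `K` is quadratic.
Generically regular integral points lift to the torus, and all but finitely many integral points are
generically regular.

Suppose that there are infinitely many integral points. The torus is finite over the generic fibre
of `X ∖ D`, so each function on it has bounded denominators at the lifted points
(`exists_denominator`). This applies to `t` and `t⁻¹`, so only finitely many ideals `(c * t)` occur
and infinitely many values of `t` differ by units of `K`. The units are thus infinite. In the
quadratic case infinitely many units satisfy `u * σ u = 1`; if no archimedean place split, `σ` would
preserve every archimedean absolute value, so these units would be roots of unity, finite in number.

Conversely, the conditions on `K` provide a unit `η` of infinite order acting on the rational points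
of the torus: any unit of infinite order in the split case, and `η = ε / σ ε` in the quadratic case.
Let it act on the lift of a regular integral point, restricting to powers congruent to `1` modulo a
suitable `N`. Functions are Laurent polynomials in `t`, so on these translates they have bounded
denominators and stay close to their initial values (`TorusForm.exists_bound`). Bounded denominators
give integrality at all but finitely many primes; at the remaining ones, closeness to an integral
point does (`exists_localized_section`). The resulting sections are infinitely many because the
normalization has finite fibres. -/

section Units

/-! ### Units of number fields. -/

variable {K : Type*} [Field K] [NumberField K]

theorem NumberField.Units.infinite_setOf_pow_of_place_ne_one {w : InfinitePlace K} {u : (𝓞 K)ˣ}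
    (h : w (u : K) ≠ 1) : Function.Injective fun n : ℕ ↦ u ^ n := by
  rw [injective_pow_iff_not_isOfFinOrder]
  intro hu
  exact h ((NumberField.Units.mem_torsion K).1 ((CommGroup.mem_torsion u).2 hu) w)

/-- The construction behind Dirichlet's theorem gives a unit that is small away from `w₁`; since the
weighted logarithms sum to zero, it must be large at `w₁`. A second place is needed to make the sum
strictly negative otherwise. -/
theorem NumberField.Units.exists_place_lt_one (w₁ : InfinitePlace K)
    (hw : ∃ w : InfinitePlace K, w ≠ w₁) :
    ∃ u : (𝓞 K)ˣ, (∀ w : InfinitePlace K, w ≠ w₁ → w (u : K) < 1) ∧ 1 < w₁ (u : K) := by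
  obtain ⟨u, hu⟩ := NumberField.Units.dirichletUnitTheorem.exists_unit K w₁
  refine ⟨u, fun w h ↦ ?_, ?_⟩
  · have := hu w h
    by_contra! h1
    exact absurd (Real.log_nonneg h1) (by linarith)
  · by_contra! h1
    have hs := NumberField.Units.sum_mult_mul_log u
    obtain ⟨w₂, hw₂⟩ := hw
    have : ∑ w : InfinitePlace K, w.mult * Real.log (w (u : K)) < 0 := by
      apply Finset.sum_neg'
      · intro w _
        apply mul_nonpos_of_nonneg_of_nonpos (by positivity)
        by_cases h : w = w₁
        · subst h
          exact Real.log_nonpos (apply_nonneg _ _) h1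
        · exact (hu w h).le
      · exact ⟨w₂, Finset.mem_univ _, mul_neg_of_pos_of_neg
          (by exact_mod_cast InfinitePlace.mult_pos) (hu w₂ hw₂)⟩
    linarith

/-- With a single place the sum formula for logarithms forces absolute value one there, so every
unit is torsion; with two places a unit of absolute value greater than one has infinite order. -/
theorem NumberField.Units.infinite_iff_one_lt_card :
    Infinite (𝓞 K)ˣ ↔ 1 < Fintype.card (InfinitePlace K) := by
  constructor
  · intro h
    by_contra! hc
    have hsub : Subsingleton (InfinitePlace K) := Fintype.card_le_one_iff_subsingleton.1 hc
    apply (Set.infinite_univ (α := (𝓞 K)ˣ))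
    have : Set.Finite ((NumberField.Units.torsion K : Subgroup (𝓞 K)ˣ) : Set (𝓞 K)ˣ) :=
      Set.finite_coe_iff.1 (inferInstanceAs (Finite (NumberField.Units.torsion K)))
    refine this.subset fun u _ ↦ (NumberField.Units.mem_torsion K).2 fun w ↦ ?_
    have hs := NumberField.Units.sum_mult_mul_log u
    rw [Fintype.sum_subsingleton _ w] at hs
    exact NumberField.Units.dirichletUnitTheorem.mult_log_place_eq_zero.1 hs
  · intro h
    obtain ⟨w₁, w₂, h12⟩ := Fintype.one_lt_card_iff.1 h
    obtain ⟨u, -, hu⟩ := NumberField.Units.exists_place_lt_one w₁ ⟨w₂, h12.symm⟩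
    exact Infinite.of_injective _
      (NumberField.Units.infinite_setOf_pow_of_place_ne_one (w := w₁) (u := u) hu.ne')

theorem NumberField.Units.exists_place_ne_one [Infinite (𝓞 K)ˣ] :
    ∃ (u : (𝓞 K)ˣ) (w : InfinitePlace K), w (u : K) ≠ 1 := by
  obtain ⟨w₁, w₂, h12⟩ := Fintype.one_lt_card_iff.1
    (NumberField.Units.infinite_iff_one_lt_card.1 ‹Infinite (𝓞 K)ˣ›)
  obtain ⟨u, -, hu⟩ := NumberField.Units.exists_place_lt_one w₁ ⟨w₂, h12.symm⟩
  exact ⟨u, w₁, hu.ne'⟩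

theorem NumberField.finite_quotient_span {a : 𝓞 K} (ha : a ≠ 0) :
    Finite (𝓞 K ⧸ Ideal.span {a}) := by
  rw [← Ideal.absNorm_ne_zero_iff]
  simpa [Ideal.absNorm_eq_zero_iff] using ha

theorem NumberField.Units.exists_pow_sub_one_mem {a : 𝓞 K} (ha : a ≠ 0) (u : (𝓞 K)ˣ) :
    ∃ m : ℕ, 0 < m ∧ a ∣ ((u ^ m : (𝓞 K)ˣ) : 𝓞 K) - 1 := by
  have := NumberField.finite_quotient_span ha
  obtain ⟨m, hm, h⟩ := isOfFinOrder_iff_pow_eq_one.1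
    (isOfFinOrder_of_finite (Units.map (Ideal.Quotient.mk (Ideal.span {a})).toMonoidHom u))
  refine ⟨m, hm, ?_⟩
  rw [← Ideal.mem_span_singleton, ← Ideal.Quotient.eq_zero_iff_mem, map_sub, sub_eq_zero]
  have := congrArg Units.val h
  simpa using this

theorem dvd_units_pow_sub_one {A : Type*} [CommRing A] {a : A} {u : Aˣ} (h : a ∣ (u : A) - 1)
    (n : ℕ) : a ∣ ((u ^ n : Aˣ) : A) - 1 := by
  rw [Units.val_pow_eq_pow_val]
  exact h.trans (sub_one_dvd_pow_sub_one _ n)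
where sub_one_dvd_pow_sub_one (x : A) (n : ℕ) : x - 1 ∣ x ^ n - 1 := by
        simpa using sub_dvd_pow_sub_pow x 1 n

theorem dvd_units_zpow_sub_one {A : Type*} [CommRing A] {a : A} {u : Aˣ} (h : a ∣ (u : A) - 1)
    (n : ℤ) : a ∣ ((u ^ n : Aˣ) : A) - 1 := by
  obtain ⟨n, rfl | rfl⟩ := n.eq_nat_or_neg
  · simpa using dvd_units_pow_sub_one h n
  · rw [zpow_neg, zpow_natCast]
    have h1 := dvd_units_pow_sub_one h n
    have : (((u ^ n)⁻¹ : Aˣ) : A) - 1 = -(((u ^ n : Aˣ) : A) - 1) * (((u ^ n)⁻¹ : Aˣ) : A) := by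
      have := (u ^ n).mul_inv
      linear_combination this
    rw [this]
    exact (h1.neg_right).mul_right _

/-- An infinite set of elements `t` of a number field such that `t` and `t⁻¹` have a bounded
denominator contains infinitely many unit multiples of one of its elements. -/
theorem NumberField.infinite_setOf_unit_mul_mem {T : Set K} (hT : T.Infinite) (hT0 : ∀ t ∈ T, t ≠ 0)
    {c : 𝓞 K} (hc : c ≠ 0) (h1 : ∀ t ∈ T, ∃ a : 𝓞 K, algebraMap (𝓞 K) K a = algebraMap (𝓞 K) K c * t)
    (h2 : ∀ t ∈ T, ∃ a : 𝓞 K, algebraMap (𝓞 K) K a = algebraMap (𝓞 K) K c * t⁻¹) :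
    ∃ t₀ ∈ T, {u : (𝓞 K)ˣ | (u : K) * t₀ ∈ T}.Infinite := by
  classical
  have h1' (t : K) : ∃ a : 𝓞 K, t ∈ T → algebraMap (𝓞 K) K a = algebraMap (𝓞 K) K c * t := by
    by_cases ht : t ∈ T
    · exact (h1 t ht).imp fun a h _ ↦ h
    · exact ⟨0, fun h ↦ absurd h ht⟩
  choose g hg using h1'
  have hfin : {I : Ideal (𝓞 K) | I ∣ Ideal.span {c ^ 2}}.Finite := by
    have : Fintype {I : Ideal (𝓞 K) // I ∣ Ideal.span {c ^ 2}} :=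
      UniqueFactorizationMonoid.fintypeSubtypeDvd _ (by simpa using hc)
    exact Set.finite_coe_iff.1 (inferInstanceAs (Finite {I : Ideal (𝓞 K) // I ∣ Ideal.span {c ^ 2}}))
  -- The integral elements `c * t` and `c * t⁻¹` have product `c ^ 2`, so only finitely many ideals
  -- `(c * t)` occur. By pigeonhole one of them occurs infinitely often, and generators of the same
  -- ideal differ by units.
  have hdvd (t : K) (ht : t ∈ T) : Ideal.span {g t} ∣ Ideal.span {c ^ 2} := by
    rw [Ideal.dvd_span_singleton, Ideal.mem_span_singleton]
    obtain ⟨b, hb⟩ := h2 t ht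
    refine ⟨b, FaithfulSMul.algebraMap_injective (𝓞 K) K ?_⟩
    have := hT0 t ht
    rw [map_pow, map_mul, hg t ht, hb]
    field_simp
  obtain ⟨I, hI⟩ : ∃ I : Ideal (𝓞 K), {t ∈ T | Ideal.span {g t} = I}.Infinite := by
    by_contra! hcon
    refine hT ((hfin.biUnion fun I _ ↦ hcon I).subset fun t ht ↦ ?_)
    simp only [Set.mem_iUnion]
    exact ⟨_, hdvd t ht, ht, rfl⟩
  obtain ⟨t₀, ht₀, rfl⟩ := hI.nonempty
  refine ⟨t₀, ht₀, Set.Infinite.of_image (fun u : (𝓞 K)ˣ ↦ (u : K) * t₀) (hI.mono ?_)⟩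
  have hc' : algebraMap (𝓞 K) K c ≠ 0 := by simpa using hc
  rintro t ⟨ht, hft⟩
  obtain ⟨u, hu⟩ := (Ideal.span_singleton_eq_span_singleton.1 hft).symm
  have hu' := congrArg (algebraMap (𝓞 K) K) hu
  rw [map_mul, hg t ht, hg t₀ ht₀] at hu'
  have : (u : K) * t₀ = t := by
    apply mul_left_cancel₀ hc'
    rw [← hu']; ring
  exact ⟨u, by simpa [this] using ht, this⟩

/-! ### Archimedean places in an extension. -/

variable {k : Type*} [Field k] [NumberField k] [Algebra k K]

/-- Restriction of places is surjective, so a split place exists exactly when restriction fails to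
be injective. -/
theorem exists_placeSplits_iff :
    (∃ v : InfinitePlace k, LogCurves.PlaceSplits (K := K) v) ↔
        Fintype.card (InfinitePlace k) < Fintype.card (InfinitePlace K) := by
  have hsurj := InfinitePlace.comap_surjective (k := k) (K := K)
  constructor
  · rintro ⟨v, w₁, w₂, hne, h1, h2⟩
    refine Fintype.card_lt_of_surjective_not_injective _ hsurj fun hinj ↦ hne (hinj ?_)
    exact h1.trans h2.symm
  · intro h
    by_contra! hcon
    refine absurd (Fintype.card_le_of_injective (fun w : InfinitePlace K ↦
      w.comap (algebraMap k K)) ?_) (not_le.2 h)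
    intro w₁ w₂ h12
    by_contra hne
    exact hcon (w₂.comap (algebraMap k K)) ⟨w₁, w₂, hne, h12, rfl⟩

omit [NumberField k] in
-- Both `w` and `w ∘ σ` lie over the same place of `k`, hence coincide if nothing splits. Then `u *
-- σ u = 1` gives `w u ^ 2 = 1` for every `w`, and `u` is a root of unity.
theorem finite_setOf_norm_eq_one_of_not_placeSplits (σ : K ≃ₐ[k] K)
    (h : ¬ ∃ v : InfinitePlace k, LogCurves.PlaceSplits (K := K) v) :
    {u : (𝓞 K)ˣ | (u : K) * σ u = 1}.Finite := by
  have : Set.Finite ((NumberField.Units.torsion K : Subgroup (𝓞 K)ˣ) : Set (𝓞 K)ˣ) :=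
    Set.finite_coe_iff.1 (inferInstanceAs (Finite (NumberField.Units.torsion K)))
  refine this.subset fun u hu ↦ (NumberField.Units.mem_torsion K).2 fun w ↦ ?_
  have hw : w.comap (σ : K →+* K) = w := by
    by_contra hne
    refine h ⟨w.comap (algebraMap k K), w.comap (σ : K →+* K), w, hne, ?_, rfl⟩
    rw [← InfinitePlace.comap_comp]
    congr 1
    ext x
    simp
  have h1 : w (σ u) = w (u : K) := by
    conv_rhs => rw [← hw]
    rfl
  have h2 : w (u : K) * w (u : K) = 1 := by
    nth_rw 2 [← h1]
    rw [← map_mul, hu, map_one]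
  nlinarith [apply_nonneg w (u : K)]

/-- The Galois group permutes the places above `v` transitively, so `σ` interchanges `w₁` and `w₂`;
a unit that is large only at `w₁` distinguishes them. Its quotient by its conjugate will be a
norm-one unit of infinite order. -/
theorem exists_unit_place_ne_of_placeSplits (hd : Module.finrank k K = 2) {σ : K ≃ₐ[k] K}
    (hσ : σ ≠ 1) (h : ∃ v : InfinitePlace k, LogCurves.PlaceSplits (K := K) v) :
    ∃ (u : (𝓞 K)ˣ) (w : InfinitePlace K), w (u : K) ≠ w (σ u) := by
  have : Algebra.IsQuadraticExtension k K := ⟨hd⟩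
  obtain ⟨v, w₁, w₂, hne, h1, h2⟩ := h
  obtain ⟨τ, hτ⟩ := InfinitePlace.exists_smul_eq_of_comap_eq (h2.trans h1.symm)
  have hcard : Nat.card (K ≃ₐ[k] K) = 2 := by
    rw [← hd]; exact IsGalois.card_aut_eq_finrank k K
  have hτ1 : τ⁻¹ ≠ 1 := by
    intro h
    rw [inv_eq_one] at h
    subst h
    simp at hτ
    exact hne hτ.symm
  have hτσ : τ⁻¹ = σ := by
    obtain ⟨x, hx, huniq⟩ := Nat.card_eq_two_iff' (1 : K ≃ₐ[k] K) |>.1 hcard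
    exact (huniq _ hτ1).trans (huniq _ hσ).symm
  obtain ⟨u, hu, hu1⟩ := NumberField.Units.exists_place_lt_one w₁ ⟨w₂, hne.symm⟩
  refine ⟨u, w₂, ?_⟩
  have : w₁ (u : K) = w₂ (σ u) := by
    rw [← hτ, InfinitePlace.smul_apply, ← hτσ]
    rfl
  rw [← this]
  exact ((hu w₂ hne.symm).trans hu1).ne

end Units

/-! ### Functions and rational points on the complement of a hypersurface. -/

namespace LogCurves

attribute [local instance] MvPolynomial.gradedAlgebra

open HomogeneousLocalization

section Away

variable {k : Type*} [Field k] {n : ℕ}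

variable (k n) in
/-- The grading of the homogeneous coordinate ring of projective space. -/
abbrev polyGrading : ℕ → Submodule k (MvPolynomial (Fin (n + 1)) k) :=
  MvPolynomial.homogeneousSubmodule (Fin (n + 1)) k

/-- The structure map of the coordinate ring of the complement of a hypersurface. -/
noncomputable def awayConst (F : MvPolynomial (Fin (n + 1)) k) : k →+* Away (polyGrading k n) F :=
  (algebraMap (polyGrading k n 0) _).comp (algebraMap k (polyGrading k n 0))

/-- The localization of the homogeneous coordinate ring away from `F`. -/
noncomputable abbrev toLoc (F : MvPolynomial (Fin (n + 1)) k) :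
    MvPolynomial (Fin (n + 1)) k →+* Localization (Submonoid.powers F) :=
  algebraMap _ _

variable {F : MvPolynomial (Fin (n + 1)) k} {d : ℕ} (hF : F ∈ polyGrading k n d)

theorem val_awayConst (a : k) : (awayConst F a).val = toLoc F (MvPolynomial.C a) := by
  simp only [awayConst, RingHom.comp_apply]
  rfl

theorem away_mk_val (m : ℕ) (G) (hG : G ∈ polyGrading k n (m • d)) :
    toLoc F F ^ m * (Away.mk _ hF m G hG).val =
      toLoc F G := by
  rw [Away.val_mk, ← map_pow, Localization.mk_eq_mk']
  exact IsLocalization.mk'_spec' (M := Submonoid.powers F) (Localization (Submonoid.powers F)) G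
    ⟨F ^ m, by use m⟩

theorem isUnit_algebraMap_localization_powers :
    IsUnit (toLoc F F) :=
  IsLocalization.map_units (M := Submonoid.powers F) (Localization (Submonoid.powers F)) ⟨F, 1, pow_one F⟩

theorem away_mk_eq_iff {m : ℕ} {G} {hG : G ∈ polyGrading k n (m • d)}
    {z : Away (polyGrading k n) F} : Away.mk _ hF m G hG = z ↔
      toLoc F G = toLoc F F ^ m * z.val := by
  rw [ext_iff_val, ← away_mk_val hF m G hG]
  exact ((isUnit_algebraMap_localization_powers.pow m).mul_right_inj).symm

/-- Evaluation of the functions on the complement of a hypersurface at a rational point. -/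
noncomputable def evalAway (v : Fin (n + 1) → k) (hv : MvPolynomial.eval v F ≠ 0) :
    Away (polyGrading k n) F →+* k :=
  (IsLocalization.Away.lift (S := Localization (Submonoid.powers F)) F (g := MvPolynomial.eval v)
    hv.isUnit).comp (algebraMap _ _)

theorem evalAway_apply {v : Fin (n + 1) → k} (hv : MvPolynomial.eval v F ≠ 0) (z) :
    evalAway v hv z = IsLocalization.Away.lift (S := Localization (Submonoid.powers F)) F
      (g := MvPolynomial.eval v) hv.isUnit z.val := rfl

theorem evalAway_mk {v : Fin (n + 1) → k} (hv : MvPolynomial.eval v F ≠ 0) (m : ℕ) (G)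
    (hG : G ∈ polyGrading k n (m • d)) :
    evalAway v hv (Away.mk _ hF m G hG) =
      MvPolynomial.eval v G / MvPolynomial.eval v F ^ m := by
  rw [eq_div_iff (pow_ne_zero _ hv), evalAway_apply, mul_comm]
  have := congrArg (IsLocalization.Away.lift (S := Localization (Submonoid.powers F)) F
      (g := MvPolynomial.eval v) hv.isUnit) (away_mk_val hF m G hG)
  simpa using this

theorem evalAway_comp_awayConst {v : Fin (n + 1) → k} (hv : MvPolynomial.eval v F ≠ 0) :
    (evalAway v hv).comp (awayConst F) = RingHom.id k := by
  ext a
  simp [evalAway_apply, val_awayConst]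

theorem eval₂_mul_eq_of_isHomogeneous {A σ : Type*} [CommRing A] {R : Type*} [CommRing R]
    (f : R →+* A) (r : A) (x : σ → A) {G : MvPolynomial σ R} {e : ℕ} (hG : G.IsHomogeneous e) :
    MvPolynomial.eval₂ f (fun j ↦ r * x j) G = r ^ e * MvPolynomial.eval₂ f x G := by
  simp only [MvPolynomial.eval₂_eq, Finset.mul_sum]
  refine Finset.sum_congr rfl fun s hs ↦ ?_
  simp only [mul_pow, Finset.prod_mul_distrib, Finset.prod_pow_eq_pow_sum]
  have : ∑ i ∈ s.support, s i = e := (hG.degree_eq_sum_deg_support hs).symm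
  rw [this]
  ring

end Away

section Conic

variable {k : Type*} [Field k]

theorem X_mul_X_mem (i j : Fin 2) :
    MvPolynomial.X i * MvPolynomial.X j ∈ polyGrading k 1 (1 • 2) :=
  (MvPolynomial.isHomogeneous_X k i).mul (MvPolynomial.isHomogeneous_X k j)

variable {F : MvPolynomial (Fin 2) k} (hF : F ∈ polyGrading k 1 2)

/-- This is `G (X_i X_0 / F, X_i X_1 / F) = (G / F ^ e) * (X_i ^ 2 / F) ^ e`, by homogeneity of
degree `2 * e`. It lets a homomorphism be recovered from its values on the `X_i X_j / F`. -/
theorem eval₂_away_mk (i : Fin 2) {e : ℕ} {G : MvPolynomial (Fin 2) k}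
    (hG : G ∈ polyGrading k 1 (e • 2)) :
    MvPolynomial.eval₂ (awayConst F) (fun j ↦ Away.mk _ hF 1 _ (X_mul_X_mem i j)) G =
      Away.mk _ hF e G hG * Away.mk _ hF 1 _ (X_mul_X_mem i i) ^ e := by
  apply val_injective
  set ψ := algebraMap (Away (polyGrading k 1) F) (Localization (Submonoid.powers F)) with hψ
  have hu := isUnit_algebraMap_localization_powers (F := F)
  simp only [← HomogeneousLocalization.algebraMap_apply]
  rw [← hψ]
  rw [MvPolynomial.hom_eval₂, map_mul, map_pow]
  have h1 (j : Fin 2) : toLoc F F *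
      ψ (Away.mk _ hF 1 _ (X_mul_X_mem i j)) =
      toLoc F (MvPolynomial.X i) * toLoc F (MvPolynomial.X j) := by
    rw [← map_mul, ← away_mk_val hF 1 _ (X_mul_X_mem i j), pow_one]; rfl
  have h2 : toLoc F F ^ e *
      ψ (Away.mk _ hF e G hG) = toLoc F G := away_mk_val hF e G hG
  have h3 := eval₂_mul_eq_of_isHomogeneous (ψ.comp (awayConst F))
    (toLoc F F)
    (fun j ↦ ψ (Away.mk _ hF 1 _ (X_mul_X_mem i j))) hG
  simp only [h1] at h3
  rw [eval₂_mul_eq_of_isHomogeneous _ _ _ hG] at h3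
  have h4 : MvPolynomial.eval₂ (ψ.comp (awayConst F)) (fun x ↦ toLoc F (MvPolynomial.X x)) G = toLoc F G := by
    have : ψ.comp (awayConst F) = (toLoc F).comp MvPolynomial.C := RingHom.ext val_awayConst
    rw [this, ← Function.comp_def, ← MvPolynomial.coe_eval₂Hom]
    exact congrFun (congrArg DFunLike.coe (MvPolynomial.ringHom_ext (by simp) (by simp))) G
  rw [h4] at h3
  have h5 := congrArg (· ^ e) (h1 i)
  simp only [mul_pow] at h5
  rw [smul_eq_mul, pow_mul', pow_mul', sq, sq] at h3
  apply (((hu.pow e).mul (hu.pow e)).mul_right_inj).1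
  rw [mul_pow, mul_pow] at h3
  linear_combination -h3 - toLoc F G * h5 - toLoc F F ^ e *
      ψ (Away.mk _ hF 1 _ (X_mul_X_mem i i)) ^ e * h2

variable (k) in
/-- The binary quadratic form with the given coefficients. -/
noncomputable def quadForm (c : Fin 3 → k) : MvPolynomial (Fin 2) k :=
  MvPolynomial.C (c 0) * (MvPolynomial.X 0 * MvPolynomial.X 0) +
    MvPolynomial.C (c 1) * (MvPolynomial.X 0 * MvPolynomial.X 1) +
    MvPolynomial.C (c 2) * (MvPolynomial.X 1 * MvPolynomial.X 1)

theorem quadForm_mem (c : Fin 3 → k) : quadForm k c ∈ polyGrading k 1 2 :=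
  (((X_mul_X_mem 0 0).C_mul _).add ((X_mul_X_mem 0 1).C_mul _)).add ((X_mul_X_mem 1 1).C_mul _)

theorem eval_quadForm (c : Fin 3 → k) (v : Fin 2 → k) : MvPolynomial.eval v (quadForm k c) =
    c 0 * v 0 ^ 2 + c 1 * (v 0 * v 1) + c 2 * v 1 ^ 2 := by
  simp [quadForm]
  ring

theorem quadForm_relation (c : Fin 3 → k) :
    awayConst _ (c 0) * Away.mk _ (quadForm_mem c) 1 _ (X_mul_X_mem 0 0) +
    awayConst _ (c 1) * Away.mk _ (quadForm_mem c) 1 _ (X_mul_X_mem 0 1) +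
    awayConst _ (c 2) * Away.mk _ (quadForm_mem c) 1 _ (X_mul_X_mem 1 1) = 1 := by
  apply val_injective
  have hu := isUnit_algebraMap_localization_powers (F := quadForm k c)
  apply hu.mul_right_inj.1
  simp only [val_add, val_mul, val_awayConst, val_one, mul_add]
  have h (i j : Fin 2) := away_mk_val (quadForm_mem c) 1 _ (X_mul_X_mem i j)
  simp only [pow_one] at h
  have : toLoc (quadForm k c) (quadForm k c) = toLoc _ (MvPolynomial.C (c 0)) *
      toLoc _ (MvPolynomial.X 0 * MvPolynomial.X 0) + toLoc _ (MvPolynomial.C (c 1)) *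
      toLoc _ (MvPolynomial.X 0 * MvPolynomial.X 1) + toLoc _ (MvPolynomial.C (c 2)) *
      toLoc _ (MvPolynomial.X 1 * MvPolynomial.X 1) := by
    rw [← map_mul, ← map_mul, ← map_mul, ← map_add, ← map_add]
    rfl
  linear_combination toLoc _ (MvPolynomial.C (c 0)) * h 0 0 + toLoc _ (MvPolynomial.C (c 1)) * h 0 1
    + toLoc _ (MvPolynomial.C (c 2)) * h 1 1 - this

theorem away_mk_mul_mk (i j : Fin 2) : Away.mk _ hF 1 _ (X_mul_X_mem i j) ^ 2 =
    Away.mk _ hF 1 _ (X_mul_X_mem i i) * Away.mk _ hF 1 _ (X_mul_X_mem j j) := by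
  apply val_injective
  have hu := isUnit_algebraMap_localization_powers (F := F)
  apply (hu.pow 2).mul_right_inj.1
  simp only [val_mul, val_pow]
  have h (i j : Fin 2) := away_mk_val hF 1 _ (X_mul_X_mem i j)
  simp only [pow_one] at h
  have h1 := congrArg₂ (· * ·) (h i i) (h j j)
  have h2 := congrArg (· ^ 2) (h i j)
  simp only [map_mul] at h1 h2
  linear_combination h2 - h1

/-- Every rational point of the complement of a conic divisor is given by homogeneous
coordinates. -/
theorem exists_eq_evalAway (c : Fin 3 → k) (χ : Away (polyGrading k 1) (quadForm k c) →+* k)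
    (hχ : χ.comp (awayConst _) = RingHom.id k) :
    ∃ (v : Fin 2 → k) (hv : MvPolynomial.eval v (quadForm k c) ≠ 0), χ = evalAway v hv := by
  -- Row `i` of `X_i X_j / F` is proportional to `(X_0, X_1)`, so a row with `s i i ≠ 0` serves as a
  -- vector of homogeneous coordinates.
  set s : Fin 2 → Fin 2 → k :=
    fun i j ↦ χ (Away.mk _ (quadForm_mem c) 1 _ (X_mul_X_mem i j)) with hs
  have hs2 (i j : Fin 2) : s i j ^ 2 = s i i * s j j := by
    simp only [hs, ← map_pow, ← map_mul, away_mk_mul_mk]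
  have hχc (a : k) : χ (awayConst _ a) = a := congrArg (fun f : k →+* k ↦ f a) hχ
  have key (i : Fin 2) {e : ℕ} {G : MvPolynomial (Fin 2) k} (hG : G ∈ polyGrading k 1 (e • 2)) :
      MvPolynomial.eval (s i) G = χ (Away.mk _ (quadForm_mem c) e G hG) * s i i ^ e := by
    have := congrArg χ (eval₂_away_mk (quadForm_mem c) i hG)
    rw [MvPolynomial.hom_eval₂, hχ, map_mul, map_pow] at this
    exact this
  -- If both diagonal entries vanished, so would all entries, since `s i j ^ 2 = s i i * s j j`; but
  -- `F / F = 1` is a linear combination of them.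
  obtain ⟨i, hi⟩ : ∃ i, s i i ≠ 0 := by
    by_contra! hcon
    have h0 (i j : Fin 2) : s i j = 0 := by
      have := hs2 i j
      rwa [hcon i, zero_mul, sq_eq_zero_iff] at this
    have := congrArg χ (quadForm_relation c)
    simp only [map_add, map_mul, hχc, map_one] at this
    have h0' (i j : Fin 2) : χ (Away.mk _ (quadForm_mem c) 1 _ (X_mul_X_mem i j)) = 0 := h0 i j
    rw [h0', h0', h0'] at this
    simp at this
  have hF1 : MvPolynomial.eval (s i) (quadForm k c) = s i i := by
    have h1 : Away.mk _ (quadForm_mem c) 1 (quadForm k c) (by simpa using quadForm_mem c) = 1 := by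
      rw [away_mk_eq_iff]
      simp
    rw [key i (e := 1) (by simpa using quadForm_mem c), h1]
    simp
  refine ⟨s i, by rwa [hF1], RingHom.ext fun z ↦ ?_⟩
  obtain ⟨e, G, hG, rfl⟩ := Away.mk_surjective _ (quadForm_mem c) z
  rw [evalAway_mk, hF1, key i hG, mul_div_cancel_right₀ _ (pow_ne_zero _ hi)]

end Conic

end LogCurves

/-! ### The torus attached to a factored binary quadratic form. -/

namespace LogCurves

attribute [local instance] MvPolynomial.gradedAlgebra

open HomogeneousLocalization

section Torus

variable {k K : Type*} [Field k] [Field K] [Algebra k K]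

/-- The value of a linear form with coefficients in `K` at a vector with entries in `k`. -/
def lin (a : Fin 2 → K) (v : Fin 2 → k) : K :=
  a 0 * algebraMap k K (v 0) + a 1 * algebraMap k K (v 1)

variable (k K) in
/-- A binary quadratic form over `k` together with a factorization into nonproportional linear
forms over `K`, such that either `K = k` or `K` is quadratic over `k` and the two factors are
conjugate. -/
structure TorusForm where
  c : Fin 3 → k
  a : Fin 2 → K
  b : Fin 2 → K
  c_zero : algebraMap k K (c 0) = a 0 * b 0
  c_one : algebraMap k K (c 1) = a 0 * b 1 + a 1 * b 0
  c_two : algebraMap k K (c 2) = a 1 * b 1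
  det_ne_zero : a 0 * b 1 - a 1 * b 0 ≠ 0
  split_or : Function.Surjective (algebraMap k K) ∨
    Module.finrank k K = 2 ∧ ∃ σ : K ≃ₐ[k] K, σ (a 0) = b 0 ∧ σ (a 1) = b 1

namespace TorusForm

variable (T : TorusForm k K)

/-- The quadratic form of a torus form. -/
noncomputable abbrev form : MvPolynomial (Fin 2) k := quadForm k T.c

theorem algebraMap_eval_form (v : Fin 2 → k) :
    algebraMap k K (MvPolynomial.eval v T.form) = lin T.a v * lin T.b v := by
  rw [eval_quadForm]
  simp only [map_add, map_mul, map_pow, T.c_zero, T.c_one, T.c_two, lin]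
  ring

theorem eval_form_ne_zero {v : Fin 2 → k} :
    MvPolynomial.eval v T.form ≠ 0 ↔ lin T.a v ≠ 0 ∧ lin T.b v ≠ 0 := by
  rw [← (map_ne_zero (algebraMap k K)), algebraMap_eval_form, mul_ne_zero_iff]

theorem det_mul_zero (v : Fin 2 → k) : (T.a 0 * T.b 1 - T.a 1 * T.b 0) * algebraMap k K (v 0) =
    T.b 1 * lin T.a v - T.a 1 * lin T.b v := by
  simp only [lin]; ring

theorem det_mul_one (v : Fin 2 → k) : (T.a 0 * T.b 1 - T.a 1 * T.b 0) * algebraMap k K (v 1) =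
    T.a 0 * lin T.b v - T.b 0 * lin T.a v := by
  simp only [lin]; ring

/-- The coordinate of a point of the torus. -/
def coord (v : Fin 2 → k) : K := lin T.a v / lin T.b v

/-- As the two linear forms are independent, equal ratios force proportional vectors, and functions
of degree zero do not see the scaling. -/
theorem evalAway_eq_of_coord_eq {v w : Fin 2 → k} (hv : MvPolynomial.eval v T.form ≠ 0)
    (hw : MvPolynomial.eval w T.form ≠ 0) (h : T.coord v = T.coord w) :
    evalAway v hv = evalAway w hw := by
  obtain ⟨hv1, hv2⟩ := T.eval_form_ne_zero.1 hv
  obtain ⟨hw1, hw2⟩ := T.eval_form_ne_zero.1 hw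
  rw [coord, coord, div_eq_div_iff hv2 hw2] at h
  have h1 : v 0 * w 1 = v 1 * w 0 := by
    apply (algebraMap k K).injective
    apply mul_left_cancel₀ T.det_ne_zero
    simp only [lin] at h
    rw [map_mul, map_mul]
    linear_combination h
  obtain ⟨r, hr⟩ : ∃ r : k, w = fun j ↦ r * v j := by
    by_cases h0 : v 0 = 0
    · have h1' : v 1 ≠ 0 := by
        intro h1'
        apply hv1
        simp [lin, h0, h1']
      refine ⟨w 1 / v 1, funext fun j ↦ ?_⟩
      fin_cases j
      · have : w 0 = 0 := by simpa [h0, h1'] using h1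
        simp [h0, this]
      · simp [h1']
    · refine ⟨w 0 / v 0, funext fun j ↦ ?_⟩
      fin_cases j
      · simp [h0]
      · simp only [Fin.mk_one, Fin.isValue]
        field_simp
        linear_combination h1
  have hrv (e : ℕ) (G : MvPolynomial (Fin 2) k) (hG : G.IsHomogeneous e) :
      MvPolynomial.eval w G = r ^ e * MvPolynomial.eval v G := by
    rw [hr]
    exact eval₂_mul_eq_of_isHomogeneous _ r v hG
  have hr0 : r ≠ 0 := by
    rintro rfl
    exact hw (by rw [hrv 2 _ (quadForm_mem T.c)]; simp)
  refine RingHom.ext fun z ↦ ?_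
  obtain ⟨e, G, hG, rfl⟩ := Away.mk_surjective _ (quadForm_mem T.c) z
  rw [evalAway_mk, evalAway_mk, hrv _ _ hG, hrv 2 _ (quadForm_mem T.c), mul_pow, ← pow_mul,
    smul_eq_mul, mul_comm 2 e, mul_div_mul_left _ _ (pow_ne_zero _ hr0)]

/-- Writing `a / b = a ^ 2 / (a * b) = a ^ 2 / F` exhibits the coordinate as a combination of the
functions `X_i X_j / F`, so that bounded denominators pass from these to `t`; symmetrically for `t⁻¹
= b ^ 2 / F`. -/
theorem coord_eq {v : Fin 2 → k} (hv : MvPolynomial.eval v T.form ≠ 0) :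
    T.coord v =
      T.a 0 ^ 2 * algebraMap k K
        (evalAway v hv (Away.mk _ (quadForm_mem T.c) 1 _ (X_mul_X_mem 0 0))) +
      2 * T.a 0 * T.a 1 * algebraMap k K
        (evalAway v hv (Away.mk _ (quadForm_mem T.c) 1 _ (X_mul_X_mem 0 1))) +
      T.a 1 ^ 2 * algebraMap k K
        (evalAway v hv (Away.mk _ (quadForm_mem T.c) 1 _ (X_mul_X_mem 1 1))) := by
  obtain ⟨hv1, hv2⟩ := T.eval_form_ne_zero.1 hv
  simp only [evalAway_mk, pow_one, map_div₀, show algebraMap k K (MvPolynomial.eval v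
    (quadForm k T.c)) = _ from T.algebraMap_eval_form v, map_mul, MvPolynomial.eval_X]
  rw [coord]
  field_simp
  simp only [lin]
  ring

theorem coord_inv_eq {v : Fin 2 → k} (hv : MvPolynomial.eval v T.form ≠ 0) :
    (T.coord v)⁻¹ =
      T.b 0 ^ 2 * algebraMap k K
        (evalAway v hv (Away.mk _ (quadForm_mem T.c) 1 _ (X_mul_X_mem 0 0))) +
      2 * T.b 0 * T.b 1 * algebraMap k K
        (evalAway v hv (Away.mk _ (quadForm_mem T.c) 1 _ (X_mul_X_mem 0 1))) +
      T.b 1 ^ 2 * algebraMap k K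
        (evalAway v hv (Away.mk _ (quadForm_mem T.c) 1 _ (X_mul_X_mem 1 1))) := by
  obtain ⟨hv1, hv2⟩ := T.eval_form_ne_zero.1 hv
  simp only [evalAway_mk, pow_one, map_div₀, show algebraMap k K (MvPolynomial.eval v
    (quadForm k T.c)) = _ from T.algebraMap_eval_form v, map_mul, MvPolynomial.eval_X]
  rw [coord]
  field_simp
  simp only [lin]
  ring

/-- Functions on the torus are Laurent polynomials in the coordinate. -/
theorem exists_polynomial (z : Away (polyGrading k 1) T.form) :
    ∃ (p : Polynomial K) (m : ℕ), ∀ (v : Fin 2 → k) (hv : MvPolynomial.eval v T.form ≠ 0),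
      algebraMap k K (evalAway v hv z) = p.eval (T.coord v) * (T.coord v ^ m)⁻¹ := by
  obtain ⟨e, G, hG, rfl⟩ := Away.mk_surjective _ (quadForm_mem T.c) z
  set D := T.a 0 * T.b 1 - T.a 1 * T.b 0 with hD
  have hD0 : D ≠ 0 := T.det_ne_zero
  -- Cramer's rule gives `v j = b v * q j (t)` with `q j` linear. Hence `G v = (b v) ^ (2 * e) * G
  -- (q) (t)`, while `F v ^ e = (b v) ^ (2 * e) * t ^ e`; this explains the exponent `m = e`.
  let q : Fin 2 → Polynomial K :=
    ![Polynomial.C (D⁻¹ * T.b 1) * Polynomial.X - Polynomial.C (D⁻¹ * T.a 1),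
      Polynomial.C (D⁻¹ * T.a 0) - Polynomial.C (D⁻¹ * T.b 0) * Polynomial.X]
  refine ⟨MvPolynomial.eval₂ (Polynomial.C.comp (algebraMap k K)) q G, e, fun v hv ↦ ?_⟩
  obtain ⟨hv1, hv2⟩ := T.eval_form_ne_zero.1 hv
  have hq (j : Fin 2) : algebraMap k K (v j) = lin T.b v * (q j).eval (T.coord v) := by
    apply mul_left_cancel₀ hD0
    fin_cases j
    · simp only [Fin.zero_eta, Fin.isValue, T.det_mul_zero, hD, q, coord]
      rw [← hD]
      simp
      field_simp
    · simp only [Fin.mk_one, Fin.isValue, T.det_mul_one, hD, q, coord]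
      rw [← hD]
      simp
      field_simp
  have h1 : algebraMap k K (MvPolynomial.eval v G) = lin T.b v ^ (e • 2) *
      (MvPolynomial.eval₂ (Polynomial.C.comp (algebraMap k K)) q G).eval (T.coord v) := by
    rw [← Polynomial.coe_evalRingHom, MvPolynomial.hom_eval₂, MvPolynomial.eval,
      MvPolynomial.coe_eval₂Hom, MvPolynomial.hom_eval₂]
    have : (fun j ↦ algebraMap k K (v j)) =
      fun j ↦ lin T.b v * (fun i ↦ Polynomial.evalRingHom (T.coord v) (q i)) j := funext hq
    rw [this, eval₂_mul_eq_of_isHomogeneous _ _ _ hG]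
    congr 2
    ext x
    simp
  rw [evalAway_mk, map_div₀, h1, map_pow, algebraMap_eval_form, smul_eq_mul, coord, pow_mul']
  rw [div_pow, inv_div, mul_pow]
  field_simp
  ring

end TorusForm

end Torus

end LogCurves

/-! ### Arithmetic of the torus: bounded denominators and unit translates. -/

namespace LogCurves

attribute [local instance] MvPolynomial.gradedAlgebra

open HomogeneousLocalization

section Torus

variable {k K : Type*} [Field k] [Field K] [NumberField k] [NumberField K] [Algebra k K]

omit [NumberField k] [NumberField K] in
theorem exists_ringOfIntegers_eq {x : k} (hx : _root_.IsIntegral ℤ (algebraMap k K x)) :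
    ∃ r : 𝓞 k, algebraMap (𝓞 k) k r = x :=
  ⟨⟨x, (isIntegral_algebraMap_iff (algebraMap k K).injective).1 hx⟩, rfl⟩

omit [NumberField k] [NumberField K] in
theorem apply_apply_of_finrank_eq_two [CharZero k] (hd : Module.finrank k K = 2) (σ : K ≃ₐ[k] K)
    (x : K) : σ (σ x) = x := by
  have : Algebra.IsQuadraticExtension k K := ⟨hd⟩
  have hcard : Nat.card (K ≃ₐ[k] K) = 2 := by
    rw [← hd]; exact IsGalois.card_aut_eq_finrank k K
  have h : σ ^ 2 = 1 := by rw [← hcard]; exact pow_card_eq_one'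
  rw [sq] at h
  exact congrArg (fun τ : K ≃ₐ[k] K ↦ τ x) h

theorem exists_int_multiples (s : Finset K) :
    ∃ d : ℤ, d ≠ 0 ∧ ∀ x ∈ s, _root_.IsIntegral ℤ ((d : K) * x) := by
  obtain ⟨d, hd, h⟩ := exists_integral_multiples ℤ ℚ s
  exact ⟨d, hd, fun x hx ↦ by simpa using h x hx⟩

namespace TorusForm

variable (T : TorusForm k K)

omit [NumberField k] [NumberField K] in
theorem conj_lin {σ : K ≃ₐ[k] K} {a b : Fin 2 → K} (h0 : σ (a 0) = b 0) (h1 : σ (a 1) = b 1)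
    (v : Fin 2 → k) : σ (lin a v) = lin b v := by
  simp [lin, h0, h1]

/-- Bounded denominators of all functions bound those of `t` and `t⁻¹`, so infinitely many values of
`t` are unit multiples of a single one. In the quadratic case these units have norm one, as ratios
of elements of norm one, and there are only finitely many such units if no place splits. -/
theorem infinite_units_and_exists_placeSplits
    {𝒳 : Set (Away (polyGrading k 1) T.form →+* k)} (hinf : 𝒳.Infinite)
    (hconst : ∀ χ ∈ 𝒳, χ.comp (awayConst _) = RingHom.id k)
    (hden : ∀ z, ∃ c : 𝓞 k, c ≠ 0 ∧ ∀ χ ∈ 𝒳, ∃ r : 𝓞 k, algebraMap (𝓞 k) k r = algebraMap (𝓞 k) k c * χ z) :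
    Infinite (𝓞 K)ˣ ∧
      (Module.finrank k K = 2 → ∃ v : InfinitePlace k, PlaceSplits (K := K) v) := by
  classical
  have hpt (χ : 𝒳) : ∃ (v : Fin 2 → k) (hv : MvPolynomial.eval v T.form ≠ 0),
      χ.1 = evalAway v hv := exists_eq_evalAway _ _ (hconst _ χ.2)
  choose V hV hVχ using hpt
  have htinj : Function.Injective fun χ ↦ T.coord (V χ) := fun χ χ' h ↦ Subtype.ext <| by
    rw [hVχ, hVχ, T.evalAway_eq_of_coord_eq (hV χ) (hV χ') h]
  have := hinf.to_subtype
  have hT := Set.infinite_range_of_injective htinj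
  have hlin (χ : 𝒳) := T.eval_form_ne_zero.1 (hV χ)
  -- common denominators
  obtain ⟨c, hc, hcint⟩ : ∃ c : 𝓞 k, c ≠ 0 ∧ ∀ (χ : 𝒳) (i j : Fin 2), ∃ r : 𝓞 k,
      algebraMap (𝓞 k) k r = algebraMap (𝓞 k) k c * χ.1 (Away.mk _ (quadForm_mem T.c) 1 _ (X_mul_X_mem i j)) := by
    choose c hc hcint using fun i j : Fin 2 ↦
      hden (Away.mk _ (quadForm_mem T.c) 1 _ (X_mul_X_mem i j))
    refine ⟨∏ p : Fin 2 × Fin 2, c p.1 p.2, Finset.prod_ne_zero_iff.2 fun p _ ↦ hc _ _,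
      fun χ i j ↦ ?_⟩
    obtain ⟨r, hr⟩ := hcint i j χ.1 χ.2
    obtain ⟨e, he⟩ : c i j ∣ ∏ p : Fin 2 × Fin 2, c p.1 p.2 :=
      Finset.dvd_prod_of_mem (fun p : Fin 2 × Fin 2 ↦ c p.1 p.2) (Finset.mem_univ (i, j))
    refine ⟨r * e, ?_⟩
    rw [he, map_mul, hr, map_mul]
    ring
  obtain ⟨d, hd, hdint⟩ := exists_int_multiples
    ({T.a 0 ^ 2, 2 * T.a 0 * T.a 1, T.a 1 ^ 2, T.b 0 ^ 2, 2 * T.b 0 * T.b 1, T.b 1 ^ 2} : Finset K)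
  simp only [Finset.mem_insert, Finset.mem_singleton, forall_eq_or_imp, forall_eq] at hdint
  obtain ⟨a00, a01, a11, b00, b01, b11⟩ := hdint
  have hcomb (χ : 𝒳) {x y z : K} (hx : _root_.IsIntegral ℤ ((d : K) * x)) (hy : _root_.IsIntegral ℤ ((d : K) * y))
      (hz : _root_.IsIntegral ℤ ((d : K) * z)) : _root_.IsIntegral ℤ ((d : K) * algebraMap k K (algebraMap (𝓞 k) k c) * (
        x * algebraMap k K (χ.1 (Away.mk _ (quadForm_mem T.c) 1 _ (X_mul_X_mem 0 0))) +
        y * algebraMap k K (χ.1 (Away.mk _ (quadForm_mem T.c) 1 _ (X_mul_X_mem 0 1))) +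
        z * algebraMap k K (χ.1 (Away.mk _ (quadForm_mem T.c) 1 _ (X_mul_X_mem 1 1))))) := by
    have h (i j : Fin 2) : _root_.IsIntegral ℤ (algebraMap k K (algebraMap (𝓞 k) k c) *
        algebraMap k K (χ.1 (Away.mk _ (quadForm_mem T.c) 1 _ (X_mul_X_mem i j)))) := by
      obtain ⟨r, hr⟩ := hcint χ i j
      rw [← map_mul, ← hr]
      exact (RingOfIntegers.isIntegral_coe r).map (IsScalarTower.toAlgHom ℤ k K)
    have := ((hx.mul (h 0 0)).add (hy.mul (h 0 1))).add (hz.mul (h 1 1))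
    refine Eq.mp (congrArg (_root_.IsIntegral ℤ) ?_) this
    ring
  -- Here `c` clears the denominators of the `X_i X_j / F` and `d` those of the coefficients in
  -- `coord_eq` and `coord_inv_eq`.
  obtain ⟨_, ⟨χ₀, rfl⟩, hu⟩ := NumberField.infinite_setOf_unit_mul_mem hT
    (by rintro _ ⟨χ, rfl⟩; exact div_ne_zero (hlin χ).1 (hlin χ).2)
    (c := (d : 𝓞 K) * algebraMap (𝓞 k) (𝓞 K) c) (by simpa using ⟨hd, hc⟩)
    (by
      rintro _ ⟨χ, rfl⟩
      refine ⟨⟨_, hcomb χ a00 a01 a11⟩, ?_⟩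
      change _ = _ * T.coord (V χ)
      rw [T.coord_eq (hV χ), ← hVχ]
      simp [← IsScalarTower.algebraMap_apply])
    (by
      rintro _ ⟨χ, rfl⟩
      refine ⟨⟨_, hcomb χ b00 b01 b11⟩, ?_⟩
      change _ = _ * (T.coord (V χ))⁻¹
      rw [T.coord_inv_eq (hV χ), ← hVχ]
      simp [← IsScalarTower.algebraMap_apply])
  refine ⟨Set.infinite_univ_iff.1 (hu.mono (Set.subset_univ _)), fun h2 ↦ ?_⟩
  obtain hsurj | ⟨-, σ, hσ0, hσ1⟩ := T.split_or
  · have e : k ≃ₗ[k] K := LinearEquiv.ofBijective (Algebra.linearMap k K)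
      ⟨(algebraMap k K).injective, hsurj⟩
    rw [← e.finrank_eq, Module.finrank_self] at h2
    omega
  · by_contra hsplit
    refine hu ((finite_setOf_norm_eq_one_of_not_placeSplits σ hsplit).subset ?_)
    rintro u ⟨χ, hχ⟩
    -- The involution `σ` exchanges `a v` and `b v`, hence inverts their ratio.
    have hnorm (χ : 𝒳) : T.coord (V χ) * σ (T.coord (V χ)) = 1 := by
      have h1 := conj_lin hσ0 hσ1 (V χ)
      have h3 : σ (lin T.b (V χ)) = lin T.a (V χ) := by
        rw [← h1, apply_apply_of_finrank_eq_two h2]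
      have := (hlin χ).1
      have := (hlin χ).2
      rw [coord, map_div₀, h1, h3]
      field_simp
    have h1 := hnorm χ
    rw [show T.coord (V χ) = algebraMap (𝓞 K) K u * T.coord (V χ₀) from hχ, map_mul] at h1
    change _ * _ = _
    linear_combination h1 - algebraMap (𝓞 K) K u * σ (algebraMap (𝓞 K) K u) * hnorm χ₀

omit [NumberField k] [NumberField K] in
-- A vector of `k²` killed by `a` is also killed by the conjugate form `b`, hence is zero; the map
-- `k² → K` given by `a` is therefore bijective by dimension.
theorem exists_lin_eq (hd : Module.finrank k K = 2) {σ : K ≃ₐ[k] K} (hσ0 : σ (T.a 0) = T.b 0)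
    (hσ1 : σ (T.a 1) = T.b 1) (x : K) : ∃ v : Fin 2 → k, lin T.a v = x := by
  have : FiniteDimensional k K := Module.finite_of_finrank_eq_succ hd
  let f : (Fin 2 → k) →ₗ[k] K :=
    { toFun := lin T.a
      map_add' := fun v w ↦ by simp only [lin, Pi.add_apply, map_add]; ring
      map_smul' := fun r v ↦ by
        simp only [lin, Pi.smul_apply, smul_eq_mul, map_mul, RingHom.id_apply, Algebra.smul_def]
        ring }
  have hinj : Function.Injective f := by
    rw [injective_iff_map_eq_zero]
    intro v hv
    change lin T.a v = 0 at hv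
    have hv' : lin T.b v = 0 := by rw [← conj_lin hσ0 hσ1, hv, map_zero]
    have h0 := T.det_mul_zero v
    have h1 := T.det_mul_one v
    simp only [hv, hv', mul_zero, sub_zero, mul_eq_zero, T.det_ne_zero, map_eq_zero,
      false_or] at h0 h1
    funext j
    fin_cases j <;> assumption
  exact (LinearMap.injective_iff_surjective_of_finrank_eq_finrank (by simp [hd])).1 hinj x

/-- If the units of `K` are infinite, and an archimedean place splits in the quadratic case, then
the torus has a unit of infinite order acting on its rational points. -/
theorem exists_unit_translates (hunits : Infinite (𝓞 K)ˣ)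
    (hsplit : Module.finrank k K = 2 → ∃ v : InfinitePlace k, PlaceSplits (K := K) v)
    {v₀ : Fin 2 → k} (hv₀ : MvPolynomial.eval v₀ T.form ≠ 0) :
    ∃ η : (𝓞 K)ˣ, Function.Injective (fun j : ℕ ↦ η ^ j) ∧ ∀ j : ℕ, ∃ v : Fin 2 → k,
      MvPolynomial.eval v T.form ≠ 0 ∧
        T.coord v = algebraMap (𝓞 K) K (η ^ j : (𝓞 K)ˣ) * T.coord v₀ := by
  obtain ⟨ha₀, hb₀⟩ := T.eval_form_ne_zero.1 hv₀
  have hne (e : (𝓞 K)ˣ) : algebraMap (𝓞 K) K e ≠ 0 := by simp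
  obtain hsurj | ⟨hd, σ, hσ0, hσ1⟩ := T.split_or
  · obtain ⟨η, w, hw⟩ := NumberField.Units.exists_place_ne_one (K := K)
    refine ⟨η, NumberField.Units.infinite_setOf_pow_of_place_ne_one hw, fun j ↦ ?_⟩
    set e := algebraMap (𝓞 K) K (η ^ j : (𝓞 K)ˣ) with he
    choose g hg using hsurj
    have hD := T.det_ne_zero
    -- Cramer's rule for the system `a v = e * a v₀`, `b v = b v₀`, whose solution lies in `k`
    -- because `K = k`.
    let v : Fin 2 → k := ![
      g ((T.b 1 * (e * lin T.a v₀) - T.a 1 * lin T.b v₀) / (T.a 0 * T.b 1 - T.a 1 * T.b 0)),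
      g ((T.a 0 * lin T.b v₀ - T.b 0 * (e * lin T.a v₀)) / (T.a 0 * T.b 1 - T.a 1 * T.b 0))]
    have h1 : lin T.a v = e * lin T.a v₀ := by
      simp only [lin.eq_1 T.a v, v, Matrix.cons_val_zero, Matrix.cons_val_one, hg]
      rw [mul_div, mul_div, ← add_div, div_eq_iff hD]
      ring
    have h2 : lin T.b v = lin T.b v₀ := by
      simp only [lin.eq_1 T.b v, v, Matrix.cons_val_zero, Matrix.cons_val_one, hg]
      rw [mul_div, mul_div, ← add_div, div_eq_iff hD]
      ring
    refine ⟨v, T.eval_form_ne_zero.2 ⟨?_, ?_⟩, ?_⟩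
    · rw [h1]; exact mul_ne_zero (hne _) ha₀
    · rwa [h2]
    · rw [coord, coord, h1, h2, mul_div_assoc]
  · have hσ : σ ≠ 1 := by
      rintro rfl
      apply T.det_ne_zero
      rw [← hσ0, ← hσ1]
      simp [mul_comm]
    obtain ⟨ε, w, hw⟩ := exists_unit_place_ne_of_placeSplits hd hσ (hsplit hd)
    -- Choosing `v` with `a v = ε ^ j * a v₀` gives `b v = σ (ε ^ j) * b v₀` by conjugation, so the
    -- coordinate is multiplied by the `j`-th power of `ε / σ ε`.
    let ε' : (𝓞 K)ˣ := Units.map (RingOfIntegers.mapRingHom (σ : K →+* K)).toMonoidHom ε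
    have hε' (j : ℕ) : algebraMap (𝓞 K) K (ε' ^ j : (𝓞 K)ˣ) =
        σ (algebraMap (𝓞 K) K (ε ^ j : (𝓞 K)ˣ)) := by
      rw [Units.val_pow_eq_pow_val, Units.val_pow_eq_pow_val, map_pow, map_pow, map_pow]
      rfl
    have hη (j : ℕ) : algebraMap (𝓞 K) K ((ε * ε'⁻¹) ^ j : (𝓞 K)ˣ) =
        algebraMap (𝓞 K) K (ε ^ j : (𝓞 K)ˣ) / σ (algebraMap (𝓞 K) K (ε ^ j : (𝓞 K)ˣ)) := by
      rw [← hε', eq_div_iff (hne _), ← map_mul, ← Units.val_mul]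
      congr 2
      rw [mul_pow, inv_pow, inv_mul_cancel_right]
    refine ⟨ε * ε'⁻¹, NumberField.Units.infinite_setOf_pow_of_place_ne_one (w := w) ?_, fun j ↦ ?_⟩
    · have := hη 1
      rw [pow_one, pow_one] at this
      rw [this, map_div₀]
      intro h
      rw [div_eq_one_iff_eq] at h
      · exact hw h
      · rw [Ne, map_eq_zero, map_eq_zero]
        exact hne _
    · obtain ⟨v, hv⟩ := T.exists_lin_eq hd hσ0 hσ1
        (algebraMap (𝓞 K) K (ε ^ j : (𝓞 K)ˣ) * lin T.a v₀)
      have hv' : lin T.b v = σ (algebraMap (𝓞 K) K (ε ^ j : (𝓞 K)ˣ)) * lin T.b v₀ := by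
        rw [← conj_lin hσ0 hσ1, hv, map_mul, conj_lin hσ0 hσ1]
      have hne' : σ (algebraMap (𝓞 K) K (ε ^ j : (𝓞 K)ˣ)) ≠ 0 := by
        rw [Ne, map_eq_zero]
        exact hne _
      refine ⟨v, T.eval_form_ne_zero.2 ⟨?_, ?_⟩, ?_⟩
      · rw [hv]; exact mul_ne_zero (hne _) ha₀
      · rw [hv']; exact mul_ne_zero hne' hb₀
      · rw [coord, coord, hv, hv', hη, mul_div_mul_comm]

/-- The rational points of the torus that differ from a given one by a unit congruent to `1`
modulo `N`. -/
def unitTranslates (v₀ : Fin 2 → k) (N : 𝓞 k) : Set (Away (polyGrading k 1) T.form →+* k) :=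
  {χ | ∃ (v : Fin 2 → k) (hv : MvPolynomial.eval v T.form ≠ 0) (u : (𝓞 K)ˣ), χ = evalAway v hv ∧
    T.coord v = algebraMap (𝓞 K) K u * T.coord v₀ ∧ algebraMap (𝓞 k) (𝓞 K) N ∣ (u : 𝓞 K) - 1}

omit [NumberField k] [NumberField K] in
theorem unitTranslates_anti (v₀ : Fin 2 → k) {N N' : 𝓞 k} (h : N ∣ N') :
    T.unitTranslates v₀ N' ⊆ T.unitTranslates v₀ N := by
  rintro _ ⟨v, hv, u, rfl, hu, hd⟩
  exact ⟨v, hv, u, rfl, hu, (map_dvd _ h).trans hd⟩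

omit [NumberField k] [NumberField K] in
theorem comp_awayConst_of_mem_unitTranslates {v₀ : Fin 2 → k} {N : 𝓞 k} {χ}
    (h : χ ∈ T.unitTranslates v₀ N) : χ.comp (awayConst _) = RingHom.id k := by
  obtain ⟨v, hv, u, rfl, -⟩ := h
  exact evalAway_comp_awayConst hv

/-- Some power `η ^ m` with `m > 0` is congruent to `1` modulo `N`, and its powers still move `v₀`
to pairwise distinct points. -/
theorem infinite_unitTranslates (hunits : Infinite (𝓞 K)ˣ)
    (hsplit : Module.finrank k K = 2 → ∃ v : InfinitePlace k, PlaceSplits (K := K) v)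
    {v₀ : Fin 2 → k} (hv₀ : MvPolynomial.eval v₀ T.form ≠ 0) {N : 𝓞 k} (hN : N ≠ 0) :
    (T.unitTranslates v₀ N).Infinite := by
  obtain ⟨η, hη, hv⟩ := T.exists_unit_translates hunits hsplit hv₀
  obtain ⟨m, hm, hdvd⟩ := NumberField.Units.exists_pow_sub_one_mem
    (a := algebraMap (𝓞 k) (𝓞 K) N) (by simpa using hN) η
  choose v hv hvc using fun j ↦ hv (m * j)
  refine Set.infinite_of_injective_forall_mem (f := fun j : ℕ ↦ evalAway (v j) (hv j)) ?_ ?_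
  · intro i j hij
    have h1 : T.coord (v i) = T.coord (v j) := by
      rw [T.coord_eq (hv i), T.coord_eq (hv j)]
      simp only at hij
      rw [hij]
    have h0 : T.coord v₀ ≠ 0 :=
      div_ne_zero (T.eval_form_ne_zero.1 hv₀).1 (T.eval_form_ne_zero.1 hv₀).2
    rw [hvc, hvc, mul_left_inj' h0] at h1
    have := hη (Units.ext (FaithfulSMul.algebraMap_injective (𝓞 K) K h1))
    exact Nat.eq_of_mul_eq_mul_left hm this
  · intro j
    refine ⟨v j, hv j, _, rfl, hvc j, ?_⟩
    rw [pow_mul]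
    exact dvd_units_pow_sub_one hdvd j

omit [NumberField k] [NumberField K] in
theorem exists_laurent_coeffs {v₀ : Fin 2 → k} (hv₀ : MvPolynomial.eval v₀ T.form ≠ 0)
    (z : Away (polyGrading k 1) T.form) :
    ∃ (s : Finset ℤ) (δ : ℤ → K), ∀ (v : Fin 2 → k) (hv : MvPolynomial.eval v T.form ≠ 0)
      (u : (𝓞 K)ˣ), T.coord v = algebraMap (𝓞 K) K u * T.coord v₀ →
      algebraMap k K (evalAway v hv z) =
        ∑ i ∈ s, δ i * algebraMap (𝓞 K) K (u ^ i : (𝓞 K)ˣ) := by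
  classical
  obtain ⟨p, m, hp⟩ := T.exists_polynomial z
  refine ⟨p.support.image fun i : ℕ ↦ (i : ℤ) - m,
    -- From `p (t) / t ^ m` at `t = u * t₀`: the exponents are `i - m` with `i` in the support of
    -- `p`, so `toNat` truncates nothing, and the powers of `t₀` are absorbed in the coefficients.
    fun i ↦ p.coeff (i + m).toNat * T.coord v₀ ^ i, fun v hv u hu ↦ ?_⟩
  have h0 : T.coord v₀ ≠ 0 :=
    div_ne_zero (T.eval_form_ne_zero.1 hv₀).1 (T.eval_form_ne_zero.1 hv₀).2
  have hu0 : algebraMap (𝓞 K) K u ≠ 0 := by simp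
  rw [hp v hv, hu, Polynomial.eval_eq_sum, Polynomial.sum, Finset.sum_mul,
    Finset.sum_image fun i _ j _ h ↦ by simpa using h]
  refine Finset.sum_congr rfl fun i _ ↦ ?_
  have hcoe : algebraMap (𝓞 K) K (u ^ ((i : ℤ) - m) : (𝓞 K)ˣ) =
      algebraMap (𝓞 K) K u ^ ((i : ℤ) - m) :=
    (congrArg Units.val (map_zpow (Units.map (algebraMap (𝓞 K) K).toMonoidHom) u ((i : ℤ) - m))).trans
      (Units.val_zpow_eq_zpow_val _ _)
  simp only [sub_add_cancel, Int.toNat_natCast, hcoe]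
  rw [zpow_sub₀ h0, zpow_sub₀ hu0]
  simp only [zpow_natCast]
  rw [mul_pow, mul_pow]
  field_simp

/-- Functions on the torus have bounded denominators on the unit translates of a point, and are
continuous there in the congruence topology. -/
theorem exists_bound {v₀ : Fin 2 → k} (hv₀ : MvPolynomial.eval v₀ T.form ≠ 0)
    (z : Away (polyGrading k 1) T.form) :
    ∃ c : 𝓞 k, c ≠ 0 ∧
      (∀ N, ∀ χ ∈ T.unitTranslates v₀ N, ∃ r, algebraMap (𝓞 k) k r = algebraMap (𝓞 k) k c * χ z) ∧
      ∀ N ≠ 0, ∀ χ ∈ T.unitTranslates v₀ (c * N), ∃ r : 𝓞 k,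
        χ z - evalAway v₀ hv₀ z = algebraMap (𝓞 k) k N * algebraMap (𝓞 k) k r := by
  classical
  obtain ⟨s, δ, hδ⟩ := T.exists_laurent_coeffs hv₀ z
  obtain ⟨d, hd, hdint⟩ := exists_int_multiples (s.image δ)
  simp only [Finset.mem_image, forall_exists_index, and_imp, forall_apply_eq_imp_iff₂] at hdint
  -- With `d` a common denominator of the Laurent coefficients, `u ≡ 1` modulo `d * N` makes each `δ
  -- i * (u ^ i - 1)` an integral multiple of `N`: the factor `d` is spent on `δ i`.
  refine ⟨d, by simpa using hd, ?_, ?_⟩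
  · rintro N _ ⟨v, hv, u, rfl, hu, -⟩
    apply exists_ringOfIntegers_eq (K := K)
    rw [map_mul, hδ v hv u hu, Finset.mul_sum, map_intCast, map_intCast]
    refine IsIntegral.sum _ fun i hi ↦ ?_
    rw [← mul_assoc]
    exact (hdint i hi).mul (RingOfIntegers.isIntegral_coe _)
  · rintro N hN _ ⟨v, hv, u, rfl, hu, hdvd⟩
    have hN' : algebraMap (𝓞 k) k N ≠ 0 := by simpa using hN
    suffices h : ∃ r : 𝓞 k, algebraMap (𝓞 k) k r =
        (evalAway v hv z - evalAway v₀ hv₀ z) / algebraMap (𝓞 k) k N by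
      obtain ⟨r, hr⟩ := h
      exact ⟨r, by rw [hr]; field_simp⟩
    apply exists_ringOfIntegers_eq (K := K)
    have h0 := hδ v₀ hv₀ 1 (by simp)
    have hN'' : algebraMap k K (algebraMap (𝓞 k) k N) ≠ 0 := by simpa using hN
    rw [map_div₀, map_sub, hδ v hv u hu, h0, ← Finset.sum_sub_distrib, Finset.sum_div]
    refine IsIntegral.sum _ fun i hi ↦ ?_
    obtain ⟨r, hr⟩ := dvd_units_zpow_sub_one hdvd i
    have hr' := congrArg (algebraMap (𝓞 K) K) hr
    simp only [map_sub, map_one, map_mul, map_intCast] at hr'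
    rw [← IsScalarTower.algebraMap_apply, IsScalarTower.algebraMap_apply (𝓞 k) k K] at hr'
    have : (δ i * algebraMap (𝓞 K) K (u ^ i : (𝓞 K)ˣ) -
        δ i * algebraMap (𝓞 K) K ((1 : (𝓞 K)ˣ) ^ i : (𝓞 K)ˣ)) /
          algebraMap k K (algebraMap (𝓞 k) k N) = d * δ i * algebraMap (𝓞 K) K r := by
      rw [div_eq_iff hN'']
      simp only [one_zpow, Units.val_one, map_one]
      linear_combination δ i * hr'
    rw [this]
    exact (hdint i hi).mul (RingOfIntegers.isIntegral_coe _)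

end TorusForm

end Torus

end LogCurves

/-! ### Gluing sections from local integrality. -/

namespace LogCurves

universe u

theorem isDominant_of_apply_eq_genericPoint {W P X : Scheme.{u}} [IrreducibleSpace X] (i : W ⟶ P)
    (q : P ⟶ X) [IsOpenImmersion q] (w : W) (h : q (i w) = genericPoint X) : IsDominant i := by
  refine ⟨fun z => ?_⟩
  have : i w ⤳ z := by
    rw [← q.isOpenEmbedding.isInducing.specializes_iff, h]
    exact genericPoint_specializes _
  exact this.mem_closed isClosed_closure (subset_closure ⟨w, rfl⟩)

theorem hom_ext_of_apply_eq_genericPoint {W P X Y S : Scheme.{u}} [IsIntegral X] {f g : P ⟶ Y}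
    (s : Y ⟶ S) [IsSeparated s] (h : f ≫ s = g ≫ s) (i : W ⟶ P) (q : P ⟶ X) [IsOpenImmersion q]
    (w : W) (hw : q (i w) = genericPoint X) (hi : i ≫ f = i ≫ g) : f = g := by
  have := isDominant_of_apply_eq_genericPoint i q w hw
  have : IsReduced P := isReduced_of_isOpenImmersion q
  exact ext_of_isDominant_of_isSeparated s h i hi

/-- The generic point `Spec k ⟶ Spec R`. -/
noncomputable abbrev specGeneric (R k : Type u) [CommRing R] [Field k] [Algebra R k] :
    Spec (CommRingCat.of k) ⟶ Spec (CommRingCat.of R) :=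
  Spec.map (CommRingCat.ofHom (algebraMap R k))

section

variable {R k : Type u} [CommRing R] [Field k] [Algebra R k] [IsDomain R] [IsFractionRing R k]

theorem specGeneric_apply (x : Spec (CommRingCat.of k)) :
    specGeneric R k x = genericPoint (Spec (CommRingCat.of R)) := by
  rw [genericPoint_eq_bot_of_affine]
  apply PrimeSpectrum.ext
  have hx : x.asIdeal = ⊥ := by
    have : x.asIdeal ≠ ⊤ := x.2.ne_top
    rcases Ideal.eq_bot_or_top x.asIdeal with h | h
    · exact h
    · exact absurd h this
  change Ideal.comap (algebraMap R k) x.asIdeal = ⊥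
  rw [hx]
  exact Ideal.comap_bot_of_injective _ (IsFractionRing.injective R k)

/-- A morphism from an integral scheme to a separated one can be glued from morphisms on an open
cover with a common generic restriction. -/
theorem exists_hom_of_cover {X Y S W : Scheme.{u}} [IsIntegral X] (a : X ⟶ S) (f : Y ⟶ S)
    [IsSeparated f] (g : W ⟶ X) (w : W) (hw : g w = genericPoint X) (y : W ⟶ Y)
    (𝒰 : X.OpenCover) (s : ∀ i, 𝒰.X i ⟶ Y) (hs : ∀ i, s i ≫ f = 𝒰.f i ≫ a)
    (l : ∀ i, W ⟶ 𝒰.X i) (hl : ∀ i, l i ≫ 𝒰.f i = g) (hy : ∀ i, l i ≫ s i = y) :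
    ∃ t : X ⟶ Y, t ≫ f = a ∧ g ≫ t = y := by
  have hcompat : ∀ p q, pullback.fst (𝒰.f p) (𝒰.f q) ≫ s p = pullback.snd (𝒰.f p) (𝒰.f q) ≫ s q := by
    intro p q
    let i : W ⟶ pullback (𝒰.f p) (𝒰.f q) := pullback.lift (l p) (l q) (by rw [hl, hl])
    refine hom_ext_of_apply_eq_genericPoint f ?_ i (pullback.fst _ _ ≫ 𝒰.f p) w ?_ ?_
    · rw [Category.assoc, Category.assoc, hs, hs, pullback.condition_assoc]
    · rw [← Scheme.Hom.comp_apply, pullback.lift_fst_assoc, hl, hw]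
    · rw [pullback.lift_fst_assoc, pullback.lift_snd_assoc, hy, hy]
  have hι : ∀ p, 𝒰.f p ≫ 𝒰.glueMorphisms s hcompat = s p := 𝒰.ι_glueMorphisms s hcompat
  refine ⟨𝒰.glueMorphisms s hcompat, ?_, ?_⟩
  · refine Scheme.Cover.hom_ext 𝒰 _ _ fun p => ?_
    rw [← Category.assoc, hι, hs]
  · obtain ⟨i, -⟩ := 𝒰.exists_eq (g w)
    rw [← hl i, Category.assoc, hι, hy]

/-- A rational point of a separated scheme over a domain is integral if it is integral
everywhere locally. -/
theorem exists_section_of_cover {Y : Scheme.{u}} (f : Y ⟶ Spec (CommRingCat.of R)) [IsSeparated f]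
    (y : Spec (CommRingCat.of k) ⟶ Y) (r : PrimeSpectrum R → R) (hr : ∀ p, r p ∉ p.asIdeal)
    (s : ∀ p, Spec (CommRingCat.of (Localization.Away (r p))) ⟶ Y)
    (hs : ∀ p, s p ≫ f =
      Spec.map (CommRingCat.ofHom (algebraMap R (Localization.Away (r p)))))
    (γ : ∀ p, Localization.Away (r p) →+* k)
    (hγ : ∀ p, (γ p).comp (algebraMap R _) = algebraMap R k)
    (hy : ∀ p, Spec.map (CommRingCat.ofHom (γ p)) ≫ s p = y) :
    ∃ t : Spec (CommRingCat.of R) ⟶ Y, t ≫ f = 𝟙 _ ∧ specGeneric R k ≫ t = y := by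
  have hspan : Ideal.span (Set.range r) = ⊤ := by
    by_contra h
    obtain ⟨m, hm, hle⟩ := Ideal.exists_le_maximal _ h
    exact hr ⟨m, hm.isPrime⟩ (hle (Ideal.subset_span ⟨_, rfl⟩))
  refine exists_hom_of_cover (𝟙 _) f (specGeneric R k) default (specGeneric_apply _) y
    (Scheme.affineOpenCoverOfSpanRangeEqTop (R := CommRingCat.of R) r hspan).openCover s
    (fun p => (hs p).trans (Category.comp_id _).symm)
    (fun p => Spec.map (CommRingCat.ofHom (γ p))) (fun p => ?_) hy
  refine (Spec.map_comp _ _).symm.trans ?_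
  exact congr_arg (fun g => Spec.map (CommRingCat.ofHom g)) (hγ p)

/-- A rational point lying in an affine chart `Spec A`, all of whose coordinates are integral at
every prime for a suitable choice of chart, is integral. -/
theorem exists_section_of_forall_prime {Y : Scheme.{u}} (f : Y ⟶ Spec (CommRingCat.of R))
    [IsSeparated f] [LocallyOfFiniteType f] (y : Spec (CommRingCat.of k) ⟶ Y)
    (hy : y ≫ f = specGeneric R k)
    (h : ∀ p : PrimeSpectrum R, ∃ (A : CommRingCat.{u}) (j : Spec A ⟶ Y) (_ : IsOpenImmersion j)
      (ω : A →+* k), Spec.map (CommRingCat.ofHom ω) ≫ j = y ∧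
        ∀ a, ∃ b c : R, c ∉ p.asIdeal ∧ algebraMap R k c * ω a = algebraMap R k b) :
    ∃ t : Spec (CommRingCat.of R) ⟶ Y, t ≫ f = 𝟙 _ ∧ specGeneric R k ≫ t = y := by
  have key : ∀ p : PrimeSpectrum R, ∃ r : R, r ∉ p.asIdeal ∧
      ∃ s : Spec (CommRingCat.of (Localization.Away r)) ⟶ Y,
        s ≫ f = Spec.map (CommRingCat.ofHom (algebraMap R (Localization.Away r))) ∧
        ∃ γ : Localization.Away r →+* k, γ.comp (algebraMap R _) = algebraMap R k ∧
          Spec.map (CommRingCat.ofHom γ) ≫ s = y := by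
    intro p
    obtain ⟨A, j, hj, ω, hω, hint⟩ := h p
    let α := (Spec.preimage (j ≫ f)).hom
    have hα : Spec.map (CommRingCat.ofHom α) = j ≫ f := Spec.map_preimage _
    have hωα : ω.comp α = algebraMap R k := by
      have : Spec.map (CommRingCat.ofHom (ω.comp α)) = specGeneric R k := by
        rw [CommRingCat.ofHom_comp, Spec.map_comp, hα, ← Category.assoc, hω, hy]
      exact congr_arg CommRingCat.Hom.hom (Spec.map_injective this)
    have hft : α.FiniteType := by
      have : LocallyOfFiniteType (Spec.map (CommRingCat.ofHom α)) := by
        rw [hα]; infer_instance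
      exact HasRingHomProperty.Spec_iff.mp this
    let := α.toAlgebra
    obtain ⟨T, hT⟩ := (show Algebra.FiniteType R A from hft).out
    choose b c hc hbc using hint
    -- The ring `A` is finitely generated over `R`, so one denominator prime to `p` serves for all
    -- coordinates and the point extends over the neighbourhood `Spec R[1/r]` of `p`.
    let r := ∏ a ∈ T, c a
    have hrp : r ∉ p.asIdeal := by
      intro hr
      obtain ⟨a, -, ha⟩ := (p.2.prod_mem_iff).mp hr
      exact hc a ha
    have hr0 : algebraMap R k r ≠ 0 := by
      rw [Ne, IsFractionRing.to_map_eq_zero_iff]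
      rintro h0
      exact hrp (h0 ▸ Ideal.zero_mem _)
    let γ : Localization.Away r →+* k :=
      IsLocalization.Away.lift r (g := algebraMap R k) (isUnit_iff_ne_zero.mpr hr0)
    have hγ : γ.comp (algebraMap R _) = algebraMap R k := IsLocalization.Away.lift_comp _ _
    have hγinj : Function.Injective γ := by
      refine (injective_iff_map_eq_zero γ).mpr fun z hz => ?_
      obtain ⟨x, s, rfl⟩ := IsLocalization.exists_mk'_eq (Submonoid.powers r) z
      have hx : algebraMap R k x = 0 := by
        rw [← hγ, RingHom.comp_apply, ← IsLocalization.mk'_spec _ x s, map_mul, hz, zero_mul]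
      rw [IsFractionRing.to_map_eq_zero_iff.mp hx, IsLocalization.mk'_zero]
    have hmem : ∀ a, ω a ∈ γ.range := by
      let S : Subalgebra R A :=
        { (γ.range.comap ω : Subring A) with
          algebraMap_mem' := fun x => by
            change ω (α x) ∈ γ.range
            rw [← RingHom.comp_apply, hωα, ← hγ]
            exact ⟨_, rfl⟩ }
      have hS : S = ⊤ := by
        rw [eq_top_iff, ← hT, Algebra.adjoin_le_iff]
        intro a ha
        change ω a ∈ γ.range
        have hu : IsUnit (algebraMap R (Localization.Away r) (c a)) := by
          refine isUnit_of_dvd_unit (map_dvd _ (Finset.dvd_prod_of_mem c ha))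
            (IsLocalization.Away.algebraMap_isUnit r)
        obtain ⟨u, hu⟩ := hu
        refine ⟨algebraMap R _ (b a) * ↑u⁻¹, ?_⟩
        have h1 : γ (algebraMap R _ (c a)) ≠ 0 := by
          rw [← hu]; exact (u.isUnit.map γ).ne_zero
        refine mul_left_cancel₀ h1 ?_
        rw [← map_mul, mul_left_comm, ← hu, Units.mul_inv, mul_one, hu]
        change (γ.comp (algebraMap R _)) (b a) = (γ.comp (algebraMap R _)) (c a) * ω a
        rw [hγ, hbc]
      intro a
      have : a ∈ S := hS ▸ Algebra.mem_top
      exact this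
    let e := RingEquiv.ofBijective γ.rangeRestrict
      ⟨fun x z h => hγinj (congr_arg Subtype.val h), γ.rangeRestrict_surjective⟩
    let β : A →+* Localization.Away r := e.symm.toRingHom.comp (ω.codRestrict γ.range hmem)
    have hγβ : γ.comp β = ω := by
      ext a
      have : e (β a) = ω.codRestrict γ.range hmem a := e.apply_symm_apply _
      exact congr_arg Subtype.val this
    refine ⟨r, hrp, Spec.map (CommRingCat.ofHom β) ≫ j, ?_, γ, hγ, ?_⟩
    · rw [Category.assoc, ← hα, ← Spec.map_comp, ← CommRingCat.ofHom_comp]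
      congr 2
      ext x
      apply hγinj
      change (γ.comp β) (α x) = (γ.comp (algebraMap R _)) x
      rw [hγβ, hγ, ← hωα]
      rfl
    · rw [← Category.assoc, ← Spec.map_comp, ← CommRingCat.ofHom_comp, hγβ, hω]
  choose r hr s hs γ hγ hy using key
  exact exists_section_of_cover f y r hr s hs γ hγ hy

end
end LogCurves

/-! ### Integrality of points in charts, and stability under congruences. -/

namespace LogCurves

universe u

section

variable {R k : Type u} [CommRing R] [Field k] [Algebra R k]

/-- The localization of a domain at a prime, as a subring of the field of fractions. -/
def localSubring (k : Type u) [Field k] [Algebra R k] (p : PrimeSpectrum R) : Subring k where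
  carrier := {x | ∃ b c : R, c ∉ p.asIdeal ∧ algebraMap R k c * x = algebraMap R k b}
  mul_mem' := by
    rintro x y ⟨b, c, hc, h⟩ ⟨b', c', hc', h'⟩
    refine ⟨b * b', c * c', fun hm => (p.2.mem_or_mem hm).elim hc hc', ?_⟩
    rw [map_mul, map_mul, ← h, ← h']; ring
  one_mem' := ⟨1, 1, fun h => p.2.ne_top ((Ideal.eq_top_iff_one _).mpr h), by simp⟩
  add_mem' := by
    rintro x y ⟨b, c, hc, h⟩ ⟨b', c', hc', h'⟩
    refine ⟨b * c' + b' * c, c * c', fun hm => (p.2.mem_or_mem hm).elim hc hc', ?_⟩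
    rw [map_add, map_mul, map_mul, map_mul, ← h, ← h']; ring
  zero_mem' := ⟨0, 1, fun h => p.2.ne_top ((Ideal.eq_top_iff_one _).mpr h), by simp⟩
  neg_mem' := by
    rintro x ⟨b, c, hc, h⟩
    exact ⟨-b, c, hc, by rw [map_neg, ← h]; ring⟩

theorem algebraMap_mem_localSubring (p : PrimeSpectrum R) (r : R) :
    algebraMap R k r ∈ localSubring k p :=
  ⟨r, 1, fun h => p.2.ne_top ((Ideal.eq_top_iff_one _).mpr h), by simp⟩

theorem mem_localSubring_of_mul {p : PrimeSpectrum R} {x : k} {c : R} (hc : c ∉ p.asIdeal)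
    (h : ∃ r : R, algebraMap R k r = algebraMap R k c * x) : x ∈ localSubring k p :=
  let ⟨r, hr⟩ := h
  ⟨r, c, hc, hr.symm⟩

variable [IsFractionRing R k]

theorem algebraMap_ne_zero_of_notMem {p : PrimeSpectrum R} {c : R} (hc : c ∉ p.asIdeal) :
    algebraMap R k c ≠ 0 := by
  rw [Ne, IsFractionRing.to_map_eq_zero_iff]
  rintro rfl
  exact hc (Ideal.zero_mem _)

theorem inv_algebraMap_mem_localSubring {p : PrimeSpectrum R} {c : R} (hc : c ∉ p.asIdeal) :
    (algebraMap R k c)⁻¹ ∈ localSubring k p :=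
  ⟨1, c, hc, by rw [mul_inv_cancel₀ (algebraMap_ne_zero_of_notMem hc), map_one]⟩

/-- If finitely many elements of a local ring add up to one, one of them is a unit. -/
theorem exists_inv_mem_localSubring {p : PrimeSpectrum R} {ι : Type*} (t : Finset ι) (x : ι → k)
    (hx : ∀ i ∈ t, x i ∈ localSubring k p) (hsum : ∑ i ∈ t, x i = 1) :
    ∃ i ∈ t, x i ≠ 0 ∧ (x i)⁻¹ ∈ localSubring k p := by
  by_contra! hcon
  -- `P` describes the maximal ideal of the local ring: if no summand had its inverse in the local
  -- ring, all summands would lie in this ideal, and so would `1`.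
  let P : k → Prop := fun y => ∃ b c : R, b ∈ p.asIdeal ∧ c ∉ p.asIdeal ∧
    algebraMap R k c * y = algebraMap R k b
  have h1 : P (∑ i ∈ t, x i) := by
    refine Finset.sum_induction _ P ?_ ?_ fun i hi => ?_
    · rintro y z ⟨b, c, hb, hc, h⟩ ⟨b', c', hb', hc', h'⟩
      refine ⟨b * c' + b' * c, c * c',
        Ideal.add_mem _ (Ideal.mul_mem_right _ _ hb) (Ideal.mul_mem_right _ _ hb'),
        fun hm => (p.2.mem_or_mem hm).elim hc hc', ?_⟩
      rw [map_add, map_mul, map_mul, map_mul, ← h, ← h']; ring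
    · exact ⟨0, 1, Ideal.zero_mem _, fun h => p.2.ne_top ((Ideal.eq_top_iff_one _).mpr h), by simp⟩
    · obtain ⟨b, c, hc, h⟩ := hx i hi
      refine ⟨b, c, by_contra fun hb => ?_, hc, h⟩
      have hb0 := algebraMap_ne_zero_of_notMem (k := k) hb
      have hx0 : x i ≠ 0 := fun h0 => hb0 (by rw [← h, h0, mul_zero])
      refine hcon i hi hx0 ⟨c, b, hb, ?_⟩
      rw [← h, mul_assoc, mul_inv_cancel₀ hx0, mul_one]
  rw [hsum] at h1
  obtain ⟨b, c, hb, hc, h⟩ := h1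
  rw [mul_one, (IsFractionRing.injective R k).eq_iff] at h
  exact hc (h ▸ hb)

end

section

variable {R k : Type u} [CommRing R] [Field k] [Algebra R k]
  {Y : Scheme.{u}} (f : Y ⟶ Spec (CommRingCat.of R))

/-- The coordinates, in an affine chart of `Y`, of the values of a family of points of `Y`
parametrized by `Spec B`. -/
theorem exists_chart_coordinates [LocallyOfFiniteType f] {B : Type u} [CommRing B] (cst : k →+* B)
    (ψ : Spec (CommRingCat.of B) ⟶ Y)
    (hψ : ψ ≫ f = Spec.map (CommRingCat.ofHom cst) ≫ specGeneric R k)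
    {A : CommRingCat.{u}} (j : Spec A ⟶ Y) [IsOpenImmersion j] (x : PrimeSpectrum B)
    (hx : ψ x ∈ Set.range j) :
    ∃ (g : B) (e : ℕ) (T : Finset A) (h : A → B), g ∉ x.asIdeal ∧
      ∀ χ : B →+* k, χ.comp cst = RingHom.id k → χ g ≠ 0 →
        ∃ ω : A →+* k, Spec.map (CommRingCat.ofHom ω) ≫ j = Spec.map (CommRingCat.ofHom χ) ≫ ψ ∧
          (∀ a ∈ T, ω a = χ (h a) / χ g ^ e) ∧
          ∀ S : Subring k, (∀ r : R, algebraMap R k r ∈ S) → (∀ a ∈ T, ω a ∈ S) → ∀ a, ω a ∈ S := by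
  -- On a basic neighbourhood `D(g)` of `x` the map `ψ` lands in the chart, so the chart's
  -- coordinates become fractions `h a / g ^ e` in `B`.
  obtain ⟨_, ⟨g, rfl⟩, hxg, hgj⟩ := PrimeSpectrum.isTopologicalBasis_basic_opens.exists_subset_of_mem_open
    (show x ∈ ψ ⁻¹ᵁ j.opensRange from hx) (ψ ⁻¹ᵁ j.opensRange).2
  let l := Spec.map (CommRingCat.ofHom (algebraMap B (Localization.Away g)))
  have hl : Set.range (l ≫ ψ) ⊆ Set.range j := by
    rintro _ ⟨z, rfl⟩
    have : l z ∈ (PrimeSpectrum.basicOpen g : Set (PrimeSpectrum B)) := by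
      rw [← PrimeSpectrum.localization_away_comap_range (Localization.Away g) g]
      exact ⟨z, rfl⟩
    exact hgj this
  let α : A →+* Localization.Away g := (Spec.preimage (IsOpenImmersion.lift j (l ≫ ψ) hl)).hom
  have hα : Spec.map (CommRingCat.ofHom α) ≫ j = l ≫ ψ := by
    have : Spec.map (CommRingCat.ofHom α) = IsOpenImmersion.lift j (l ≫ ψ) hl := Spec.map_preimage _
    rw [this, IsOpenImmersion.lift_fac]
  let δ : R →+* A := (Spec.preimage (j ≫ f)).hom
  have hδ : Spec.map (CommRingCat.ofHom δ) = j ≫ f := Spec.map_preimage _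
  have hft : δ.FiniteType := by
    have : LocallyOfFiniteType (Spec.map (CommRingCat.ofHom δ)) := by
      rw [hδ]; infer_instance
    exact HasRingHomProperty.Spec_iff.mp this
  let := δ.toAlgebra
  obtain ⟨T, hT⟩ := (show Algebra.FiniteType R A from hft).out
  classical
  obtain ⟨⟨_, e, rfl⟩, he⟩ := IsLocalization.exist_integer_multiples_of_finset
    (Submonoid.powers g) (T.image α)
  choose! h hh using fun a (ha : a ∈ T) => he (α a) (Finset.mem_image_of_mem _ ha)
  refine ⟨g, e, T, h, hxg, fun χ hχ hχg => ?_⟩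
  let χ' : Localization.Away g →+* k := IsLocalization.Away.lift g (isUnit_iff_ne_zero.mpr hχg)
  have hχ' : χ'.comp (algebraMap B _) = χ := IsLocalization.Away.lift_comp _ _
  have hω : Spec.map (CommRingCat.ofHom (χ'.comp α)) ≫ j = Spec.map (CommRingCat.ofHom χ) ≫ ψ := by
    rw [CommRingCat.ofHom_comp, Spec.map_comp, Category.assoc, hα, ← Category.assoc,
      ← Spec.map_comp, ← CommRingCat.ofHom_comp, hχ']
  have hωδ : (χ'.comp α).comp δ = algebraMap R k := by
    have : Spec.map (CommRingCat.ofHom ((χ'.comp α).comp δ)) = specGeneric R k := by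
      rw [CommRingCat.ofHom_comp, Spec.map_comp, hδ, ← Category.assoc, hω, Category.assoc, hψ,
        ← Category.assoc, ← Spec.map_comp, ← CommRingCat.ofHom_comp, hχ]
      exact (congr_arg (· ≫ _) (Spec.map_id _)).trans (Category.id_comp _)
    exact congr_arg CommRingCat.Hom.hom (Spec.map_injective this)
  refine ⟨χ'.comp α, hω, fun a ha => ?_, fun S hRS hS => ?_⟩
  · have h1 := congr_arg χ' (hh a ha)
    rw [Algebra.smul_def, map_mul] at h1
    change (χ'.comp (algebraMap B _)) (h a) = (χ'.comp (algebraMap B _)) (g ^ e) * _ at h1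
    rw [hχ', map_pow] at h1
    rw [h1, mul_div_cancel_left₀ _ (pow_ne_zero _ hχg)]
    rfl
  · let S' : Subalgebra R A :=
      { (S.comap (χ'.comp α) : Subring A) with
        algebraMap_mem' := fun x => by
          change ((χ'.comp α).comp δ) x ∈ S
          rw [hωδ]
          exact hRS x }
    have hS' : S' = ⊤ := by
      rw [eq_top_iff, ← hT, Algebra.adjoin_le_iff]
      exact hS
    intro a
    have : a ∈ S' := hS' ▸ Algebra.mem_top
    exact this

variable [IsFractionRing R k]

/-- The coordinates of an integral point are integral at a prime reducing into the chart. -/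
theorem coordinates_mem_localSubring (s : Spec (CommRingCat.of R) ⟶ Y) {A : CommRingCat.{u}}
    (j : Spec A ⟶ Y) [IsOpenImmersion j] (p : PrimeSpectrum R) (hp : s p ∈ Set.range j)
    (ω : A →+* k) (hω : Spec.map (CommRingCat.ofHom ω) ≫ j = specGeneric R k ≫ s) (a : A) :
    ω a ∈ localSubring k p := by
  let l := Spec.map (CommRingCat.ofHom (algebraMap R (Localization.AtPrime p.asIdeal)))
  have hl : Set.range (l ≫ s) ⊆ Set.range j := by
    rintro _ ⟨z, rfl⟩
    -- Every point of `Spec R_p` specializes to `p`, and open sets are stable under generization, so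
    -- `s` maps all of `Spec R_p` into the chart.
    have hz : l z ⤳ p := by
      refine (PrimeSpectrum.le_iff_specializes (l z) p).mp ?_
      intro r hr
      by_contra hrp
      have : IsUnit (algebraMap R (Localization.AtPrime p.asIdeal) r) :=
        IsLocalization.map_units _ (⟨r, hrp⟩ : p.asIdeal.primeCompl)
      exact z.2.ne_top (Ideal.eq_top_of_isUnit_mem _ hr this)
    exact (hz.map s.continuous).mem_open j.isOpenEmbedding.isOpen_range hp
  let β : A →+* Localization.AtPrime p.asIdeal :=
    (Spec.preimage (IsOpenImmersion.lift j (l ≫ s) hl)).hom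
  have hβ : Spec.map (CommRingCat.ofHom β) ≫ j = l ≫ s := by
    have : Spec.map (CommRingCat.ofHom β) = IsOpenImmersion.lift j (l ≫ s) hl := Spec.map_preimage _
    rw [this, IsOpenImmersion.lift_fac]
  let γ : Localization.AtPrime p.asIdeal →+* k :=
    IsLocalization.lift (M := p.asIdeal.primeCompl) (g := algebraMap R k) fun c =>
      isUnit_iff_ne_zero.mpr (algebraMap_ne_zero_of_notMem c.2)
  have hγ : γ.comp (algebraMap R _) = algebraMap R k := IsLocalization.lift_comp _
  have hωγ : ω = γ.comp β := by
    have : Spec.map (CommRingCat.ofHom ω) = Spec.map (CommRingCat.ofHom (γ.comp β)) := by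
      rw [← cancel_mono j, hω, CommRingCat.ofHom_comp, Spec.map_comp, Category.assoc, hβ,
        ← Category.assoc, ← Spec.map_comp, ← CommRingCat.ofHom_comp, hγ]
    exact congr_arg CommRingCat.Hom.hom (Spec.map_injective this)
  obtain ⟨b, c, hbc⟩ := IsLocalization.exists_mk'_eq p.asIdeal.primeCompl (β a)
  refine ⟨b, c, c.2, ?_⟩
  rw [hωγ, ← hγ, RingHom.comp_apply, RingHom.comp_apply, RingHom.comp_apply, ← map_mul, ← hbc,
    IsLocalization.mk'_spec']

end

/-- A nonzero element of a Dedekind domain lies in finitely many primes. -/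
theorem finite_setOf_mem_asIdeal {R : Type*} [CommRing R] [IsDedekindDomain R] {r : R}
    (hr : r ≠ 0) : {p : PrimeSpectrum R | r ∈ p.asIdeal}.Finite := by
  refine Set.Finite.of_finite_image (f := PrimeSpectrum.asIdeal)
    ((Ideal.finite_minimalPrimes_of_isNoetherianRing R (Ideal.span {r})).subset ?_)
    fun p _ q _ h => PrimeSpectrum.ext h
  rintro _ ⟨p, hp, rfl⟩
  -- In dimension one a prime containing `r ≠ 0` is minimal over `(r)`, because a nonzero prime
  -- below it is already maximal.
  refine ⟨⟨p.2, (Ideal.span_singleton_le_iff_mem _).mpr hp⟩, fun q ⟨hq, hN⟩ hqp => ?_⟩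
  have hq0 : q ≠ ⊥ := by
    rintro rfl
    exact hr ((Ideal.span_singleton_le_iff_mem _).mp hN)
  exact ((hq.isMaximal hq0).eq_of_le p.2.ne_top hqp).ge

section

variable {R k : Type u} [CommRing R] [IsDedekindDomain R] [Field k] [Algebra R k]
  [IsFractionRing R k] {Y : Scheme.{u}} (f : Y ⟶ Spec (CommRingCat.of R)) [IsSeparated f]
  [LocallyOfFiniteType f]

/-- Away from finitely many primes, integral values of finitely many functions suffice to place the
point integrally in some chart. At each remaining prime, a point congruent enough to the given
integral point `s` lies in the same chart as `s` with integral coordinates. The product of the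
moduli for these primes is `N`. -/
theorem exists_localized_section {B : Type u} [CommRing B] (cst : k →+* B)
    (ψ : Spec (CommRingCat.of B) ⟶ Y)
    (hψ : ψ ≫ f = Spec.map (CommRingCat.ofHom cst) ≫ specGeneric R k)
    (P : R → Set (B →+* k)) (hanti : ∀ N N', N ∣ N' → P N' ⊆ P N)
    (hP : ∀ N, ∀ χ ∈ P N, χ.comp cst = RingHom.id k)
    (χ₀ : B →+* k) (hχ₀ : χ₀.comp cst = RingHom.id k)
    (s : Spec (CommRingCat.of R) ⟶ Y)
    (hs : specGeneric R k ≫ s = Spec.map (CommRingCat.ofHom χ₀) ≫ ψ)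
    (H₁ : ∀ b, ∃ c : R, c ≠ 0 ∧ ∀ N, ∀ χ ∈ P N, ∃ r : R,
      algebraMap R k r = algebraMap R k c * χ b)
    (H₂ : ∀ b, ∃ c : R, c ≠ 0 ∧ ∀ N, N ≠ 0 → ∀ χ ∈ P (c * N), ∃ r : R,
      χ b - χ₀ b = algebraMap R k N * algebraMap R k r) :
    ∃ N : R, N ≠ 0 ∧ ∀ χ ∈ P N, ∃ t : Spec (CommRingCat.of R) ⟶ Y,
      t ≫ f = 𝟙 _ ∧ specGeneric R k ≫ t = Spec.map (CommRingCat.ofHom χ) ≫ ψ := by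
  classical
  let good : PrimeSpectrum R → (B →+* k) → Prop := fun p χ =>
    ∃ (A : CommRingCat.{u}) (j : Spec A ⟶ Y) (_ : IsOpenImmersion j)
      (ω : A →+* k), Spec.map (CommRingCat.ofHom ω) ≫ j = Spec.map (CommRingCat.ofHom χ) ≫ ψ ∧
        ∀ a, ω a ∈ localSubring k p
  have hgood : ∀ χ : B →+* k, χ.comp cst = RingHom.id k → (∀ p, good p χ) →
      ∃ t : Spec (CommRingCat.of R) ⟶ Y,
      t ≫ f = 𝟙 _ ∧ specGeneric R k ≫ t = Spec.map (CommRingCat.ofHom χ) ≫ ψ := by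
    intro χ hχ h
    refine exists_section_of_forall_prime f _ ?_ h
    rw [Category.assoc, hψ, ← Category.assoc, ← Spec.map_comp, ← CommRingCat.ofHom_comp, hχ]
    exact (congr_arg (· ≫ _) (Spec.map_id _)).trans (Category.id_comp _)
  have hlarge : ∃ N₁ : R, N₁ ≠ 0 ∧ ∀ p : PrimeSpectrum R, N₁ ∉ p.asIdeal → ∀ N, ∀ χ ∈ P N,
      good p χ := by
    have hch : ∀ x : PrimeSpectrum B, ∃ (A : CommRingCat.{u}) (j : Spec A ⟶ Y)
        (_ : IsOpenImmersion j), ψ x ∈ Set.range j := fun x =>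
      ⟨_, Y.affineOpenCover.f (Y.affineOpenCover.idx (ψ x)), inferInstance,
        Y.affineOpenCover.covers (ψ x)⟩
    choose A j hj hx using hch
    choose g e T h hgx hχ using fun x => exists_chart_coordinates f cst ψ hψ (j x) x (hx x)
    -- The functions `g x` give a relation `∑ z i * g i = 1`. If the finitely many functions
    -- involved take values in the local ring at `p`, some `χ (g i)` is a unit there, and chart `i`
    -- has integral coordinates `χ (h a) / χ (g i) ^ e`.
    have hspan : (1 : B) ∈ Ideal.span (Set.range g) := by
      rw [← Ideal.eq_top_iff_one]
      by_contra hne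
      obtain ⟨m, hm, hle⟩ := Ideal.exists_le_maximal _ hne
      exact hgx ⟨m, hm.isPrime⟩ (hle (Ideal.subset_span ⟨_, rfl⟩))
    obtain ⟨z, hz⟩ := Finsupp.mem_ideal_span_range_iff_exists_finsupp.mp hspan
    choose c hc0 hc using H₁
    let t : Finset B := z.support.biUnion fun i => {z i, g i} ∪ (T i).image (h i)
    have ht : ∀ i ∈ z.support, z i ∈ t ∧ g i ∈ t ∧ ∀ a ∈ T i, h i a ∈ t := fun i hi =>
      ⟨Finset.mem_biUnion.mpr ⟨i, hi, by simp⟩, Finset.mem_biUnion.mpr ⟨i, hi, by simp⟩,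
        fun a ha => Finset.mem_biUnion.mpr ⟨i, hi, Finset.mem_union_right _
          (Finset.mem_image_of_mem _ ha)⟩⟩
    refine ⟨∏ b ∈ t, c b, Finset.prod_ne_zero_iff.mpr fun b _ => hc0 b, fun p hp N χ hχN => ?_⟩
    have hint : ∀ b ∈ t, χ b ∈ localSubring k p := fun b hb =>
      mem_localSubring_of_mul
        (fun hm => hp (Ideal.mem_of_dvd _ (Finset.dvd_prod_of_mem c hb) hm)) (hc b N χ hχN)
    obtain ⟨i, hi, hne, hinv⟩ := exists_inv_mem_localSubring (p := p) z.support
      (fun i => χ (z i) * χ (g i))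
      (fun i hi => mul_mem (hint _ (ht i hi).1) (hint _ (ht i hi).2.1)) (by
        simp_rw [← map_mul]
        rw [← map_sum, ← map_one χ]
        exact congr_arg χ hz)
    have hginv : (χ (g i))⁻¹ ∈ localSubring k p := by
      have := mul_mem (hint _ (ht i hi).1) hinv
      rwa [mul_inv, mul_inv_cancel_left₀ (left_ne_zero_of_mul hne)] at this
    obtain ⟨ω, hω, hωT, hS⟩ := hχ i χ (hP _ χ hχN) (right_ne_zero_of_mul hne)
    refine ⟨A i, j i, hj i, ω, hω, hS _ (algebraMap_mem_localSubring p) fun a ha => ?_⟩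
    rw [hωT a ha, div_eq_mul_inv, ← inv_pow]
    exact mul_mem (hint _ ((ht i hi).2.2 a ha)) (pow_mem hginv _)
  have hsmall : ∀ N₁ : R, N₁ ≠ 0 → ∀ p : PrimeSpectrum R, N₁ ∈ p.asIdeal →
      ∃ N : R, N ≠ 0 ∧ ∀ χ ∈ P N, good p χ := by
    intro N₁ hN₁ p hp
    let A := Y.affineOpenCover.X (Y.affineOpenCover.idx (s p))
    let j : Spec A ⟶ Y := Y.affineOpenCover.f (Y.affineOpenCover.idx (s p))
    have hsp : s p ∈ Set.range j := Y.affineOpenCover.covers (s p)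
    let x₀ : PrimeSpectrum B := Spec.map (CommRingCat.ofHom χ₀) (default : Spec (CommRingCat.of k))
    have hx₀ : ψ x₀ ∈ Set.range j := by
      have h1 : ψ x₀ = s (genericPoint (Spec (CommRingCat.of R))) := by
        rw [← specGeneric_apply (k := k) default, ← Scheme.Hom.comp_apply,
          ← Scheme.Hom.comp_apply, hs]
      rw [h1]
      exact ((genericPoint_specializes p).map s.continuous).mem_open
        j.isOpenEmbedding.isOpen_range hsp
    obtain ⟨g, e, T, h, hgx, hχ⟩ := exists_chart_coordinates f cst ψ hψ j x₀ hx₀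
    have hg0 : χ₀ g ≠ 0 := by
      intro h0
      apply hgx
      change χ₀ g ∈ (default : Spec (CommRingCat.of k)).asIdeal
      rw [h0]
      exact Ideal.zero_mem _
    obtain ⟨ω₀, hω₀, hω₀T, -⟩ := hχ χ₀ hχ₀ hg0
    have hint₀ := coordinates_mem_localSubring s j p hsp ω₀ (hω₀.trans hs.symm)
    obtain ⟨α, β, hβ, hαβ⟩ := IsFractionRing.div_surjective (A := R) (χ₀ g)
    have hβ0 : algebraMap R k β ≠ 0 := fun h0 => hg0 (by rw [← hαβ, h0, div_zero])
    have hα0 : algebraMap R k α ≠ 0 := fun h0 => hg0 (by rw [← hαβ, h0, zero_div])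
    have hα0' : α ≠ 0 := fun h0 => hα0 (by rw [h0, map_zero])
    choose c hc0 hc using H₂
    -- Write `χ₀ g = α / β`. Congruence modulo `α * N₁` yields `χ g = χ₀ g * (1 + β * N₁ * r)`,
    -- where the last factor is a unit at `p` because `N₁ ∈ p`. Congruence of the numerators modulo
    -- `α ^ e` changes the coordinates by `β ^ e * r'`, which is integral, up to a power of this
    -- unit.
    refine ⟨c g * (α * N₁) * ∏ a ∈ T, c (h a) * α ^ e, mul_ne_zero
      (mul_ne_zero (hc0 _) (mul_ne_zero hα0' hN₁)) (Finset.prod_ne_zero_iff.mpr fun a _ =>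
        mul_ne_zero (hc0 _) (pow_ne_zero _ hα0')), fun χ hχN => ?_⟩
    obtain ⟨r, hr⟩ := hc g (α * N₁) (mul_ne_zero hα0' hN₁) χ (hanti _ _ (dvd_mul_right _ _) hχN)
    have hu : 1 + β * N₁ * r ∉ p.asIdeal := fun hm => p.2.ne_top <|
      (Ideal.eq_top_iff_one _).mpr <| (Ideal.add_mem_iff_left _
        (Ideal.mul_mem_right _ _ (Ideal.mul_mem_left _ _ hp))).mp hm
    have hχg : χ g = χ₀ g * algebraMap R k (1 + β * N₁ * r) := by
      rw [eq_add_of_sub_eq hr, ← hαβ]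
      simp only [map_add, map_mul, map_one]
      field_simp
      ring
    have hχg0 : χ g ≠ 0 := by
      rw [hχg]
      exact mul_ne_zero hg0 (algebraMap_ne_zero_of_notMem hu)
    obtain ⟨ω, hω, hωT, hS⟩ := hχ χ (hP _ χ hχN) hχg0
    refine ⟨A, j, inferInstance, ω, hω, hS _ (algebraMap_mem_localSubring p) fun a ha => ?_⟩
    obtain ⟨r', hr'⟩ := hc (h a) (α ^ e) (pow_ne_zero _ hα0') χ
      (hanti _ _ (Dvd.dvd.mul_left (Finset.dvd_prod_of_mem (fun a => c (h a) * α ^ e) ha) _) hχN)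
    have : ω a = (ω₀ a + algebraMap R k (β ^ e * r')) *
        (algebraMap R k (1 + β * N₁ * r))⁻¹ ^ e := by
      have h2 : algebraMap R k (β ^ e * r') = (χ (h a) - χ₀ (h a)) / χ₀ g ^ e := by
        rw [hr', ← hαβ, map_mul, map_pow, map_pow, div_pow]
        field_simp
      rw [hωT a ha, hω₀T a ha, hχg, mul_pow, h2, ← add_div, add_sub_cancel, inv_pow, div_mul_eq_div_div,
        div_eq_mul_inv (_ / _)]
    rw [this]
    exact mul_mem (add_mem (hint₀ a) (algebraMap_mem_localSubring p _))
      (pow_mem (inv_algebraMap_mem_localSubring hu) _)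
  obtain ⟨N₁, hN₁, hl⟩ := hlarge
  choose! N₂ hN₂ hg using hsmall N₁ hN₁
  have hfin := finite_setOf_mem_asIdeal hN₁
  refine ⟨∏ p ∈ hfin.toFinset, N₂ p, Finset.prod_ne_zero_iff.mpr fun p hp =>
    hN₂ p (hfin.mem_toFinset.mp hp), fun χ hχ => hgood χ (hP _ χ hχ) fun p => ?_⟩
  by_cases hp : N₁ ∈ p.asIdeal
  · exact hg p hp χ (hanti _ _ (Finset.dvd_prod_of_mem _ (hfin.mem_toFinset.mpr hp)) hχ)
  · exact hl p hp _ χ hχ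

end
end LogCurves

/-! ### Topology and local rings of the projective line. -/

namespace LogCurves

universe u

attribute [local instance] MvPolynomial.gradedAlgebra

open HomogeneousLocalization

section

variable {k : Type u} [Field k] {n : ℕ}

/-- The open immersion of the complement of a hypersurface into projective space. -/
noncomputable def complementι {F : MvPolynomial (Fin (n + 1)) k} {d : ℕ}
    (hF : F ∈ polyGrading k n d) (hd : 0 < d) :
    Spec (CommRingCat.of (Away (polyGrading k n) F)) ⟶ projSpace n k :=
  Proj.awayι (polyGrading k n) F hF hd

instance {F : MvPolynomial (Fin (n + 1)) k} {d : ℕ} (hF : F ∈ polyGrading k n d) (hd : 0 < d) :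
    IsOpenImmersion (complementι hF hd) :=
  inferInstanceAs (IsOpenImmersion (Proj.awayι (polyGrading k n) F hF hd))

/-- The homogeneous ideal of a point of projective space. -/
noncomputable def pointIdeal (x : projSpace n k) : Ideal (MvPolynomial (Fin (n + 1)) k) :=
  (show ProjectiveSpectrum (polyGrading k n) from x).asHomogeneousIdeal.toIdeal

variable {F : MvPolynomial (Fin (n + 1)) k} {d : ℕ} (hF : F ∈ polyGrading k n d) (hd : 0 < d)

theorem mem_range_complementι {x : projSpace n k} :
    x ∈ Set.range (complementι hF hd) ↔ F ∉ pointIdeal x := by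
  have : x ∈ (Proj.awayι (polyGrading k n) F hF hd).opensRange ↔ x ∈ Proj.basicOpen (polyGrading k n) F := by
    rw [Proj.opensRange_awayι]
  exact this

theorem complementι_comp_projSpaceStr :
    complementι hF hd ≫ projSpaceStr n k = Spec.map (CommRingCat.ofHom (awayConst F)) := by
  change Proj.awayι (polyGrading k n) F hF hd ≫ Proj.toSpecZero _ ≫ _ = _
  rw [Proj.awayι_toSpecZero_assoc, ← Spec.map_comp, ← CommRingCat.ofHom_comp]
  rfl

theorem exists_X_notMem_pointIdeal (x : projSpace n k) :
    ∃ i, (MvPolynomial.X i : MvPolynomial (Fin (n + 1)) k) ∉ pointIdeal x := by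
  have h := Proj.iSup_basicOpen_eq_top' (polyGrading k n)
    (fun i : Fin (n + 1) => (MvPolynomial.X i : MvPolynomial (Fin (n + 1)) k))
    (fun i => ⟨1, MvPolynomial.isHomogeneous_X k i⟩) (by
      rw [eq_top_iff]
      rintro p -
      induction p using MvPolynomial.induction_on with
      | C a =>
        exact (Algebra.adjoin (polyGrading k n 0) _).algebraMap_mem
          ⟨MvPolynomial.C a, MvPolynomial.isHomogeneous_C _ a⟩
      | add p q hp hq => exact add_mem hp hq
      | mul_X p i hp => exact mul_mem hp (Algebra.subset_adjoin ⟨i, rfl⟩))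
  have hx : (show Proj (polyGrading k n) from x) ∈ (⊤ : (Proj (polyGrading k n)).Opens) := trivial
  rw [← h] at hx
  exact TopologicalSpace.Opens.mem_iSup.mp hx

theorem isDomain_away (h0 : F ≠ 0) : IsDomain (Away (polyGrading k n) F) := by
  have := IsLocalization.isDomain_localization (M := Submonoid.powers F)
    (powers_le_nonZeroDivisors_of_noZeroDivisors h0)
  exact (show Function.Injective (algebraMap (Away (polyGrading k n) F)
    (Localization (Submonoid.powers F))) from val_injective _).isDomain (algebraMap _ _)

theorem X_mem (i : Fin (n + 1)) :
    (MvPolynomial.X i : MvPolynomial (Fin (n + 1)) k) ∈ polyGrading k n 1 :=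
  MvPolynomial.isHomogeneous_X k i

/-- The affine coordinates on the standard charts of projective space. -/
noncomputable def affineCoord (k : Type u) [Field k] {n : ℕ} (i j : Fin (n + 1)) :
    Away (polyGrading k n) (MvPolynomial.X i) :=
  Away.mk _ (X_mem i) 1 (MvPolynomial.X j) (by simpa using X_mem j)

theorem affineCoord_self (i : Fin (n + 1)) : affineCoord k i i = 1 := by
  rw [affineCoord, away_mk_eq_iff]
  simp

theorem eval₂_affineCoord (i : Fin (n + 1)) {e : ℕ} {G : MvPolynomial (Fin (n + 1)) k}
    (hG : G ∈ polyGrading k n (e • 1)) :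
    MvPolynomial.eval₂ (awayConst _) (affineCoord k i) G = Away.mk _ (X_mem i) e G hG := by
  symm
  rw [away_mk_eq_iff, ← HomogeneousLocalization.algebraMap_apply, MvPolynomial.hom_eval₂]
  have hG' : G.IsHomogeneous e := by simpa using hG
  rw [← eval₂_mul_eq_of_isHomogeneous _ _ _ hG']
  set t := toLoc (MvPolynomial.X i : MvPolynomial (Fin (n + 1)) k)
  set ψ := algebraMap (Away (polyGrading k n) (MvPolynomial.X i))
    (Localization (Submonoid.powers (MvPolynomial.X i : MvPolynomial (Fin (n + 1)) k)))
  have h1 (j : Fin (n + 1)) : t (MvPolynomial.X i) * ψ (affineCoord k i j) =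
      t (MvPolynomial.X j) := by
    have := away_mk_val (X_mem i) 1 (MvPolynomial.X j : MvPolynomial (Fin (n + 1)) k)
      (by simpa using X_mem j)
    rwa [pow_one] at this
  have h3 : (fun j => t (MvPolynomial.X i) * ψ (affineCoord k i j)) =
      fun j => t (MvPolynomial.X j) := funext h1
  have h2 : ψ.comp (awayConst _) = t.comp MvPolynomial.C := RingHom.ext val_awayConst
  rw [h3, h2, ← MvPolynomial.coe_eval₂Hom]
  exact congrFun (congrArg DFunLike.coe (MvPolynomial.ringHom_ext (by simp) (by simp))) G

/-- Setting `X i = 1` turns forms into polynomials in the other coordinate. The chart ring is thus a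
quotient of `k[X]`, hence principal, which yields the dimension and regularity properties of the
line. -/
theorem eval₂_affineCoord_surjective (i : Fin 2) : Function.Surjective
    (Polynomial.eval₂RingHom (awayConst (k := k) (n := 1) (MvPolynomial.X i))
      (affineCoord k i (1 - i))) := by
  intro z
  obtain ⟨e, G, hG, rfl⟩ := Away.mk_surjective _ (X_mem i) z
  refine ⟨MvPolynomial.eval₂ Polynomial.C (fun j => if j = i then 1 else Polynomial.X) G, ?_⟩
  rw [MvPolynomial.hom_eval₂, ← eval₂_affineCoord i hG]
  congr 1
  · ext a; simp
  · funext j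
    by_cases hj : j = i
    · subst hj
      simp [affineCoord_self]
    · have : j = 1 - i := by omega
      subst this
      simp [hj]

theorem isPrincipalIdealRing_away (i : Fin 2) :
    IsPrincipalIdealRing (Away (polyGrading k 1) (MvPolynomial.X i)) :=
  IsPrincipalIdealRing.of_surjective _ (eval₂_affineCoord_surjective i)

/-- The standard charts of the projective line. -/
noncomputable abbrev chartι (i : Fin 2) :
    Spec (CommRingCat.of (Away (polyGrading k 1) (MvPolynomial.X i))) ⟶ projSpace 1 k :=
  complementι (X_mem i) one_pos

theorem exists_chartι_eq (x : projSpace 1 k) : ∃ i y, chartι (k := k) i y = x := by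
  obtain ⟨i, hi⟩ := exists_X_notMem_pointIdeal x
  exact ⟨i, (mem_range_complementι (X_mem i) one_pos).mpr hi⟩

theorem specializes_iff_pointIdeal_le {x y : projSpace n k} :
    x ⤳ y ↔ pointIdeal x ≤ pointIdeal y := by
  rw [specializes_iff_mem_closure]
  exact (ProjectiveSpectrum.le_iff_mem_closure (polyGrading k n) x y).symm

variable (k n) in
/-- The generic point of projective space. -/
noncomputable def projGeneric : projSpace n k :=
  (show ProjectiveSpectrum (polyGrading k n) from
    ⟨⊥, by
      change (⊥ : Ideal (MvPolynomial (Fin (n + 1)) k)).IsPrime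
      exact Ideal.isPrime_bot, fun h => by
      have h1 : (MvPolynomial.X 0 : MvPolynomial (Fin (n + 1)) k) ∈
        HomogeneousIdeal.irrelevant (polyGrading k n) := by
          rw [HomogeneousIdeal.mem_irrelevant_iff]
          exact DirectSum.decompose_of_mem_ne _ (X_mem (k := k) 0) one_ne_zero
      have h2 := h h1
      exact MvPolynomial.X_ne_zero (R := k) (0 : Fin (n + 1)) h2⟩)

variable (k n) in
theorem pointIdeal_projGeneric : pointIdeal (projGeneric k n) = ⊥ := rfl

theorem projGeneric_specializes (x : projSpace n k) : projGeneric k n ⤳ x := by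
  rw [specializes_iff_pointIdeal_le, pointIdeal_projGeneric k n]
  exact bot_le

instance : IrreducibleSpace (projSpace n k) := by
  rw [irreducibleSpace_def]
  have h : closure {projGeneric k n} = Set.univ :=
    Set.eq_univ_of_forall fun x => (projGeneric_specializes x).mem_closure
  change IsIrreducible Set.univ
  rw [← h]
  exact isIrreducible_singleton.closure

theorem genericPoint_projSpace : genericPoint (projSpace n k) = projGeneric k n :=
  ((genericPoint_specializes _).antisymm (projGeneric_specializes _)).eq

end

section

variable {k : Type u} [Field k]

instance (i : Fin 2) : IsDomain (Away (polyGrading k 1) (MvPolynomial.X i)) :=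
  isDomain_away (MvPolynomial.X_ne_zero i)

instance (i : Fin 2) : IsPrincipalIdealRing (Away (polyGrading k 1) (MvPolynomial.X i)) :=
  isPrincipalIdealRing_away i

theorem chartι_bot (i : Fin 2) : chartι (k := k) i (⊥ : PrimeSpectrum _) = projGeneric k 1 := by
  have h := genericPoint_eq_of_isOpenImmersion (chartι (k := k) i)
  rw [genericPoint_projSpace] at h
  rw [← h]
  exact congr_arg _ (genericPoint_eq_bot_of_affine _).symm

/-- The points of the projective line are closed, except for the generic one. -/
theorem eq_of_specializes {x y : projSpace 1 k} (h : x ⤳ y) (hx : x ≠ projGeneric k 1) :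
    x = y := by
  obtain ⟨i, q, rfl⟩ := exists_chartι_eq y
  obtain ⟨p, rfl⟩ := h.mem_open (chartι (k := k) i).isOpenEmbedding.isOpen_range ⟨q, rfl⟩
  have hpq : p ⤳ q := (chartι (k := k) i).isOpenEmbedding.isInducing.specializes_iff.mp h
  have hp : (show PrimeSpectrum (Away (polyGrading k 1) (MvPolynomial.X i)) from p).asIdeal ≠ ⊥ := by
    intro h0
    apply hx
    rw [← chartι_bot i]
    exact congr_arg _ (PrimeSpectrum.ext h0)
  congr 1
  refine PrimeSpectrum.ext ((((PrimeSpectrum.isPrime _).isMaximal hp).eq_of_le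
    (PrimeSpectrum.isPrime _).ne_top ?_))
  exact (PrimeSpectrum.le_iff_specializes _ _).mpr hpq

/-- The proper closed subsets of the projective line are finite. -/
theorem finite_of_isClosed {Z : Set (projSpace 1 k)} (hZ : IsClosed Z)
    (hgen : projGeneric k 1 ∉ Z) : Z.Finite := by
  have h (i : Fin 2) : (chartι (k := k) i ⁻¹' Z).Finite := by
    have hc : IsClosed (chartι (k := k) i ⁻¹' Z) := hZ.preimage (chartι (k := k) i).continuous
    obtain ⟨s, hs⟩ := (PrimeSpectrum.isClosed_iff_zeroLocus _).mp hc
    have hbot : (⊥ : PrimeSpectrum (Away (polyGrading k 1) (MvPolynomial.X i))) ∉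
        PrimeSpectrum.zeroLocus s := by
      rw [← hs]
      intro h
      apply hgen
      rw [← chartι_bot i]
      exact h
    obtain ⟨r, hr, hr0⟩ := Set.not_subset.mp hbot
    rw [hs]
    exact (finite_setOf_mem_asIdeal hr0).subset fun p hp => hp hr
  refine (Set.finite_iUnion fun i => (h i).image (chartι (k := k) i)).subset fun x hx => ?_
  obtain ⟨i, y, rfl⟩ := exists_chartι_eq x
  exact Set.mem_iUnion.mpr ⟨i, y, hx, rfl⟩

/-- Each local ring is a localization of a principal ideal domain at a prime. -/
instance (x : projSpace 1 k) : IsRegularLocalRing ((projSpace 1 k).presheaf.stalk x) := by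
  obtain ⟨i, y, rfl⟩ := exists_chartι_eq x
  let p : PrimeSpectrum (Away (polyGrading k 1) (MvPolynomial.X i)) := y
  have h1 : IsRegularLocalRing ((Spec (CommRingCat.of (Away (polyGrading k 1)
      (MvPolynomial.X i)))).presheaf.stalk y) :=
    IsRegularLocalRing.of_ringEquiv (IsLocalization.algEquiv p.asIdeal.primeCompl
      (Localization.AtPrime p.asIdeal) ((Spec.structureSheaf (Away (polyGrading k 1)
      (MvPolynomial.X i))).presheaf.stalk p)).toRingEquiv
  exact IsRegularLocalRing.of_ringEquiv
    (asIso ((chartι (k := k) i).stalkMap y)).commRingCatIsoToRingEquiv.symm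

end
end LogCurves

/-! ### Residue fields and affine coordinates of points. -/

namespace LogCurves

universe u

attribute [local instance] MvPolynomial.gradedAlgebra

open HomogeneousLocalization

/-- The residue field of a point in an affine chart. -/
theorem exists_residueField_ringEquiv {k : Type u} [Field k] {X : Scheme.{u}}
    (f : X ⟶ Spec (CommRingCat.of k)) {A : CommRingCat.{u}} (cst : k →+* A)
    (j : Spec A ⟶ X) [IsOpenImmersion j]
    (h : j ≫ f = Spec.map (CommRingCat.ofHom cst)) (p : PrimeSpectrum A) :
    ∃ ε : p.asIdeal.ResidueField ≃+* X.residueField (j p), ∀ a,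
      ε (algebraMap A _ (cst a)) = residueMap f (j p) a := by
  let q : Spec A := p
  let E : CommRingCat.of p.asIdeal.ResidueField ≅ X.residueField (j q) :=
    (Scheme.Spec.residueFieldIso A q).symm ≪≫ (asIso (j.residueFieldMap q)).symm
  refine ⟨E.commRingCatIsoToRingEquiv, fun a => ?_⟩
  have : CommRingCat.ofHom ((algebraMap A p.asIdeal.ResidueField).comp cst) ≫ E.hom =
      CommRingCat.ofHom (residueMap f (j q)) := by
    apply Spec.map_injective
    change _ = Spec.map (Spec.preimage (X.fromSpecResidueField (j q) ≫ f))
    have h1 : Spec.map E.hom ≫ Spec.map (CommRingCat.ofHom (algebraMap A p.asIdeal.ResidueField)) =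
        Spec.map (inv (j.residueFieldMap q)) ≫ (Spec A).fromSpecResidueField q := by
      rw [← Scheme.Spec.map_residueFieldIso_inv_eq_fromSpecResidueField]
      change Spec.map (_ ≫ _) ≫ _ = _
      rw [Spec.map_comp, Category.assoc]
      rfl
    rw [Spec.map_preimage, CommRingCat.ofHom_comp, Spec.map_comp, Spec.map_comp]
    change Spec.map E.hom ≫ Spec.map (CommRingCat.ofHom (algebraMap A p.asIdeal.ResidueField)) ≫
      Spec.map (CommRingCat.ofHom cst) = _
    have h2 : Spec.map (inv (j.residueFieldMap q)) ≫ (Spec A).fromSpecResidueField q ≫ j =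
        X.fromSpecResidueField (j q) := by
      rw [← Scheme.Hom.SpecMap_residueFieldMap_fromSpecResidueField, ← Spec.map_comp_assoc,
        IsIso.hom_inv_id, Spec.map_id, Category.id_comp]
    rw [reassoc_of% h1, ← h2, Category.assoc, Category.assoc]
    exact congr_arg (fun g => _ ≫ _ ≫ g) h.symm
  exact congr_arg (fun g => g.hom a) this

section

variable {k : Type u} [Field k]

/-- Homogeneous coordinates for a point in the `i`-th standard chart of the projective line. -/
def affinePt {L : Type*} [One L] (i : Fin 2) (τ : L) : Fin 2 → L := fun j => if j = i then 1 else τ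

theorem mem_pointIdeal_chartι_iff (i : Fin 2) (p) {e : ℕ} {G : MvPolynomial (Fin 2) k}
    (hG : G ∈ polyGrading k 1 (e • 1)) : G ∈ pointIdeal (chartι (k := k) i p) ↔
      Away.mk _ (X_mem i) e G hG ∈ PrimeSpectrum.asIdeal p := by
  have hi : (MvPolynomial.X i : MvPolynomial (Fin 2) k) ∉ pointIdeal (chartι (k := k) i p) :=
    (mem_range_complementι (X_mem i) one_pos).mp ⟨p, rfl⟩
  have hprime : (pointIdeal (chartι (k := k) i p)).IsPrime :=
    (show ProjectiveSpectrum (polyGrading k 1) from chartι (k := k) i p).isPrime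
  -- The description of basic opens in a chart needs positive degree; multiplying by `X i`, which
  -- does not vanish on the chart, covers `e = 0`.
  have hG1 : G * MvPolynomial.X i ∈ polyGrading k 1 (e + 1) := by
    have := SetLike.mul_mem_graded hG (X_mem (k := k) i)
    simpa using this
  have h := congr_arg (fun U : TopologicalSpace.Opens _ => p ∈ U)
    (Proj.awayι_preimage_basicOpen (polyGrading k 1) (X_mem i) one_pos hG1 e.succ_pos)
  have h1 : Away.isLocalizationElem (X_mem i) hG1 = Away.mk _ (X_mem i) e G hG := by
    rw [Away.isLocalizationElem, away_mk_eq_iff, pow_one, pow_succ, mul_right_comm, away_mk_val,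
      map_mul]
  have h2 : G * MvPolynomial.X i ∉ pointIdeal (chartι (k := k) i p) ↔
      Away.isLocalizationElem (X_mem i) hG1 ∉ PrimeSpectrum.asIdeal p := iff_of_eq h
  rw [h1, not_iff_not] at h2
  rw [← h2]
  exact ⟨fun h => Ideal.mul_mem_right _ _ h, fun h => (hprime.mem_or_mem h).resolve_right hi⟩

/-- A point of the projective line is described by the value of the affine coordinate in
its residue field. -/
theorem exists_affine_coordinate {x : projSpace 1 k} (hx : x ≠ projGeneric k 1) {i : Fin 2}
    (hi : MvPolynomial.X i ∉ pointIdeal x) :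
    ∃ τ : (projSpace 1 k).residueField x,
      Function.Surjective (Polynomial.eval₂RingHom (residueMap (projSpaceStr 1 k) x) τ) ∧
      ∀ (e : ℕ) (G : MvPolynomial (Fin 2) k), G.IsHomogeneous e →
        (G ∈ pointIdeal x ↔
          MvPolynomial.eval₂ (residueMap (projSpaceStr 1 k) x) (affinePt i τ) G = 0) := by
  obtain ⟨p, rfl⟩ := (mem_range_complementι (X_mem i) one_pos).mpr hi
  let p' : PrimeSpectrum (Away (polyGrading k 1) (MvPolynomial.X i)) := p
  obtain ⟨ε, hε⟩ := exists_residueField_ringEquiv (projSpaceStr 1 k) (awayConst (MvPolynomial.X i))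
    (chartι (k := k) i) (complementι_comp_projSpaceStr _ _) p
  let θ : Away (polyGrading k 1) (MvPolynomial.X i) →+* (projSpace 1 k).residueField
      (chartι (k := k) i p) := ε.toRingHom.comp (algebraMap _ p'.asIdeal.ResidueField)
  have hθ : θ.comp (awayConst _) = residueMap (projSpaceStr 1 k) (chartι (k := k) i p) :=
    RingHom.ext hε
  have hp : p'.asIdeal ≠ ⊥ := by
    intro h0
    apply hx
    rw [← chartι_bot i]
    exact congr_arg _ (PrimeSpectrum.ext h0)
  have : p'.asIdeal.IsMaximal := (PrimeSpectrum.isPrime p').isMaximal hp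
  have hθs : Function.Surjective θ := ε.surjective.comp fun z => by
    obtain ⟨w, rfl⟩ := (Ideal.bijective_algebraMap_quotient_residueField p'.asIdeal).2 z
    obtain ⟨a, rfl⟩ := Ideal.Quotient.mk_surjective w
    exact ⟨a, rfl⟩
  refine ⟨θ (affineCoord k i (1 - i)), ?_, fun e G hG => ?_⟩
  · have : Polynomial.eval₂RingHom (residueMap (projSpaceStr 1 k) (chartι (k := k) i p))
        (θ (affineCoord k i (1 - i))) =
        θ.comp (Polynomial.eval₂RingHom (awayConst _) (affineCoord k i (1 - i))) := by
      ext a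
      · simp [← hθ]
      · simp
    rw [this]
    exact hθs.comp (eval₂_affineCoord_surjective i)
  · have hG' : G ∈ polyGrading k 1 (e • 1) := by simpa using hG
    have h1 : affinePt i (θ (affineCoord k i (1 - i))) = θ ∘ affineCoord k i := by
      funext j
      by_cases hj : j = i
      · subst hj
        simp [affinePt, affineCoord_self]
      · have : j = 1 - i := by omega
        subst this
        simp [affinePt, hj]
    have h2 : MvPolynomial.eval₂ (residueMap (projSpaceStr 1 k) (chartι (k := k) i p))
        (affinePt i (θ (affineCoord k i (1 - i)))) G = θ (Away.mk _ (X_mem i) e G hG') := by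
      rw [← eval₂_affineCoord, MvPolynomial.hom_eval₂, hθ, h1]
      rfl
    rw [mem_pointIdeal_chartι_iff i p hG']
    refine Iff.trans ?_ (iff_of_eq (congr_arg (· = 0) h2.symm))
    change _ ↔ ε (algebraMap _ _ _) = 0
    rw [map_eq_zero_iff _ ε.injective, Ideal.algebraMap_residueField_eq_zero]

end
end LogCurves

/-! ### Closed subsets of degree two as zero loci of quadratic forms. -/

namespace LogCurves

universe u

attribute [local instance] MvPolynomial.gradedAlgebra

open HomogeneousLocalization

section

variable {k : Type u} [Field k]

theorem pointIdeal_isPrime {n : ℕ} (x : projSpace n k) : (pointIdeal x).IsPrime :=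
  (show ProjectiveSpectrum (polyGrading k n) from x).isPrime

theorem mem_pointIdeal_of_forall_isHomogeneous {n : ℕ} {x : projSpace n k} {I : Ideal _}
    (h : ∀ e (G : MvPolynomial (Fin (n + 1)) k), G.IsHomogeneous e → G ∈ pointIdeal x → G ∈ I) :
    pointIdeal x ≤ I := by
  intro G hG
  rw [← MvPolynomial.sum_homogeneousComponent G]
  refine Ideal.sum_mem _ fun e _ => h e _ (MvPolynomial.homogeneousComponent_isHomogeneous e G) ?_
  have := (show ProjectiveSpectrum (polyGrading k n) from x).asHomogeneousIdeal.isHomogeneous e hG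
  have h2 : (DirectSum.decompose (polyGrading k n) G e : MvPolynomial (Fin (n + 1)) k) =
      MvPolynomial.homogeneousComponent e G := by
    exact MvPolynomial.decomposition.decompose'_apply G e
  rwa [h2] at this

/-- The residue field is generated by one coordinate as a `k`-algebra, so it is finite over `k` by
Zariski's lemma. -/
theorem finite_residueField {x : projSpace 1 k} (hx : x ≠ projGeneric k 1) :
    (residueMap (projSpaceStr 1 k) x).Finite := by
  obtain ⟨i, hi⟩ := exists_X_notMem_pointIdeal x
  obtain ⟨τ, hτ, -⟩ := exists_affine_coordinate hx hi
  let := (residueMap (projSpaceStr 1 k) x).toAlgebra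
  have : Algebra.FiniteType k ((projSpace 1 k).residueField x) :=
    Algebra.FiniteType.of_surjective (Polynomial.aeval τ) hτ
  exact finite_of_finite_type_of_isJacobsonRing k ((projSpace 1 k).residueField x)

theorem pointDegree_pos {x : projSpace 1 k} (hx : x ≠ projGeneric k 1) :
    0 < pointDegree (projSpaceStr 1 k) x := by
  let := (residueMap (projSpaceStr 1 k) x).toAlgebra
  have : Module.Finite k ((projSpace 1 k).residueField x) := finite_residueField hx
  exact Module.finrank_pos (R := k) (M := (projSpace 1 k).residueField x)

/-- A closed point of the projective line is cut out by the homogenization of the minimal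
polynomial of its coordinate. -/
theorem form_mem_pointIdeal_iff {x : projSpace 1 k} (hx : x ≠ projGeneric k 1) {i : Fin 2}
    {τ : (projSpace 1 k).residueField x}
    (hτ : ∀ (e : ℕ) (G : MvPolynomial (Fin 2) k), G.IsHomogeneous e →
        (G ∈ pointIdeal x ↔
          MvPolynomial.eval₂ (residueMap (projSpaceStr 1 k) x) (affinePt i τ) G = 0))
    {e : ℕ} {F : MvPolynomial (Fin 2) k} (hF : F.IsHomogeneous e) (hF0 : F ≠ 0)
    (hFi : ∀ y : projSpace 1 k, F ∈ pointIdeal y → MvPolynomial.X i ∉ pointIdeal y)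
    {μ : Polynomial k}
    (hFμ : ∀ (L : Type u) [Field L] (ρ : k →+* L) (t : L),
      MvPolynomial.eval₂ ρ (affinePt i t) F = μ.eval₂ ρ t)
    (hμ : ∀ g : Polynomial k, g.eval₂ (residueMap (projSpaceStr 1 k) x) τ = 0 ↔ μ ∣ g)
    (y : projSpace 1 k) : F ∈ pointIdeal y ↔ y = x := by
  constructor
  · intro hy
    have hy0 : y ≠ projGeneric k 1 := by
      rintro rfl
      exact hF0 hy
    obtain ⟨t, -, ht⟩ := exists_affine_coordinate hy0 (hFi y hy)
    -- A form vanishing at `x` dehomogenizes to a multiple of `μ`, and `μ` vanishes at the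
    -- coordinate of `y` because `F` does. So the ideal of `x` lies in that of `y`, and `x` is
    -- closed.
    refine (eq_of_specializes (specializes_iff_pointIdeal_le.mpr
      (mem_pointIdeal_of_forall_isHomogeneous fun d G hG hGx => ?_)) hx).symm
    rw [hτ d G hG] at hGx
    rw [ht d G hG]
    have hde : ∀ (L : Type u) [Field L] (ρ : k →+* L) (t : L), MvPolynomial.eval₂ ρ (affinePt i t) G =
        (MvPolynomial.eval₂ Polynomial.C (affinePt i Polynomial.X) G).eval₂ ρ t := by
      intro L _ ρ t
      rw [← Polynomial.coe_eval₂RingHom, MvPolynomial.hom_eval₂]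
      congr 1
      · ext a; simp
      · funext j
        by_cases hj : j = i <;> simp [affinePt, hj]
    rw [hde, hμ] at hGx
    rw [hde]
    refine Polynomial.eval₂_eq_zero_of_dvd_of_eval₂_eq_zero _ _ hGx ?_
    rw [← hFμ, ← ht e F hF]
    exact hy
  · rintro rfl
    rw [hτ e F hF, hFμ, hμ]

/-- The linear form with the given coefficients. -/
noncomputable def linForm (a : Fin 2 → k) : MvPolynomial (Fin 2) k :=
  MvPolynomial.C (a 0) * MvPolynomial.X 0 + MvPolynomial.C (a 1) * MvPolynomial.X 1

theorem quadForm_eq_mul (a b : Fin 2 → k) :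
    quadForm k ![a 0 * b 0, a 0 * b 1 + a 1 * b 0, a 1 * b 1] = linForm a * linForm b := by
  simp [quadForm, linForm]
  ring

/-- A rational point of the projective line is cut out by a linear form. -/
theorem exists_linForm_of_pointDegree_eq_one {x : projSpace 1 k} (hx : x ≠ projGeneric k 1)
    (hdeg : pointDegree (projSpaceStr 1 k) x = 1) :
    ∃ a : Fin 2 → k, ∀ y, linForm a ∈ pointIdeal y ↔ y = x := by
  obtain ⟨i, hi⟩ := exists_X_notMem_pointIdeal x
  obtain ⟨τ, hτs, hτ⟩ := exists_affine_coordinate hx hi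
  obtain ⟨t, rfl⟩ : ∃ t, residueMap (projSpaceStr 1 k) x t = τ := by
    let := (residueMap (projSpaceStr 1 k) x).toAlgebra
    have : Function.Surjective (algebraMap k ((projSpace 1 k).residueField x)) :=
      (Algebra.finrank_eq_one_iff_bijective_algebraMap.mp hdeg).2
    exact this τ
  -- The form is `X j - t * X i`, where `j` is the index other than `i`.
  refine ⟨fun j => if j = i then -t else 1, fun y => ?_⟩
  refine form_mem_pointIdeal_iff hx hτ (e := 1) (μ := Polynomial.X - Polynomial.C t) ?_ ?_ ?_ ?_ ?_ y
  · exact ((MvPolynomial.isHomogeneous_X k 0).C_mul _).add ((MvPolynomial.isHomogeneous_X k 1).C_mul _)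
  · intro h0
    have := congr_arg (MvPolynomial.eval fun j => if j = i then 0 else 1) h0
    fin_cases i <;> simp [linForm] at this
  · intro y hy hiy
    obtain ⟨j, hj⟩ := exists_X_notMem_pointIdeal y
    apply hj
    by_cases hji : j = i
    · rwa [hji]
    · fin_cases i <;> fin_cases j <;> simp_all [linForm]
      · exact hj ((Ideal.add_mem_iff_right _ (neg_mem (Ideal.mul_mem_left _ _ hiy))).mp hy)
      · exact hj ((Ideal.add_mem_iff_left _ (neg_mem (Ideal.mul_mem_left _ _ hiy))).mp hy)
  · intro L _ ρ s
    fin_cases i <;> simp [linForm, affinePt] <;> ring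
  · intro g
    rw [Polynomial.eval₂_at_apply, map_eq_zero, Polynomial.dvd_iff_isRoot]
    rfl

/-- A point of degree two of the projective line is the zero locus of a norm form. -/
theorem exists_torusForm_of_finrank_eq_two {K : Type*} [Field K] [Algebra k K]
    [Algebra.IsSeparable k K] (hK : Module.finrank k K = 2)
    {x : projSpace 1 k} (hx : x ≠ projGeneric k 1) (e : K ≃+* (projSpace 1 k).residueField x)
    (he : ∀ a : k, e (algebraMap k K a) = residueMap (projSpaceStr 1 k) x a) :
    ∃ T : TorusForm k K, ∀ y, T.form ∈ pointIdeal y ↔ y = x := by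
  have : Algebra.IsQuadraticExtension k K := ⟨hK⟩
  have : FiniteDimensional k K := Module.finite_of_finrank_eq_succ hK
  obtain ⟨i, hi⟩ := exists_X_notMem_pointIdeal x
  obtain ⟨s, hs, hτ⟩ := exists_affine_coordinate hx hi
  obtain ⟨τ, rfl⟩ := e.surjective s
  have hev (g : Polynomial k) : g.eval₂ (residueMap (projSpaceStr 1 k) x) (e τ) =
      e (Polynomial.aeval τ g) := by
    rw [Polynomial.aeval_def, ← RingEquiv.coe_toRingHom, Polynomial.hom_eval₂]
    congr 1
    exact RingHom.ext fun a => (he a).symm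
  have hgen (z : K) : ∃ g : Polynomial k, Polynomial.aeval τ g = z := by
    obtain ⟨g, hg⟩ := hs (e z)
    exact ⟨g, e.injective (by rw [← hev]; exact hg)⟩
  have htop : IntermediateField.adjoin k {τ} = ⊤ := by
    rw [eq_top_iff]
    rintro z -
    obtain ⟨g, rfl⟩ := hgen z
    exact IntermediateField.algebra_adjoin_le_adjoin k _ (Polynomial.aeval_mem_adjoin_singleton k τ)
  have hint : _root_.IsIntegral k τ := Algebra.IsIntegral.isIntegral τ
  have hdeg : (minpoly k τ).natDegree = 2 := by
    rw [← hK]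
    exact (Field.primitive_element_iff_minpoly_natDegree_eq k τ).mp htop
  have hmonic : (minpoly k τ).Monic := minpoly.monic hint
  set p := (minpoly k τ).coeff 1
  set q := (minpoly k τ).coeff 0
  have hμ : minpoly k τ = Polynomial.X ^ 2 + Polynomial.C p * Polynomial.X + Polynomial.C q := by
    rw [(minpoly k τ).as_sum_range_C_mul_X_pow, hdeg, Finset.sum_range_succ, Finset.sum_range_succ,
      Finset.sum_range_one]
    have : (minpoly k τ).coeff 2 = 1 := hdeg ▸ hmonic.coeff_natDegree
    rw [this]
    simp only [pow_zero, pow_one, map_one, mul_one, one_mul]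
    ring
  have hroot : τ ^ 2 + algebraMap k K p * τ + algebraMap k K q = 0 := by
    have := minpoly.aeval k τ
    rw [hμ] at this
    simpa using this
  obtain ⟨σ, hσ⟩ : ∃ σ : K ≃ₐ[k] K, σ τ ≠ τ := by
    have hcard : Nat.card (K ≃ₐ[k] K) = 2 := by
      rw [← hK]; exact IsGalois.card_aut_eq_finrank k K
    have : Nontrivial (K ≃ₐ[k] K) := by
      rw [← Finite.one_lt_card_iff_nontrivial, hcard]; exact one_lt_two
    obtain ⟨σ, hσ⟩ := exists_ne (1 : K ≃ₐ[k] K)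
    refine ⟨σ, fun h => hσ (AlgEquiv.ext fun z => ?_)⟩
    obtain ⟨g, rfl⟩ := hgen z
    exact (Polynomial.aeval_algHom_apply σ τ g).symm.trans (by rw [h]; rfl)
  have hroot' : σ τ ^ 2 + algebraMap k K p * σ τ + algebraMap k K q = 0 := by
    have := congr_arg σ hroot
    simpa using this
  -- Vieta's formulas for the two distinct roots `τ` and `σ τ` of the minimal polynomial; they give
  -- the factorization of its homogenization.
  have hsum : τ + σ τ = -algebraMap k K p := by
    have : (τ - σ τ) * (τ + σ τ + algebraMap k K p) = 0 := by linear_combination hroot - hroot'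
    have := (mul_eq_zero.mp this).resolve_left (sub_ne_zero.mpr hσ.symm)
    linear_combination this
  have hprod : τ * σ τ = algebraMap k K q := by
    linear_combination τ * hsum - hroot
  have hform : ∀ c : Fin 3 → k, (i = 0 → c = ![q, p, 1]) → (i = 1 → c = ![1, p, q]) →
      ∀ y, quadForm k c ∈ pointIdeal y ↔ y = x := by
    intro c hc₀ hc₁ y
    refine form_mem_pointIdeal_iff hx hτ (e := 2) (μ := minpoly k τ) (quadForm_mem c)
      ?_ ?_ ?_ ?_ y
    · intro h0
      have := congr_arg (MvPolynomial.eval fun j => if j = i then 0 else 1) h0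
      rw [eval_quadForm] at this
      fin_cases i
      · simp [hc₀ rfl] at this
      · simp [hc₁ rfl] at this
    · intro y hy hiy
      obtain ⟨j, hj⟩ := exists_X_notMem_pointIdeal y
      have hprime := pointIdeal_isPrime y
      apply hj
      by_cases hji : j = i
      · rwa [hji]
      obtain ⟨r, hr⟩ : ∃ r, quadForm k c =
          MvPolynomial.X i * r + MvPolynomial.X j * MvPolynomial.X j := by
        fin_cases i
        · obtain rfl : j = 1 := (by decide : ∀ j : Fin 2, ¬ j = 0 → j = 1) j hji
          refine ⟨MvPolynomial.C q * MvPolynomial.X 0 + MvPolynomial.C p * MvPolynomial.X 1, ?_⟩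
          simp [quadForm, hc₀ rfl]
          ring
        · obtain rfl : j = 0 := (by decide : ∀ j : Fin 2, ¬ j = 1 → j = 0) j hji
          refine ⟨MvPolynomial.C q * MvPolynomial.X 1 + MvPolynomial.C p * MvPolynomial.X 0, ?_⟩
          simp [quadForm, hc₁ rfl]
          ring
      rw [hr, Ideal.add_mem_iff_right _ (Ideal.mul_mem_right _ _ hiy)] at hy
      exact (hprime.mem_or_mem hy).elim id id
    · intro L _ ρ t
      rw [hμ]
      fin_cases i
      · simp [quadForm, affinePt, hc₀ rfl]
        ring
      · simp [quadForm, affinePt, hc₁ rfl]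
        ring
    · intro g
      rw [hev, map_eq_zero_iff e e.injective, minpoly.dvd_iff]
  fin_cases i
  -- In chart `0` the coordinate is `X 1 / X 0`, so the factors are `X 1 - τ * X 0` and its
  -- conjugate; chart `1` reverses the roles of the variables.
  · exact ⟨{  c := ![q, p, 1]
              a := ![-τ, 1]
              b := ![-σ τ, 1]
              c_zero := by simp [hprod]
              c_one := by simp; linear_combination hsum
              c_two := by simp
              det_ne_zero := by
                simp only [Matrix.cons_val_zero, Matrix.cons_val_one]
                intro h; exact hσ (by linear_combination h)
              split_or := Or.inr ⟨hK, σ, by simp, by simp⟩ }, hform _ (fun _ => rfl) (by simp)⟩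
  · exact ⟨{  c := ![1, p, q]
              a := ![1, -τ]
              b := ![1, -σ τ]
              c_zero := by simp
              c_one := by simp; linear_combination hsum
              c_two := by simp [hprod]
              det_ne_zero := by
                simp only [Matrix.cons_val_zero, Matrix.cons_val_one]
                intro h; exact hσ (by linear_combination -h)
              split_or := Or.inr ⟨hK, σ, by simp, by simp⟩ }, hform _ (by simp) (fun _ => rfl)⟩

/-- A pair of rational points of the projective line is the zero locus of a split form. -/
theorem exists_torusForm_of_pair {K : Type*} [Field K] [Algebra k K]
    (hK : Function.Surjective (algebraMap k K)) {x x' : projSpace 1 k} (hxx' : x ≠ x')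
    (hx : x ≠ projGeneric k 1) (hx' : x' ≠ projGeneric k 1)
    (hdeg : pointDegree (projSpaceStr 1 k) x = 1)
    (hdeg' : pointDegree (projSpaceStr 1 k) x' = 1) :
    ∃ T : TorusForm k K, ∀ y, T.form ∈ pointIdeal y ↔ y = x ∨ y = x' := by
  obtain ⟨a, ha⟩ := exists_linForm_of_pointDegree_eq_one hx hdeg
  obtain ⟨b, hb⟩ := exists_linForm_of_pointDegree_eq_one hx' hdeg'
  -- Proportional linear forms would have the same zero, contradicting `x ≠ x'`.
  have hdet : a 0 * b 1 - a 1 * b 0 ≠ 0 := by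
    intro h0
    apply hxx'
    have h1 (j : Fin 2) : MvPolynomial.C (b j) * linForm a = MvPolynomial.C (a j) * linForm b := by
      have h0' : (MvPolynomial.C (a 0) * MvPolynomial.C (b 1) : MvPolynomial (Fin 2) k) =
          MvPolynomial.C (a 1) * MvPolynomial.C (b 0) := by
        rw [← map_mul, ← map_mul, sub_eq_zero.mp h0]
      fin_cases j <;> simp [linForm]
      · linear_combination -MvPolynomial.X 1 * h0'
      · linear_combination MvPolynomial.X 0 * h0'
    have hxa := (ha x).mpr rfl
    have hne : ∃ j, a j ≠ 0 := by
      by_contra! hcon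
      have hz : linForm a = 0 := by simp [linForm, hcon]
      exact hx ((ha (projGeneric k 1)).mp (hz ▸ Ideal.zero_mem _)).symm
    obtain ⟨j, hj⟩ := hne
    refine (hb x).mp ?_
    have h2 : linForm b = MvPolynomial.C ((a j)⁻¹ * b j) * linForm a := by
      rw [map_mul, mul_assoc, h1, ← mul_assoc, ← map_mul, inv_mul_cancel₀ hj, map_one, one_mul]
    rw [h2]
    exact Ideal.mul_mem_left _ _ hxa
  refine ⟨{ c := ![a 0 * b 0, a 0 * b 1 + a 1 * b 0, a 1 * b 1]
            a := fun j => algebraMap k K (a j)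
            b := fun j => algebraMap k K (b j)
            c_zero := by simp
            c_one := by simp
            c_two := by simp
            det_ne_zero := by
              rw [← map_mul, ← map_mul, ← map_sub]
              exact (map_ne_zero _).mpr hdet
            split_or := Or.inl hK }, fun y => ?_⟩
  rw [TorusForm.form, quadForm_eq_mul, ← ha, ← hb]
  have := pointIdeal_isPrime y
  exact this.mul_mem_iff_mem_or_mem

/-- The complement of a closed subset of degree two of the projective line is a torus. -/
theorem exists_torusForm {K : Type*} [Field K] [Algebra k K] [Algebra.IsSeparable k K]
    {Z : Set (projSpace 1 k)} (hgen : projGeneric k 1 ∉ Z) (hfin : Z.Finite)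
    (hdeg : ∑ᶠ x ∈ Z, pointDegree (projSpaceStr 1 k) x = 2) {x : projSpace 1 k} (hxZ : x ∈ Z)
    (e : K ≃+* (projSpace 1 k).residueField x)
    (he : ∀ a : k, e (algebraMap k K a) = residueMap (projSpaceStr 1 k) x a) :
    ∃ T : TorusForm k K, ∀ y, T.form ∈ pointIdeal y ↔ y ∈ Z := by
  classical
  have hne {y} (hy : y ∈ Z) : y ≠ projGeneric k 1 := fun h => hgen (h ▸ hy)
  have hx := hne hxZ
  have hrank : Module.finrank k K = pointDegree (projSpaceStr 1 k) x := by
    let := (residueMap (projSpaceStr 1 k) x).toAlgebra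
    exact (AlgEquiv.ofRingEquiv (f := e) he).toLinearEquiv.finrank_eq
  rw [finsum_mem_eq_finite_toFinset_sum _ hfin,
    ← Finset.add_sum_erase _ _ (hfin.mem_toFinset.mpr hxZ)] at hdeg
  have hpos := pointDegree_pos hx
  have hmem {y} : y ∈ hfin.toFinset.erase x ↔ y ≠ x ∧ y ∈ Z := by simp
  -- Degrees are positive and add up to `2`, so either `x` is the only point, or it is rational with
  -- exactly one other point, also rational.
  rcases (show pointDegree (projSpaceStr 1 k) x = 2 ∨ pointDegree (projSpaceStr 1 k) x = 1 by omega)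
    with h2 | h1
  · obtain ⟨T, hT⟩ := exists_torusForm_of_finrank_eq_two (hrank.trans h2) hx e he
    refine ⟨T, fun y => (hT y).trans ⟨fun h => h ▸ hxZ, fun hy => ?_⟩⟩
    by_contra hyx
    have h0 : ∑ y ∈ hfin.toFinset.erase x, pointDegree (projSpaceStr 1 k) y = 0 := by omega
    have := Finset.sum_eq_zero_iff.mp h0 y (hmem.mpr ⟨hyx, hy⟩)
    exact (pointDegree_pos (hne hy)).ne' this
  · have hsum : ∑ y ∈ hfin.toFinset.erase x, pointDegree (projSpaceStr 1 k) y = 1 := by omega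
    obtain ⟨x', hx', -⟩ := Finset.exists_ne_zero_of_sum_ne_zero (hsum.trans_ne one_ne_zero)
    obtain ⟨hx'x, hx'Z⟩ := hmem.mp hx'
    rw [← Finset.add_sum_erase _ _ hx'] at hsum
    have hpos' := pointDegree_pos (hne hx'Z)
    have hK : Function.Surjective (algebraMap k K) :=
      (Algebra.finrank_eq_one_iff_bijective_algebraMap.mp (hrank.trans h1)).2
    obtain ⟨T, hT⟩ := exists_torusForm_of_pair hK hx'x.symm hx (hne hx'Z) h1 (by omega)
    refine ⟨T, fun y => (hT y).trans ⟨?_, fun hy => ?_⟩⟩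
    · rintro (rfl | rfl) <;> assumption
    by_contra! hyx
    have h0 : ∑ y ∈ (hfin.toFinset.erase x).erase x', pointDegree (projSpaceStr 1 k) y = 0 := by
      omega
    have := Finset.sum_eq_zero_iff.mp h0 y (Finset.mem_erase.mpr ⟨hyx.2, hmem.mpr ⟨hyx.1, hy⟩⟩)
    exact (pointDegree_pos (hne hy)).ne' this

end
end LogCurves

/-! ### Bounded denominators on a scheme integral over the generic fibre. -/

namespace LogCurves

universe u

section

variable {R k : Type u} [CommRing R] [IsDedekindDomain R] [Field k] [Algebra R k]
  [IsFractionRing R k]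

/-- The localization of `R` at `p` is integrally closed in `k`, and a monic equation with
coefficients in `ω (A)` lifts to a monic equation over it. -/
theorem mem_localSubring_of_isIntegralElem (p : PrimeSpectrum R) {A : Type*} [CommRing A]
    (ω : A →+* k) (hω : ∀ a, ω a ∈ localSubring k p) {x : k} (hx : ω.IsIntegralElem x) :
    x ∈ localSubring k p := by
  let L := Localization.AtPrime p.asIdeal
  let γ : L →+* k :=
    IsLocalization.lift (M := p.asIdeal.primeCompl) (g := algebraMap R k) fun c =>
      isUnit_iff_ne_zero.mpr (algebraMap_ne_zero_of_notMem c.2)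
  have hγ : γ.comp (algebraMap R _) = algebraMap R k := IsLocalization.lift_comp _
  let := γ.toAlgebra
  have : IsScalarTower R L k := .of_algebraMap_eq' hγ.symm
  have : IsFractionRing L k :=
    IsFractionRing.isFractionRing_of_isDomain_of_isLocalization p.asIdeal.primeCompl L k
  have : IsDedekindDomain L :=
    IsLocalization.isDedekindDomain R p.asIdeal.primeCompl_le_nonZeroDivisors L
  have hmem (y : k) : y ∈ localSubring k p ↔ ∃ z : L, algebraMap L k z = y := by
    constructor
    · rintro ⟨b, c, hc, h⟩
      refine ⟨IsLocalization.mk' L b (⟨c, hc⟩ : p.asIdeal.primeCompl), ?_⟩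
      refine mul_left_cancel₀ (algebraMap_ne_zero_of_notMem (k := k) hc) ?_
      rw [h, IsScalarTower.algebraMap_apply R L k c, ← map_mul, IsScalarTower.algebraMap_apply R L k]
      congr 1
      exact IsLocalization.mk'_spec' (M := p.asIdeal.primeCompl) L b ⟨c, hc⟩
    · rintro ⟨z, rfl⟩
      obtain ⟨b, c, rfl⟩ := IsLocalization.exists_mk'_eq p.asIdeal.primeCompl z
      refine ⟨b, c, c.2, ?_⟩
      rw [IsScalarTower.algebraMap_apply R L k, ← map_mul, IsLocalization.mk'_spec',
        ← IsScalarTower.algebraMap_apply]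
  obtain ⟨P, hP, hPx⟩ := hx
  obtain ⟨Q, hQ, -, hQm⟩ := Polynomial.lifts_and_natDegree_eq_and_monic (f := algebraMap L k)
    (p := P.map ω) (by
      rw [Polynomial.lifts_iff_coeff_lifts]
      intro n
      rw [Polynomial.coeff_map]
      exact (hmem _).mp (hω _)) (hP.map ω)
  rw [hmem, ← IsIntegrallyClosed.isIntegral_iff]
  refine ⟨Q, hQm, ?_⟩
  rw [Polynomial.eval₂_eq_eval_map, hQ, ← Polynomial.eval₂_eq_eval_map, hPx]

omit [IsDedekindDomain R] [IsFractionRing R k] in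
-- The ideal of denominators of `x` lies in no maximal ideal.
theorem exists_algebraMap_eq_of_forall_mem_localSubring {x : k}
    (hx : ∀ p : PrimeSpectrum R, x ∈ localSubring k p) : ∃ r, algebraMap R k r = x := by
  let I : Ideal R :=
    { carrier := {c | ∃ b, algebraMap R k b = algebraMap R k c * x}
      add_mem' := by
        rintro c c' ⟨b, hb⟩ ⟨b', hb'⟩
        exact ⟨b + b', by rw [map_add, map_add, hb, hb', add_mul]⟩
      zero_mem' := ⟨0, by simp⟩
      smul_mem' := by
        rintro r c ⟨b, hb⟩
        exact ⟨r * b, by rw [map_mul, smul_eq_mul, map_mul, hb, mul_assoc]⟩ }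
  have hI : I = ⊤ := by
    by_contra h
    obtain ⟨m, hm, hle⟩ := Ideal.exists_le_maximal I h
    obtain ⟨b, c, hc, hbc⟩ := hx ⟨m, hm.isPrime⟩
    exact hc (hle ⟨b, hbc.symm⟩)
  obtain ⟨b, hb⟩ : (1 : R) ∈ I := hI ▸ Submodule.mem_top
  exact ⟨b, by rw [hb, map_one, one_mul]⟩

variable {Y : Scheme.{u}} (f : Y ⟶ Spec (CommRingCat.of R)) {B : Type u} [CommRing B]
  (cst : k →+* B) (q : Spec (CommRingCat.of B) ⟶ pullback f (specGeneric R k)) [IsIntegralHom q]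
  (hq : q ≫ pullback.snd _ _ = Spec.map (CommRingCat.ofHom cst))

include hq in
-- Over the chart, `b` is integral over `A ⊗ k`, the localization of `A` at the nonzero elements of
-- `R`; a nonzero `c` in `R` therefore makes `c * b` integral over `A`. The constant depends only on
-- `b` and the chart, and the equation can be specialized at every rational point.
theorem exists_isIntegralElem_of_chart {A : CommRingCat.{u}} (j : Spec A ⟶ Y) (b : B) :
    ∃ c : R, c ≠ 0 ∧ ∀ (χ : B →+* k), χ.comp cst = RingHom.id k → ∀ ω : A →+* k,
      Spec.map (CommRingCat.ofHom ω) ≫ j = Spec.map (CommRingCat.ofHom χ) ≫ q ≫ pullback.fst _ _ →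
      ω.IsIntegralElem (algebraMap R k c * χ b) := by
  let δ : R →+* A := (Spec.preimage (j ≫ f)).hom
  have hδ : Spec.map (CommRingCat.ofHom δ) = j ≫ f := Spec.map_preimage _
  let := δ.toAlgebra
  let E := TensorProduct R A k
  let eA : A →+* E := algebraMap A E
  let ek : k →+* E := (Algebra.TensorProduct.includeRight : k →ₐ[R] E).toRingHom
  have hE : eA.comp δ = ek.comp (algebraMap R k) :=
    RingHom.ext fun r => (Algebra.TensorProduct.includeLeft.commutes r).trans
      ((Algebra.TensorProduct.includeRight : k →ₐ[R] E).commutes r).symm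
  let e : Spec (CommRingCat.of E) ⟶ pullback f (specGeneric R k) :=
    pullback.lift (Spec.map (CommRingCat.ofHom eA) ≫ j) (Spec.map (CommRingCat.ofHom ek)) (by
      rw [Category.assoc, ← hδ, ← Spec.map_comp, ← Spec.map_comp, ← CommRingCat.ofHom_comp,
        ← CommRingCat.ofHom_comp, hE])
  let W := pullback q e
  have : IsAffine W := isAffine_of_isAffineHom (pullback.snd q e)
  let ε : E →+* Γ(W, ⊤) := (Spec.preimage (W.isoSpec.inv ≫ pullback.snd q e)).hom
  have hε : Spec.map (CommRingCat.ofHom ε) = W.isoSpec.inv ≫ pullback.snd q e := Spec.map_preimage _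
  let β : B →+* Γ(W, ⊤) := (Spec.preimage (W.isoSpec.inv ≫ pullback.fst q e)).hom
  have hβ : Spec.map (CommRingCat.ofHom β) = W.isoSpec.inv ≫ pullback.fst q e := Spec.map_preimage _
  have hint : ε.IsIntegral := by
    have : IsIntegralHom (Spec.map (CommRingCat.ofHom ε)) := by
      rw [hε]; infer_instance
    exact IsIntegralHom.SpecMap_iff.mp this
  let := ε.toAlgebra
  let := (ε.comp eA).toAlgebra
  have : IsScalarTower A E Γ(W, ⊤) := .of_algebraMap_eq' rfl
  have : IsLocalization (Algebra.algebraMapSubmonoid A (nonZeroDivisors R)) E :=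
    IsLocalization.tensor k (nonZeroDivisors R)
  obtain ⟨⟨_, c, hc, rfl⟩, hm⟩ := IsIntegral.exists_multiple_integral_of_isLocalization
    (Algebra.algebraMapSubmonoid A (nonZeroDivisors R)) (Rₘ := E) (β b) (hint (β b))
  refine ⟨c, nonZeroDivisors.ne_zero hc, fun χ hχ ω hω => ?_⟩
  have hωδ : ω.comp δ = algebraMap R k := by
    have : Spec.map (CommRingCat.ofHom (ω.comp δ)) = specGeneric R k := by
      rw [CommRingCat.ofHom_comp, Spec.map_comp, hδ, ← Category.assoc, hω, Category.assoc,
        Category.assoc, pullback.condition, reassoc_of% hq, ← Spec.map_comp_assoc,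
        ← CommRingCat.ofHom_comp, hχ]
      exact (congr_arg (· ≫ _) (Spec.map_id _)).trans (Category.id_comp _)
    exact congr_arg CommRingCat.Hom.hom (Spec.map_injective this)
  let ωA : A →ₐ[R] k := { ω with commutes' := fun r => congr_arg (fun g => g r) hωδ }
  have hcomm (x : A) (y : k) : Commute (ωA x) (AlgHom.id R k y) := mul_comm _ _
  let ω' : E →+* k := (Algebra.TensorProduct.lift ωA (AlgHom.id R k) hcomm).toRingHom
  have hωA : ω'.comp eA = ω := RingHom.ext fun a =>
    (Algebra.TensorProduct.lift_tmul ωA (AlgHom.id R k) hcomm a 1).trans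
      ((congr_arg _ (map_one _)).trans (mul_one _))
  have hωk : ω'.comp ek = RingHom.id k := RingHom.ext fun a =>
    (Algebra.TensorProduct.lift_tmul ωA (AlgHom.id R k) hcomm 1 a).trans
      ((congr_arg (· * _) (map_one _)).trans (one_mul _))
  -- The pair of `χ` and `ω` is a rational point of the fibre product, at which the integral
  -- equation is evaluated.
  let t : Spec (CommRingCat.of k) ⟶ W :=
    pullback.lift (Spec.map (CommRingCat.ofHom χ)) (Spec.map (CommRingCat.ofHom ω')) (by
      apply pullback.hom_ext
      · rw [Category.assoc, ← hω, Category.assoc, pullback.lift_fst, ← Spec.map_comp_assoc,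
          ← CommRingCat.ofHom_comp, hωA]
      · rw [Category.assoc, hq, Category.assoc, pullback.lift_snd, ← Spec.map_comp,
          ← Spec.map_comp, ← CommRingCat.ofHom_comp, ← CommRingCat.ofHom_comp, hωk, hχ])
  let χ' : Γ(W, ⊤) →+* k := (Spec.preimage (t ≫ W.isoSpec.hom)).hom
  have hχ' : Spec.map (CommRingCat.ofHom χ') = t ≫ W.isoSpec.hom := Spec.map_preimage _
  have hχε : χ'.comp ε = ω' := by
    have : Spec.map (CommRingCat.ofHom (χ'.comp ε)) = Spec.map (CommRingCat.ofHom ω') := by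
      rw [CommRingCat.ofHom_comp, Spec.map_comp, hχ', hε, Category.assoc, Iso.hom_inv_id_assoc,
        pullback.lift_snd]
    exact congr_arg CommRingCat.Hom.hom (Spec.map_injective this)
  have hχβ : χ'.comp β = χ := by
    have : Spec.map (CommRingCat.ofHom (χ'.comp β)) = Spec.map (CommRingCat.ofHom χ) := by
      rw [CommRingCat.ofHom_comp, Spec.map_comp, hχ', hβ, Category.assoc, Iso.hom_inv_id_assoc,
        pullback.lift_fst]
    exact congr_arg CommRingCat.Hom.hom (Spec.map_injective this)
  obtain ⟨P, hP, hPx⟩ := hm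
  refine ⟨P, hP, ?_⟩
  have h1 := congr_arg χ' hPx
  rw [map_zero, Polynomial.hom_eval₂] at h1
  have h2 : χ'.comp (algebraMap A Γ(W, ⊤)) = ω := by
    rw [← hωA, ← hχε]
    rfl
  rw [h2] at h1
  rw [← h1]
  congr 1
  rw [Submonoid.smul_def, Algebra.smul_def, map_mul, ← RingHom.comp_apply, h2, ← hωδ, ← hχβ]
  rfl

include hq in
/-- The coordinates of the points of a scheme which is integral over the generic fibre of `Y` and
which lie above integral points of `Y` have bounded denominators. -/
theorem exists_denominator [QuasiCompact f] (b : B) :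
    ∃ c : R, c ≠ 0 ∧ ∀ (χ : B →+* k), χ.comp cst = RingHom.id k →
      ∀ s : Spec (CommRingCat.of R) ⟶ Y, s ≫ f = 𝟙 _ →
      specGeneric R k ≫ s = Spec.map (CommRingCat.ofHom χ) ≫ q ≫ pullback.fst _ _ →
      ∃ r, algebraMap R k r = algebraMap R k c * χ b := by
  have : CompactSpace Y := QuasiCompact.compactSpace_of_compactSpace f
  -- Quasi-compactness leaves finitely many charts, so the product of their constants works for
  -- every section and every prime.
  obtain ⟨t, ht⟩ := isCompact_univ.elim_finite_subcover
    (fun y : Y => (Set.range (Y.affineOpenCover.f (Y.affineOpenCover.idx y))))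
    (fun y => (Y.affineOpenCover.f _).isOpenEmbedding.isOpen_range)
    (fun y _ => Set.mem_iUnion.mpr ⟨y, Y.affineOpenCover.covers y⟩)
  choose c hc0 hc using fun y : Y => exists_isIntegralElem_of_chart f cst q hq
    (Y.affineOpenCover.f (Y.affineOpenCover.idx y)) b
  refine ⟨∏ y ∈ t, c y, Finset.prod_ne_zero_iff.mpr fun y _ => hc0 y, fun χ hχ s hs hsχ =>
    exists_algebraMap_eq_of_forall_mem_localSubring fun p => ?_⟩
  obtain ⟨y, hyt, hy⟩ := Set.mem_iUnion₂.mp (ht (Set.mem_univ (s p)))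
  let j := Y.affineOpenCover.f (Y.affineOpenCover.idx y)
  have hrange : Set.range (specGeneric R k ≫ s) ⊆ Set.range j := by
    rintro _ ⟨z, rfl⟩
    rw [Scheme.Hom.comp_apply, specGeneric_apply]
    exact ((genericPoint_specializes p).map s.continuous).mem_open
      j.isOpenEmbedding.isOpen_range hy
  let ω := (Spec.preimage (IsOpenImmersion.lift j _ hrange)).hom
  have hω : Spec.map (CommRingCat.ofHom ω) ≫ j = specGeneric R k ≫ s := by
    have : Spec.map (CommRingCat.ofHom ω) = IsOpenImmersion.lift j _ hrange := Spec.map_preimage _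
    rw [this, IsOpenImmersion.lift_fac]
  have h1 := mem_localSubring_of_isIntegralElem p ω
    (coordinates_mem_localSubring s j p hy ω hω) (hc y χ hχ ω (hω.trans hsχ))
  obtain ⟨d, hd⟩ := Finset.dvd_prod_of_mem c hyt
  rw [hd, mul_comm (c y), map_mul, mul_assoc]
  exact mul_mem (algebraMap_mem_localSubring p d) h1

end
end LogCurves

/-! ### Regular points and lifting to the normalization. -/

namespace LogCurves

universe u

/-- A flat local homomorphism is faithfully flat, hence injective; for a preimmersion it is
surjective. This compares local rings both along the generic fibre and along the open set where the
normalization is an isomorphism. -/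
theorem bijective_stalkMap {X Y : Scheme.{u}} (f : X ⟶ Y) [Flat f] [IsPreimmersion f] (x : X) :
    Function.Bijective (f.stalkMap x).hom := by
  refine ⟨?_, f.stalkMap_surjective x⟩
  algebraize [(f.stalkMap x).hom]
  have : Module.FaithfullyFlat (Y.presheaf.stalk (f x)) (X.presheaf.stalk x) :=
    @Module.FaithfullyFlat.of_flat_of_isLocalHom _ _ _ _ _ _ _
      (Flat.stalkMap f x) (f.toLRSHom.prop x)
  exact FaithfulSMul.algebraMap_injective (Y.presheaf.stalk (f x)) (X.presheaf.stalk x)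

theorem isRegularLocalRing_stalk_iff {X Y : Scheme.{u}} (f : X ⟶ Y) [Flat f] [IsPreimmersion f]
    (x : X) : IsRegularLocalRing (X.presheaf.stalk x) ↔
      IsRegularLocalRing (Y.presheaf.stalk (f x)) := by
  let e := RingEquiv.ofBijective _ (bijective_stalkMap f x)
  exact ⟨fun _ => .of_ringEquiv e.symm, fun _ => .of_ringEquiv e⟩

instance (R k : Type u) [CommRing R] [IsDomain R] [Field k] [Algebra R k] [IsFractionRing R k] :
    IsPreimmersion (specGeneric R k) :=
  .of_isLocalization (nonZeroDivisors R)

instance (R k : Type u) [CommRing R] [IsDomain R] [Field k] [Algebra R k] [IsFractionRing R k] :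
    Flat (specGeneric R k) := by
  have := IsLocalization.flat k (nonZeroDivisors R)
  rw [HasRingHomProperty.Spec_iff (P := @Flat)]
  exact (RingHom.flat_algebraMap_iff).mpr this

/-- A section of a scheme over a field is determined by its image. -/
theorem section_ext {k : Type u} [Field k] {X : Scheme.{u}} {g : X ⟶ Spec (CommRingCat.of k)}
    {s t : Spec (CommRingCat.of k) ⟶ X} (hs : s ≫ g = 𝟙 _) (ht : t ≫ g = 𝟙 _)
    (h : s (IsLocalRing.closedPoint k) = t (IsLocalRing.closedPoint k)) : s = t := by
  obtain ⟨⟨x, a⟩, rfl⟩ := (Scheme.SpecToEquivOfField k X).symm.surjective s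
  obtain ⟨⟨y, b⟩, rfl⟩ := (Scheme.SpecToEquivOfField k X).symm.surjective t
  obtain rfl : x = y := 
    ((X.fromSpecResidueField_apply x _).symm.trans h).trans (X.fromSpecResidueField_apply y _)
  have key (c : X.residueField x ⟶ CommRingCat.of k)
      (hc : (Scheme.SpecToEquivOfField k X).symm ⟨x, c⟩ ≫ g = 𝟙 _) (z : k) :
      c.hom (residueMap g x z) = z := by
    have h1 : Spec.map (CommRingCat.ofHom (c.hom.comp (residueMap g x))) =
        Spec.map (CommRingCat.ofHom (RingHom.id k)) := by
      rw [CommRingCat.ofHom_comp, Spec.map_comp]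
      change _ ≫ Spec.map (Spec.preimage _) = _
      rw [Spec.map_preimage]
      exact (Category.assoc _ _ _).symm.trans (hc.trans (Spec.map_id _).symm)
    exact congr_arg (fun f => f.hom z) (Spec.map_injective h1)
  have : a = b := by
    ext z
    -- The map from the residue field to `k` is injective with the structure map as a right inverse,
    -- so it is determined by the point.
    have hz : residueMap g x (a.hom z) = z := a.hom.injective (key a hs _)
    rw [← hz]
    exact (key a hs _).trans (key b ht _).symm
  rw [this]

section

variable {k : Type u} [Field k] {X : Scheme.{u}} {φ : projSpace 1 k ⟶ X}

/-- The nonempty open set over which `φ` is an isomorphism contains the generic point; the image of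
`φ` is closed and contains a dense open set, hence is everything. -/
theorem IsNormalization.exists_isOpenImmersion (hφ : IsNormalization φ) :
    ∃ V : (projSpace 1 k).Opens, projGeneric k 1 ∈ V ∧ IsOpenImmersion (V.ι ≫ φ) ∧
      Function.Surjective φ := by
  obtain ⟨U, hU, hV, hiso⟩ := hφ.birational
  have := hφ.finite
  refine ⟨φ ⁻¹ᵁ U, ?_, ?_, ?_⟩
  · obtain ⟨y, hy⟩ := hV.nonempty
    exact (projGeneric_specializes y).mem_open (φ ⁻¹ᵁ U).isOpen hy
  · rw [← morphismRestrict_ι]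
    infer_instance
  · rw [← Set.range_eq_univ, ← φ.isClosedMap.isClosed_range.closure_eq, ← Set.univ_subset_iff,
      ← hU.closure_eq]
    refine closure_mono fun x hx => ?_
    obtain ⟨y, hy⟩ := (φ ∣_ U).surjective ⟨x, hx⟩
    refine ⟨y.1, ?_⟩
    have := congr_arg (fun f => f y) (morphismRestrict_ι φ U)
    exact this.symm.trans (congr_arg Subtype.val hy)

/-- Such points are images of the closed complement of the isomorphism locus, which is finite. -/
theorem IsNormalization.finite_setOf_not_isRegularLocalRing (hφ : IsNormalization φ) :
    {x : X | ¬ IsRegularLocalRing (X.presheaf.stalk x)}.Finite := by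
  obtain ⟨V, hV, hopen, hsurj⟩ := hφ.exists_isOpenImmersion
  refine ((finite_of_isClosed V.isOpen.isClosed_compl (fun h => h hV)).image φ).subset fun x hx => ?_
  obtain ⟨y, rfl⟩ := hsurj x
  refine ⟨y, fun hy => hx ?_, rfl⟩
  have h1 := (isRegularLocalRing_stalk_iff V.ι ⟨y, hy⟩).mpr inferInstance
  exact (isRegularLocalRing_stalk_iff (V.ι ≫ φ) ⟨y, hy⟩).mp h1

theorem IsNormalization.eq_or_isClosed (hφ : IsNormalization φ) (x : X) :
    x = φ (projGeneric k 1) ∨ IsClosed {x} := by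
  obtain ⟨V, hV, hopen, hsurj⟩ := hφ.exists_isOpenImmersion
  have := hφ.finite
  obtain ⟨y, rfl⟩ := hsurj x
  by_cases hy : y = projGeneric k 1
  · exact .inl (hy ▸ rfl)
  · right
    rw [← Set.image_singleton]
    refine φ.isClosedMap _ ?_
    rw [← closure_subset_iff_isClosed]
    intro z hz
    exact (eq_of_specializes (specializes_iff_mem_closure.mpr hz) hy).symm

theorem IsNormalization.specializes (hφ : IsNormalization φ) (x : X) :
    φ (projGeneric k 1) ⤳ x := by
  obtain ⟨V, hV, hopen, hsurj⟩ := hφ.exists_isOpenImmersion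
  obtain ⟨y, rfl⟩ := hsurj x
  exact (projGeneric_specializes y).map φ.continuous

theorem IsNormalization.fromSpecStalk_bot (hφ : IsNormalization φ) (x : X)
    [IsDomain (X.presheaf.stalk x)] :
    X.fromSpecStalk x (⊥ : PrimeSpectrum (X.presheaf.stalk x)) = φ (projGeneric k 1) := by
  have h1 : φ (projGeneric k 1) ∈ Set.range (X.fromSpecStalk x) := by
    rw [Scheme.range_fromSpecStalk]
    exact hφ.specializes x
  obtain ⟨p, hp⟩ := h1
  refine (Specializes.antisymm (Specializes.trans ?_ (specializes_of_eq hp))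
    (hφ.specializes _)).eq
  exact ((PrimeSpectrum.le_iff_specializes _ _).mp bot_le).map (X.fromSpecStalk x).continuous

/-- All points but the generic one are closed, so the local ring has dimension at most one;
regularity then makes its cotangent space at most one-dimensional. -/
theorem IsNormalization.valuationRing_stalk (hφ : IsNormalization φ) (x : X)
    [IsDomain (X.presheaf.stalk x)] [IsRegularLocalRing (X.presheaf.stalk x)] :
    ValuationRing (X.presheaf.stalk x) := by
  have hdim : Ring.KrullDimLE 1 (X.presheaf.stalk x) := by
    refine Ring.krullDimLE_one_iff_of_isPrime_bot.mpr fun P hP hprime => ?_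
    let p : PrimeSpectrum (X.presheaf.stalk x) := ⟨P, hprime⟩
    have hinj := (X.fromSpecStalk x).isEmbedding.injective
    have h1 : IsClosed {X.fromSpecStalk x p} := by
      refine (hφ.eq_or_isClosed _).resolve_left fun h => hP ?_
      exact congr_arg PrimeSpectrum.asIdeal (hinj (h.trans (hφ.fromSpecStalk_bot x).symm))
    have h2 : p ⤳ IsLocalRing.closedPoint _ := IsLocalRing.specializes_closedPoint p
    have h3 := (h2.map (X.fromSpecStalk x).continuous).mem_closed h1 rfl
    have h4 := congr_arg PrimeSpectrum.asIdeal (hinj h3)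
    exact (show _ = P from h4) ▸ IsLocalRing.maximalIdeal.isMaximal _
  refine ((tfae_of_isNoetherianRing_of_isLocalRing_of_isDomain (X.presheaf.stalk x)).out 5 1).mp ?_
  have := Ring.krullDimLE_iff.mp hdim
  rw [← (IsRegularLocalRing.iff_finrank_cotangentSpace _).mp inferInstance] at this
  exact_mod_cast this

/-- The generic point of the local scheme lies where `φ` is an open immersion, so it lifts; the
valuative criterion for the finite, hence proper, map `φ` extends this lift over the valuation ring.
-/
theorem IsNormalization.exists_lift_fromSpecStalk (hφ : IsNormalization φ) (x : X)
    [IsDomain (X.presheaf.stalk x)] [IsRegularLocalRing (X.presheaf.stalk x)] :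
    ∃ l, l ≫ φ = X.fromSpecStalk x := by
  obtain ⟨V, hV, hopen, -⟩ := hφ.exists_isOpenImmersion
  have := hφ.finite
  have := hφ.valuationRing_stalk x
  let F := FractionRing (X.presheaf.stalk x)
  let j : Spec (CommRingCat.of F) ⟶ X :=
    Spec.map (CommRingCat.ofHom (algebraMap (X.presheaf.stalk x) F)) ≫ X.fromSpecStalk x
  have hj : Set.range j ⊆ Set.range (V.ι ≫ φ) := by
    rintro _ ⟨z, rfl⟩
    refine ⟨(⟨projGeneric k 1, hV⟩ : V), ?_⟩
    have h1 : Spec.map (CommRingCat.ofHom (algebraMap (X.presheaf.stalk x) F)) z =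
        (⊥ : PrimeSpectrum (X.presheaf.stalk x)) :=
      (specGeneric_apply (R := X.presheaf.stalk x) (k := F) z).trans
        (genericPoint_eq_bot_of_affine _)
    exact (hφ.fromSpecStalk_bot x).symm.trans (congr_arg (X.fromSpecStalk x) h1).symm
  let S : ValuativeCommSq φ :=
    { R := X.presheaf.stalk x
      commRing := (X.presheaf.stalk x).commRing
      domain := ‹_›
      valuationRing := ‹_›
      K := F
      i₁ := IsOpenImmersion.lift (V.ι ≫ φ) j hj ≫ V.ι
      i₂ := X.fromSpecStalk x
      commSq := ⟨(Category.assoc _ _ _).trans (IsOpenImmersion.lift_fac _ _ _)⟩ }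
  have hval : ValuativeCriterion φ := by
    have h : IsProper φ := inferInstance
    rw [IsProper.eq_valuativeCriterion] at h
    exact h.1.1.1
  obtain ⟨⟨l⟩⟩ := hval.existence S
  exact ⟨l.l, l.fac_right⟩

/-- Sections of a curve over a field lift to the normalization at regular points. -/
theorem IsNormalization.exists_lift (hφ : IsNormalization φ) (σ : Spec (CommRingCat.of k) ⟶ X)
    [IsDomain (X.presheaf.stalk (σ (IsLocalRing.closedPoint k)))]
    [IsRegularLocalRing (X.presheaf.stalk (σ (IsLocalRing.closedPoint k)))] :
    ∃ τ, τ ≫ φ = σ := by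
  obtain ⟨l, hl⟩ := hφ.exists_lift_fromSpecStalk (σ (IsLocalRing.closedPoint k))
  refine ⟨Spec.map (Scheme.stalkClosedPointTo σ) ≫ l, ?_⟩
  rw [Category.assoc]
  exact (congr_arg (_ ≫ ·) hl).trans (Scheme.Spec_stalkClosedPointTo_fromSpecStalk σ)

end
end LogCurves

/-! ### Rational points of the torus and of the generic fibre. -/

namespace LogCurves

universe u

attribute [local instance] MvPolynomial.gradedAlgebra

open HomogeneousLocalization

section

variable {k : Type u} [Field k] {n : ℕ} {F : MvPolynomial (Fin (n + 1)) k} {d : ℕ}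
  (hF : F ∈ polyGrading k n d) (hd : 0 < d)

theorem specMap_comp_complementι_comp {χ : Away (polyGrading k n) F →+* k}
    (hχ : χ.comp (awayConst F) = RingHom.id k) :
    (Spec.map (CommRingCat.ofHom χ) ≫ complementι hF hd) ≫ projSpaceStr n k = 𝟙 _ := by
  rw [Category.assoc, complementι_comp_projSpaceStr, ← Spec.map_comp, ← CommRingCat.ofHom_comp, hχ]
  exact Spec.map_id _

theorem specMap_comp_complementι_injective {χ χ' : Away (polyGrading k n) F →+* k}
    (h : Spec.map (CommRingCat.ofHom χ) ≫ complementι hF hd =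
      Spec.map (CommRingCat.ofHom χ') ≫ complementι hF hd) : χ = χ' := by
  rw [cancel_mono] at h
  exact congr_arg CommRingCat.Hom.hom (Spec.map_injective h)

theorem eq_of_apply_closedPoint_eq {χ χ' : Away (polyGrading k n) F →+* k}
    (hχ : χ.comp (awayConst F) = RingHom.id k) (hχ' : χ'.comp (awayConst F) = RingHom.id k)
    (h : (Spec.map (CommRingCat.ofHom χ) ≫ complementι hF hd) (IsLocalRing.closedPoint k) =
      (Spec.map (CommRingCat.ofHom χ') ≫ complementι hF hd) (IsLocalRing.closedPoint k)) :
    χ = χ' :=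
  specMap_comp_complementι_injective hF hd <|
    section_ext (specMap_comp_complementι_comp hF hd hχ) (specMap_comp_complementι_comp hF hd hχ') h

theorem exists_character {τ : Spec (CommRingCat.of k) ⟶ projSpace n k}
    (hτ : τ ≫ projSpaceStr n k = 𝟙 _) (h : F ∉ pointIdeal (τ (IsLocalRing.closedPoint k))) :
    ∃ χ : Away (polyGrading k n) F →+* k, χ.comp (awayConst F) = RingHom.id k ∧
      Spec.map (CommRingCat.ofHom χ) ≫ complementι hF hd = τ := by
  have hrange : Set.range τ ⊆ Set.range (complementι hF hd) := by
    rintro _ ⟨z, rfl⟩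
    rw [mem_range_complementι]
    obtain rfl : IsLocalRing.closedPoint k = z :=
      Subsingleton.elim (α := PrimeSpectrum k) _ _
    exact h
  let χ := (Spec.preimage (IsOpenImmersion.lift (complementι hF hd) τ hrange)).hom
  have hχ : Spec.map (CommRingCat.ofHom χ) = IsOpenImmersion.lift (complementι hF hd) τ hrange :=
    Spec.map_preimage _
  have hχτ : Spec.map (CommRingCat.ofHom χ) ≫ complementι hF hd = τ := by
    rw [hχ, IsOpenImmersion.lift_fac]
  refine ⟨χ, ?_, hχτ⟩
  have : Spec.map (CommRingCat.ofHom (χ.comp (awayConst F))) =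
      Spec.map (CommRingCat.ofHom (RingHom.id k)) := by
    rw [CommRingCat.ofHom_comp, Spec.map_comp, ← complementι_comp_projSpaceStr hF hd,
      ← Category.assoc, hχτ, hτ]
    exact (Spec.map_id _).symm
  exact congr_arg CommRingCat.Hom.hom (Spec.map_injective this)

theorem infinite_projSpace (k : Type u) [Field k] [Infinite k] : Infinite (projSpace 1 k) := by
  have hv (a : k) : MvPolynomial.eval ![1, a] (MvPolynomial.X 0 : MvPolynomial (Fin 2) k) ≠ 0 := by
    simp
  refine Infinite.of_injective (fun a : k =>
    (Spec.map (CommRingCat.ofHom (evalAway _ (hv a))) ≫ complementι (X_mem 0) one_pos)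
      (IsLocalRing.closedPoint k)) fun a b hab => ?_
  have h := eq_of_apply_closedPoint_eq (X_mem 0) one_pos (evalAway_comp_awayConst _)
    (evalAway_comp_awayConst _) hab
  have h1 := congr_arg (fun f => f (affineCoord k 0 1)) h
  simpa [affineCoord, evalAway_mk] using h1

end

namespace LogScheme

variable {R k : Type u} [CommRing R] [IsDomain R] [Field k] [Algebra R k] [IsFractionRing R k]
  (L : LogScheme R)

instance : IsPreimmersion (L.genericFiberFst k) :=
  inferInstanceAs (IsPreimmersion (pullback.fst L.str (specGeneric R k)))

instance : Flat (L.genericFiberFst k) :=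
  inferInstanceAs (Flat (pullback.fst L.str (specGeneric R k)))

variable {L}

variable (k) in
/-- The rational point of the generic fibre defined by an integral point. -/
noncomputable def IntegralPoints.generic (s : L.IntegralPoints) :
    Spec (CommRingCat.of k) ⟶ L.genericFiber k :=
  pullback.lift (specGeneric R k ≫ s.1 ≫ L.openPart.ι) (𝟙 _) (by
    rw [Category.assoc, Category.assoc, s.2, Category.id_comp]
    exact Category.comp_id _)

omit [IsDomain R] [IsFractionRing R k] in
theorem IntegralPoints.generic_fst (s : L.IntegralPoints) :
    s.generic k ≫ L.genericFiberFst k = specGeneric R k ≫ s.1 ≫ L.openPart.ι :=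
  pullback.lift_fst _ _ _

omit [IsDomain R] [IsFractionRing R k] in
theorem IntegralPoints.generic_str (s : L.IntegralPoints) :
    s.generic k ≫ L.genericFiberStr k = 𝟙 _ :=
  pullback.lift_snd _ _ _

theorem IntegralPoints.generic_injective :
    Function.Injective fun s : L.IntegralPoints => s.generic k := by
  intro s t h
  have h1 : specGeneric R k ≫ s.1 ≫ L.openPart.ι = specGeneric R k ≫ t.1 ≫ L.openPart.ι := by
    rw [← s.generic_fst, ← t.generic_fst]
    exact congr_arg (· ≫ _) h
  have := L.isSeparated
  rw [← Category.assoc, ← Category.assoc, cancel_mono] at h1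
  exact Subtype.ext <| hom_ext_of_apply_eq_genericPoint (L.openPart.ι ≫ L.str)
    (s.2.trans t.2.symm) (specGeneric R k) (𝟙 (Spec (CommRingCat.of R)))
    (IsLocalRing.closedPoint k) (specGeneric_apply _) h1

theorem IntegralPoints.generic_apply_injective :
    Function.Injective fun s : L.IntegralPoints => s.generic k (IsLocalRing.closedPoint k) :=
  fun s t h => generic_injective (section_ext s.generic_str t.generic_str h)

theorem IntegralPoints.genericFiberFst_generic_apply (s : L.IntegralPoints) :
    L.genericFiberFst k (s.generic k (IsLocalRing.closedPoint k)) =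
      (s.1 ≫ L.openPart.ι) (genericPoint (Spec (CommRingCat.of R))) :=
  (congr_arg (fun f => f (IsLocalRing.closedPoint k)) s.generic_fst).trans
    (congr_arg (s.1 ≫ L.openPart.ι) (specGeneric_apply _))

/-- Passing to the generic fibre does not change local rings, so regularity can be tested there. -/
theorem IntegralPoints.genericallyRegular_iff (s : L.IntegralPoints) :
    s.GenericallyRegular ↔ IsRegularLocalRing
      ((L.genericFiber k).presheaf.stalk (s.generic k (IsLocalRing.closedPoint k))) := by
  rw [isRegularLocalRing_stalk_iff (L.genericFiberFst k), s.genericFiberFst_generic_apply]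
  rfl

theorem IntegralPoints.generic_apply_notMem (s : L.IntegralPoints) :
    s.generic k (IsLocalRing.closedPoint k) ∉ L.genericDivisor k := by
  intro h
  have h1 : L.genericFiberFst k (s.generic k (IsLocalRing.closedPoint k)) ∈ L.openPart := by
    rw [s.genericFiberFst_generic_apply]
    exact (s.1 (genericPoint (Spec (CommRingCat.of R)))).2
  exact h1 h

theorem isDomain_stalk_genericFiber [IsIntegral L.X] (x : L.genericFiber k) :
    IsDomain ((L.genericFiber k).presheaf.stalk x) :=
  (RingEquiv.ofBijective _ (bijective_stalkMap (L.genericFiberFst k) x)).isDomain_iff.mp inferInstance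

end LogScheme

end LogCurves

/-! ### Assembly for toroidal curves. -/

namespace LogCurves

universe u

attribute [local instance] MvPolynomial.gradedAlgebra

open HomogeneousLocalization

namespace ToroidalCurve

section

variable {R k : Type u} [CommRing R] [IsDedekindDomain R] [Field k] [Algebra R k]
  [IsFractionRing R k] (C : ToroidalCurve R k)

/-- A closed set containing the generic point is the whole line, which is infinite. -/
theorem projGeneric_notMem [Infinite k] : projGeneric k 1 ∉ C.φ ⁻¹' C.genericDivisor k := by
  intro h
  have := C.isClosedImmersion
  have hcl : IsClosed (C.φ ⁻¹' C.genericDivisor k) :=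
    (C.incl.isClosedEmbedding.isClosed_range.preimage
      (C.genericFiberFst k).continuous).preimage C.φ.continuous
  have hinf := infinite_projSpace k
  refine Set.infinite_univ (C.finite_preimage.subset fun y _ => ?_)
  exact (projGeneric_specializes y).mem_closed hcl h

theorem exists_torusForm [Infinite k] {K : Type*} [Field K] [Algebra k K]
    [Algebra.IsSeparable k K] (hK : C.IsSplittingField K) :
    ∃ T : TorusForm k K, ∀ y, T.form ∈ pointIdeal y ↔ y ∈ C.φ ⁻¹' C.genericDivisor k := by
  obtain ⟨x, hx, e, he⟩ := hK
  exact LogCurves.exists_torusForm C.projGeneric_notMem C.finite_preimage C.degree_eq_two hx e he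

variable {K : Type*} [Field K] [Algebra k K] (T : TorusForm k K)
  (hT : ∀ y, T.form ∈ pointIdeal y ↔ y ∈ C.φ ⁻¹' C.genericDivisor k)

/-- The inclusion of the torus `ℙ¹ ∖ φ⁻¹(D)` into the projective line. -/
noncomputable abbrev _root_.LogCurves.TorusForm.ι :
    Spec (CommRingCat.of (Away (polyGrading k 1) T.form)) ⟶ projSpace 1 k :=
  complementι (quadForm_mem T.c) two_pos

include hT in
theorem range_torus : Set.range T.ι = (C.φ ⁻¹' C.genericDivisor k)ᶜ := by
  ext y
  rw [mem_range_complementι, hT]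
  rfl

/-- The map from the torus `ℙ¹ ∖ φ⁻¹(D)` to the complement of the divisor. -/
noncomputable def torusMap :
    Spec (CommRingCat.of (Away (polyGrading k 1) T.form)) ⟶ (C.openPart : Scheme.{u}) :=
  IsOpenImmersion.lift C.openPart.ι (T.ι ≫ C.φ ≫ C.genericFiberFst k) (by
    rw [Scheme.Opens.range_ι]
    rintro _ ⟨z, rfl⟩
    have h := Set.mem_range_self (f := T.ι) z
    rw [C.range_torus T hT] at h
    exact h)

theorem torusMap_ι :
    C.torusMap T hT ≫ C.openPart.ι = T.ι ≫ C.φ ≫ C.genericFiberFst k :=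
  IsOpenImmersion.lift_fac _ _ _

theorem torusMap_comp : C.torusMap T hT ≫ C.openPart.ι ≫ C.str =
    Spec.map (CommRingCat.ofHom (awayConst _)) ≫ specGeneric R k := by
  have h : C.genericFiberFst k ≫ C.str = C.genericFiberStr k ≫ specGeneric R k :=
    pullback.condition
  rw [reassoc_of% C.torusMap_ι T hT, h, reassoc_of% C.φ_over, reassoc_of% complementι_comp_projSpaceStr]

/-- The torus is the preimage under `φ` of the open part of the generic fibre, so its map to that
open part is a base change of a finite morphism. -/
theorem exists_isIntegralHom :
    ∃ q : Spec (CommRingCat.of (Away (polyGrading k 1) T.form)) ⟶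
        pullback (C.openPart.ι ≫ C.str) (specGeneric R k),
      IsIntegralHom q ∧ q ≫ pullback.fst _ _ = C.torusMap T hT ∧
      q ≫ pullback.snd _ _ = Spec.map (CommRingCat.ofHom (awayConst _)) := by
  let q : Spec (CommRingCat.of (Away (polyGrading k 1) T.form)) ⟶
      pullback C.openPart.ι (C.genericFiberFst k) :=
    pullback.lift (C.torusMap T hT) (T.ι ≫ C.φ) (by rw [torusMap_ι, Category.assoc])
  have hq : IsPullback q T.ι (pullback.snd C.openPart.ι (C.genericFiberFst k)) C.φ := by
    refine IsOpenImmersion.isPullback _ _ _ _ (pullback.lift_snd _ _ _).symm ?_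
    ext1
    change C.φ ⁻¹' Set.range _ = Set.range T.ι
    rw [C.range_torus T hT, IsOpenImmersion.range_pullbackSnd, Scheme.Opens.opensRange_ι]
    rfl
  have := C.φ_normalization.finite
  have hint : IsIntegralHom q := MorphismProperty.of_isPullback hq.flip inferInstance
  refine ⟨q ≫ (pullbackRightPullbackFstIso C.str (specGeneric R k) C.openPart.ι).hom, ?_, ?_, ?_⟩
  · have hiso : IsIntegralHom
        (pullbackRightPullbackFstIso C.str (specGeneric R k) C.openPart.ι).hom := inferInstance
    exact MorphismProperty.comp_mem @IsIntegralHom q _ hint hiso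
  · exact (Category.assoc _ _ _).trans ((congr_arg (q ≫ ·)
      (pullbackRightPullbackFstIso_hom_fst _ _ _)).trans (pullback.lift_fst _ _ _))
  · refine (Category.assoc _ _ _).trans ((congr_arg (q ≫ ·)
      (pullbackRightPullbackFstIso_hom_snd _ _ _)).trans ?_)
    refine (Category.assoc _ _ _).symm.trans ((congr_arg (· ≫ _) (pullback.lift_snd _ _ _)).trans ?_)
    exact (Category.assoc _ _ _).trans ((congr_arg (T.ι ≫ ·) C.φ_over).trans
      (complementι_comp_projSpaceStr _ _))

include hT in
theorem exists_character_of_genericallyRegular {s : C.IntegralPoints} (hs : s.GenericallyRegular) :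
    ∃ χ : Away (polyGrading k 1) T.form →+* k, χ.comp (awayConst _) = RingHom.id k ∧
      (Spec.map (CommRingCat.ofHom χ) ≫ T.ι) ≫ C.φ = s.generic k := by
  have := C.integral
  have h1 := (s.genericallyRegular_iff (k := k)).mp hs
  have h2 := LogScheme.isDomain_stalk_genericFiber (s.generic k (IsLocalRing.closedPoint k))
  obtain ⟨τ, hτ⟩ := C.φ_normalization.exists_lift (s.generic k)
  have hτs : τ ≫ projSpaceStr 1 k = 𝟙 _ := by
    rw [← C.φ_over, ← Category.assoc, hτ, s.generic_str]
  obtain ⟨χ, hχ, hχτ⟩ := exists_character (quadForm_mem T.c) two_pos hτs (by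
    rw [hT]
    intro h
    refine s.generic_apply_notMem (k := k) ?_
    rw [← hτ]
    exact h)
  exact ⟨χ, hχ, by rw [← hτ, ← hχτ]⟩

theorem specGeneric_comp_eq {s : C.IntegralPoints} {χ : Away (polyGrading k 1) T.form →+* k}
    (h : (Spec.map (CommRingCat.ofHom χ) ≫ T.ι) ≫ C.φ = s.generic k) :
    specGeneric R k ≫ s.1 = Spec.map (CommRingCat.ofHom χ) ≫ C.torusMap T hT := by
  rw [← cancel_mono C.openPart.ι, Category.assoc, Category.assoc, torusMap_ι, ← s.generic_fst, ← h,
    Category.assoc, Category.assoc]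

theorem infinite_setOf_genericallyRegular [Infinite C.IntegralPoints] :
    {s : C.IntegralPoints | s.GenericallyRegular}.Infinite := by
  have hfin : {s : C.IntegralPoints | ¬ s.GenericallyRegular}.Finite := by
    refine (C.φ_normalization.finite_setOf_not_isRegularLocalRing.preimage
      (LogScheme.IntegralPoints.generic_apply_injective (k := k)).injOn).subset fun s hs => ?_
    exact fun h => hs ((s.genericallyRegular_iff (k := k)).mpr h)
  exact fun h => Set.infinite_univ ((h.union hfin).subset fun s _ => em _)

/-- The finite morphism `φ` has finite fibres, and a rational point of the torus is determined by
its image in the line. -/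
theorem finite_setOf_comp_torusMap_eq (t : Spec (CommRingCat.of k) ⟶ C.openPart) :
    {χ : Away (polyGrading k 1) T.form →+* k | χ.comp (awayConst _) = RingHom.id k ∧
      Spec.map (CommRingCat.ofHom χ) ≫ C.torusMap T hT = t}.Finite := by
  have := C.φ_normalization.finite
  let pt (χ : Away (polyGrading k 1) T.form →+* k) : projSpace 1 k :=
    (Spec.map (CommRingCat.ofHom χ) ≫ T.ι) (IsLocalRing.closedPoint k)
  refine Set.Finite.of_finite_image (f := pt) ?_ fun χ hχ χ' hχ' h =>
    eq_of_apply_closedPoint_eq _ _ hχ.1 hχ'.1 h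
  have hpt : ∀ χ, Spec.map (CommRingCat.ofHom χ) ≫ C.torusMap T hT = t →
      C.genericFiberFst k (C.φ (pt χ)) = (t ≫ C.openPart.ι) (IsLocalRing.closedPoint k) := by
    rintro χ rfl
    have : (Spec.map (CommRingCat.ofHom χ) ≫ C.torusMap T hT) ≫ C.openPart.ι =
        (Spec.map (CommRingCat.ofHom χ) ≫ T.ι) ≫ C.φ ≫ C.genericFiberFst k := by
      rw [Category.assoc, torusMap_ι, Category.assoc]
    rw [this]
    rfl
  rcases Set.eq_empty_or_nonempty {χ : Away (polyGrading k 1) T.form →+* k |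
    χ.comp (awayConst _) = RingHom.id k ∧
      Spec.map (CommRingCat.ofHom χ) ≫ C.torusMap T hT = t} with h | ⟨χ₀, h₀⟩
  · rw [h]; simp
  · refine (C.φ.finite_preimage_singleton (C.φ (pt χ₀))).subset ?_
    rintro _ ⟨χ, hχ, rfl⟩
    exact (C.genericFiberFst k).isEmbedding.injective
      ((hpt χ hχ.2).trans (hpt χ₀ h₀.2).symm)

end

section

variable {k : Type u} [Field k] [NumberField k] (C : ToroidalCurve (𝓞 k) k)
  {K : Type*} [Field K] [NumberField K] [Algebra k K]

theorem infinite_units_and_exists_placeSplits (hK : C.IsSplittingField K)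
    [Infinite C.IntegralPoints] :
    Infinite (𝓞 K)ˣ ∧
      (Module.finrank k K = 2 → ∃ v : InfinitePlace k, PlaceSplits (K := K) v) := by
  obtain ⟨T, hT⟩ := C.exists_torusForm hK
  have hinf := C.infinite_setOf_genericallyRegular
  have := hinf.to_subtype
  choose χ hχ hχs using fun s : {s : C.IntegralPoints | s.GenericallyRegular} =>
    C.exists_character_of_genericallyRegular T hT s.2
  have hinj : Function.Injective χ := fun s t h => Subtype.ext <|
    LogScheme.IntegralPoints.generic_injective (k := k) (by
      change s.1.generic k = t.1.generic k
      rw [← hχs, ← hχs, h])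
  refine T.infinite_units_and_exists_placeSplits (Set.infinite_range_of_injective hinj)
    (by rintro _ ⟨s, rfl⟩; exact hχ s) fun z => ?_
  obtain ⟨q, hint, hq1, hq2⟩ := C.exists_isIntegralHom T hT
  have := C.quasiCompact
  have := C.locallyOfFiniteType
  have : IsLocallyNoetherian C.X := LocallyOfFiniteType.isLocallyNoetherian C.str
  have : QuasiCompact (C.openPart.ι ≫ C.str) := inferInstance
  obtain ⟨c, hc, h⟩ := exists_denominator (C.openPart.ι ≫ C.str) (awayConst _) q hq2 z
  refine ⟨c, hc, ?_⟩
  rintro _ ⟨s, rfl⟩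
  refine h _ (hχ s) s.1.1 s.1.2 ?_
  rw [hq1]
  exact C.specGeneric_comp_eq T hT (hχs s)

theorem infinite_integralPoints (hK : C.IsSplittingField K) {s : C.IntegralPoints}
    (hs : s.GenericallyRegular) (hunits : Infinite (𝓞 K)ˣ)
    (hsplit : Module.finrank k K = 2 → ∃ v : InfinitePlace k, PlaceSplits (K := K) v) :
    Infinite C.IntegralPoints := by
  obtain ⟨T, hT⟩ := C.exists_torusForm hK
  obtain ⟨χ₀, hχ₀, hχ₀s⟩ := C.exists_character_of_genericallyRegular T hT hs
  obtain ⟨v₀, hv₀, rfl⟩ := exists_eq_evalAway _ _ hχ₀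
  have := C.isSeparated
  have := C.locallyOfFiniteType
  obtain ⟨N, hN, h⟩ := exists_localized_section (C.openPart.ι ≫ C.str) (awayConst _)
    (C.torusMap T hT) (C.torusMap_comp T hT) (T.unitTranslates v₀)
    (fun _ _ h => T.unitTranslates_anti v₀ h)
    (fun _ _ h => T.comp_awayConst_of_mem_unitTranslates h) _ hχ₀ s.1
    (C.specGeneric_comp_eq T hT hχ₀s)
    (fun b => (T.exists_bound hv₀ b).imp fun _ h => ⟨h.1, h.2.1⟩)
    (fun b => (T.exists_bound hv₀ b).imp fun _ h => ⟨h.1, h.2.2⟩)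
  choose t ht htχ using h
  by_contra hfin
  rw [not_infinite_iff_finite] at hfin
  -- Each integral point comes from only finitely many translates, so finitely many integral points
  -- would leave only finitely many translates.
  refine T.infinite_unitTranslates hunits hsplit hv₀ hN ((Set.finite_iUnion fun r : C.IntegralPoints =>
    C.finite_setOf_comp_torusMap_eq T hT (specGeneric _ k ≫ r.1)).subset fun χ hχ => ?_)
  rw [Set.mem_iUnion]
  exact ⟨⟨t χ hχ, ht χ hχ⟩, T.comp_awayConst_of_mem_unitTranslates hχ, (htχ χ hχ).symm⟩

end

end ToroidalCurve

end LogCurves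

theorem corollary2p11 {k : Type*} [Field k] [NumberField k]
    (C : LogCurves.ToroidalCurve (𝓞 k) k)
    {K : Type*} [Field K] [NumberField K] [Algebra k K] (hK : C.IsSplittingField K) :
    (Infinite C.IntegralPoints ↔
      (∃ x : C.IntegralPoints, x.GenericallyRegular) ∧
      Infinite (𝓞 K)ˣ ∧
      (Module.finrank k K = 2 → ∃ v : InfinitePlace k, LogCurves.PlaceSplits (K := K) v)) ∧
    (Infinite (𝓞 K)ˣ ↔ 1 < Fintype.card (InfinitePlace K)) ∧
    (Module.finrank k K = 2 →
      ((∃ v : InfinitePlace k, LogCurves.PlaceSplits (K := K) v) ↔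
        Fintype.card (InfinitePlace k) < Fintype.card (InfinitePlace K))) := by
  refine ⟨⟨fun h => ?_, fun ⟨⟨s, hs⟩, h⟩ => C.infinite_integralPoints hK hs h.1 h.2⟩,
    NumberField.Units.infinite_iff_one_lt_card, fun _ => exists_placeSplits_iff⟩
  exact ⟨C.infinite_setOf_genericallyRegular.nonempty, C.infinite_units_and_exists_placeSplits hK⟩
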